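/- Let $d\ge 2$ and $\Lambda\in[1,\infty)$. For $n\in\mathbb N=\{0,1,2,\dots\}$ put $$I_n=\left(-\tfrac{3^{2n}}2,\tfrac{3^{2n}}2\right),\qquad \square_n=\left(-\tfrac{3^n}2,\tfrac{3^n}2\right)^d,\qquad V_n=I_n\times\square_n\subset\mathbb R\times\mathbb R^d .$$ **Norms and spaces.** Let $V=I\times U$ be one of these cylinders; $\nabla$ is the gradient in the space variables, $(f)_E=|E|^{-1}\int_E f$ is the mean of $f$ over $E$, and underlined norms are normalized: $\|f\|_{\underline L^2(E)}=(|E|^{-1}\int_E|f|^2)^{1/2}$ and $\|f\|_{\underline H^1(U)}=|U|^{-1/d}\|f\|_{\underline L^2(U)}+\|\nabla f\|_{\underline L^2(U)}$. Let $H^{-1}(U)$ and $\hat H^{-1}(U)$ be the duals of $H^1_0(U)$ and $H^1(U)$, both with the dual norms of $\|\cdot\|_{\underline H^1(U)}$ for the normalized pairing that extends $(u,v)\mapsto(uv)_U$; for $X$ one of these spaces, $\|u\|_{\underline L^2(I;X)}=(|I|^{-1}\int_I\|u(t,\cdot)\|_X^2\,dt)^{1/2}$. Set $$H^1_{\mathrm{par}}(V)=\{u\in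 L^2(I;H^1(U)) : \partial_t u\in L^2(I;H^{-1}(U))\},\qquad \|u\|_{\underline H^1_{\mathrm{par}}(V)}=\|u\|_{\underline L^2(I;\underline H^1(U))}+\|\partial_t u\|_{\underline L^2(I;\underline H^{-1}(U))},$$ and let $H^1_{\mathrm{par},0}(V)$ be the completion of $C^\infty_c(V)$ for the norm $\|v\|_{\underline L^2(I;\underline H^1(U))}+\|\partial_t v\|_{\underline L^2(I;\underline{\hat H}^{-1}(U))}$. For $f\in L^2(V)$ put $$\|f\|_{\underline{\hat H}^{-1}_{\mathrm{par}}(V)}=\sup\left\{\frac1{|V|}\int_V fw : w\in H^1_{\mathrm{par}}(V),\ \|w\|_{\underline H^1_{\mathrm{par}}(V)}\le1\right\},$$ and for a vector-valued $f$ let this norm be the sum of the norms of the components. **Solution pairs.** Let $\mathbf a:\mathbb R\times\mathbb R^d\to\mathbb R^{d\times d}$ be Lebesgue measurable with $\xi\cdot\mathbf a(t,x)\xi\ge\Lambda^{-1}|\xi|^2$ and $|\mathbf a(t,x)\xi|\le\Lambda|\xi|$ for all $(t,x)$ and all $\xi\in\mathbb R^d$. Let $\mathbf s=\frac12(\mathbf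 a+\mathbf a^{t})$, $\mathbf m=\frac12(\mathbf a-\mathbf a^{t})$ and $$\mathbf A=\begin{pmatrix}\mathbf s-\mathbf m\mathbf s^{-1}\mathbf m & \mathbf m\mathbf s^{-1}\\ -\mathbf s^{-1}\mathbf m&\mathbf s^{-1}\end{pmatrix}.$$ Define $$\mathcal C(V)=\left\{(\nabla u,\mathbf g)\in L^2(V;\mathbb R^d)^2 : u\in H^1_{\mathrm{par}}(V),\ \int_V\nabla\phi\cdot\mathbf g=-\int_V\phi\,\partial_tu\ \ \forall\phi\in L^2(I;H^1_0(U))\right\},$$ $$\mathcal C_0(V)=\left\{(\nabla v,\mathbf h)\in L^2(V;\mathbb R^d)^2 : v\in H^1_{\mathrm{par},0}(V),\ \int_V\nabla\phi\cdot\mathbf h=-\int_V\phi\,\partial_tv\ \ \forall\phi\in L^2(I;H^1(U))\right\},$$ where the integrals containing $\partial_t u$, $\partial_t v$ denote the duality pairings, and $$\mathcal S(V)=\left\{S\in\mathcal C(V) : \int_V T\cdot\mathbf A S=0\ \ \forall\,T\in\mathcal C_0(V)\right\}.$$ **Proposition.** There exists a constant $C=C(d,\Lambda)<\infty$ such that,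 for every coefficient field $\mathbf a$ as above, every $n\in\mathbb N$ and every $S\in\mathcal S(V_{n+1})$, $$\|S\|_{\underline L^2(V_n)}\le C\,3^{-n}\,\|S\|_{\underline{\hat H}^{-1}_{\mathrm{par}}(V_{n+1})}.$$ -/

import Mathlib

open MeasureTheory Set Filter Topology
open scoped ENNReal ContDiff Matrix

noncomputable section

namespace ParHom

/-- The space variable. -/
abbrev Space (d : ℕ) := EuclideanSpace ℝ (Fin d)

/-- Time-space points `(t, x)`; the measure `volume` on it is Lebesgue measure. -/
abbrev TS (d : ℕ) := ℝ × Space d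

/-- The values of a pair `S = (∇u, g)`: the block `Sum.inl` carries `∇u`, the block `Sum.inr`
carries `g`. -/
abbrev PairVec (d : ℕ) := EuclideanSpace ℝ (Fin d ⊕ Fin d)

/-! ### Triadic cylinders -/

/-- The interval `(-3^{2n}/2, 3^{2n}/2)`. -/
def interval (n : ℕ) : Set ℝ := Ioo (-((3 : ℝ) ^ (2 * n) / 2)) ((3 : ℝ) ^ (2 * n) / 2)

/-- The cube `(-3^n/2, 3^n/2)^d`. -/
def cube (d n : ℕ) : Set (Space d) := {x | ∀ i, x i ∈ Ioo (-((3 : ℝ) ^ n / 2)) ((3 : ℝ) ^ n / 2)}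

/-! ### Normalized integrals and derivatives of smooth functions -/

/-- Normalized Lebesgue measure on `E`: integrating against it is the averaged integral over `E`,
and the `L²` norm with respect to it is the normalized (underlined) `L²` norm on `E`. -/
def nvol {α : Type*} [MeasureSpace α] (E : Set α) : Measure α :=
  (volume E)⁻¹ • volume.restrict E

/-- The time derivative of a smooth function. -/
def dt {d : ℕ} (φ : TS d → ℝ) (z : TS d) : ℝ := fderiv ℝ φ z (1, 0)

/-- The gradient in the space variables of a smooth function. -/
def grad {d : ℕ} (φ : TS d → ℝ) (z : TS d) : Space d :=
  WithLp.toLp 2 fun i => fderiv ℝ φ z (0, EuclideanSpace.single i 1)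

/-- Smooth functions with compact support in `V`. -/
structure IsTest {d : ℕ} (V : Set (TS d)) (φ : TS d → ℝ) : Prop where
  smooth : ContDiff ℝ ∞ φ
  compact : HasCompactSupport φ
  supp : tsupport φ ⊆ V

/-! ### Function spaces on a cylinder `I × U` -/

section Spaces

variable {d : ℕ} (I : Set ℝ) (U : Set (Space d))

/-- `w ∈ L²(I; H¹(U))` with weak spatial gradient `W`. -/
structure IsL2H1 (w : TS d → ℝ) (W : TS d → Space d) : Prop where
  memLp : MemLp w 2 (volume.restrict (I ×ˢ U))
  grad_memLp : MemLp W 2 (volume.restrict (I ×ˢ U))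
  weak_grad : ∀ φ, IsTest (I ×ˢ U) φ → ∀ i,
    ∫ z in I ×ˢ U, w z * grad φ z i = -∫ z in I ×ˢ U, W z i * φ z

/-- The normalized `H¹(U)` norm `|U|^{-1/d} ‖f‖_{L²(U)} + ‖F‖_{L²(U)}` of a function `f` with
gradient `F`. -/
def normH1 (f : Space d → ℝ) (F : Space d → Space d) : ℝ≥0∞ :=
  ENNReal.ofReal ((volume U).toReal ^ (-(1 / (d : ℝ)))) * eLpNorm f 2 (nvol U)
    + eLpNorm F 2 (nvol U)

/-- The normalized `L²(I; H¹(U))` norm of a function `w` with spatial gradient `W`. -/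
def normL2H1 (w : TS d → ℝ) (W : TS d → Space d) : ℝ≥0∞ :=
  (∫⁻ t, normH1 U (fun x => w (t, x)) (fun x => W (t, x)) ^ 2 ∂(nvol I)) ^ (1 / 2 : ℝ)

/-- The normalized norm of `∂ₜw` in `L²(I; H⁻¹(U))`. The latter is the (isometric) dual of
`L²(I; H¹₀(U))`, in which the smooth functions with compact support in `I × U` are dense; on these,
the distribution `∂ₜw` acts by `φ ↦ -⨍ w ∂ₜφ`. The value is `⊤` exactly if
`∂ₜw ∉ L²(I; H⁻¹(U))`. -/
def normDt (w : TS d → ℝ) : ℝ≥0∞ :=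
  ⨆ (φ : TS d → ℝ) (_ : IsTest (I ×ˢ U) φ) (_ : normL2H1 I U φ (grad φ) ≤ 1),
    ENNReal.ofReal (-∫ z, w z * dt φ z ∂(nvol (I ×ˢ U)))

/-- `w ∈ H¹_par(I × U)` with weak spatial gradient `W`: `w ∈ L²(I; H¹(U))` and
`∂ₜw ∈ L²(I; H⁻¹(U))`. -/
structure IsHpar (w : TS d → ℝ) (W : TS d → Space d) : Prop where
  l2h1 : IsL2H1 I U w W
  dt_finite : normDt I U w < ⊤

/-- The normalized `H¹_par(I × U)` norm. -/
def normHpar (w : TS d → ℝ) (W : TS d → Space d) : ℝ≥0∞ :=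
  normL2H1 I U w W + normDt I U w

/-- The normalized `Ĥ⁻¹_par(I × U)` norm of a scalar function `f`: the norm dual to
`H¹_par(I × U)`. -/
def normHatDual (f : TS d → ℝ) : ℝ≥0∞ :=
  ⨆ (w : TS d → ℝ) (W : TS d → Space d) (_ : IsHpar I U w W) (_ : normHpar I U w W ≤ 1),
    ENNReal.ofReal (∫ z, f z * w z ∂(nvol (I ×ˢ U)))

/-- The normalized `Ĥ⁻¹_par(I × U)` norm of a vector-valued function: the sum of the norms of its
components. -/
def normHatDualVec (S : TS d → PairVec d) : ℝ≥0∞ :=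
  ∑ k, normHatDual I U fun z => S z k

/-- `v ∈ H¹_{par,0}(I × U)`, with spatial gradient `G` and with time derivative
`∂ₜv = ℓ ∈ L²(I; Ĥ⁻¹(U))`, that is, `(v, G, ℓ)` is the limit of smooth functions `v k` with compact
support in `I × U`: `v k → v` and `∇(v k) → G` in `L²(I × U)`, and `∂ₜ(v k) → ℓ` in
`L²(I; Ĥ⁻¹(U))`, the dual of `L²(I; H¹(U))`. Here `ℓ φ Φ` is the value
`∫_I ⟨φ(t,·), ∂ₜv(t,·)⟩ dt` of the functional at `φ ∈ L²(I; H¹(U))` with spatial gradient `Φ`. -/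
def IsHparZero (v : TS d → ℝ) (G : TS d → Space d)
    (ℓ : (TS d → ℝ) → (TS d → Space d) → ℝ) : Prop :=
  IsL2H1 I U v G ∧
  ∃ vk : ℕ → TS d → ℝ, (∀ k, IsTest (I ×ˢ U) (vk k)) ∧
    Tendsto (fun k => eLpNorm (fun z => vk k z - v z) 2 (volume.restrict (I ×ˢ U))) atTop (𝓝 0) ∧
    Tendsto (fun k => eLpNorm (fun z => grad (vk k) z - G z) 2 (volume.restrict (I ×ˢ U)))
      atTop (𝓝 0) ∧
    ∀ ε : ℝ, 0 < ε → ∀ᶠ k in atTop, ∀ φ Φ, IsL2H1 I U φ Φ →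
      |(∫ z in I ×ˢ U, φ z * dt (vk k) z) - ℓ φ Φ| ≤ ε * (normL2H1 I U φ Φ).toReal

/-! ### Solution pairs -/

/-- The first block `∇u` of a pair `(∇u, g)`. -/
def gradPart (S : TS d → PairVec d) (z : TS d) : Space d :=
  WithLp.toLp 2 fun i => S z (Sum.inl i)

/-- The second block `g` of a pair `(∇u, g)`. -/
def fluxPart (S : TS d → PairVec d) (z : TS d) : Space d :=
  WithLp.toLp 2 fun i => S z (Sum.inr i)

/-- The space `𝒞(I × U)` of pairs `(∇u, g) ∈ L²` with `u ∈ H¹_par(I × U)` and `∂ₜu = ∇ · g`. The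
last identity is one between elements of the dual of `L²(I; H¹₀(U))`, and is tested against the
dense class of smooth compactly supported functions, for which `-⟨φ, ∂ₜu⟩ = ∫ u ∂ₜφ`. -/
def pairs : Set (TS d → PairVec d) :=
  {S | MemLp S 2 (volume.restrict (I ×ˢ U)) ∧
    ∃ u : TS d → ℝ, IsHpar I U u (gradPart S) ∧
      ∀ φ, IsTest (I ×ˢ U) φ →
        ∫ z in I ×ˢ U, ∑ i, grad φ z i * fluxPart S z i = ∫ z in I ×ˢ U, u z * dt φ z}

/-- The space `𝒞₀(I × U)` of pairs `(∇v, h) ∈ L²` with `v ∈ H¹_{par,0}(I × U)` and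
`∫ ∇φ · h = -∫ φ ∂ₜv` for every `φ ∈ L²(I; H¹(U))`. -/
def pairsZero : Set (TS d → PairVec d) :=
  {S | MemLp S 2 (volume.restrict (I ×ˢ U)) ∧
    ∃ (v : TS d → ℝ) (ℓ : (TS d → ℝ) → (TS d → Space d) → ℝ),
      IsHparZero I U v (gradPart S) ℓ ∧
      ∀ φ Φ, IsL2H1 I U φ Φ →
        ∫ z in I ×ˢ U, ∑ i, Φ z i * fluxPart S z i = -ℓ φ Φ}

end Spaces

/-- Lebesgue-measurable coefficient fields with values in the matrices `a` such that
`ξ · aξ ≥ Λ⁻¹|ξ|²` and `|aξ| ≤ Λ|ξ|` for every `ξ`. -/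
structure IsCoeffField {d : ℕ} (Λ : ℝ) (a : TS d → Matrix (Fin d) (Fin d) ℝ) : Prop where
  measurable : ∀ i j, AEMeasurable (fun z => a z i j) volume
  elliptic : ∀ z, ∀ ξ : Space d, Λ⁻¹ * ‖ξ‖ ^ 2 ≤ ξ.ofLp ⬝ᵥ a z *ᵥ ξ.ofLp
  bounded : ∀ z, ∀ ξ : Space d, ‖WithLp.toLp 2 (a z *ᵥ ξ.ofLp)‖ ≤ Λ * ‖ξ‖

/-- The symmetric part `s = (a + aᵗ)/2`. -/
def symPart {d : ℕ} (a : Matrix (Fin d) (Fin d) ℝ) : Matrix (Fin d) (Fin d) ℝ :=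
  (1 / 2 : ℝ) • (a + aᵀ)

/-- The skew-symmetric part `m = (a - aᵗ)/2`. -/
def skewPart {d : ℕ} (a : Matrix (Fin d) (Fin d) ℝ) : Matrix (Fin d) (Fin d) ℝ :=
  (1 / 2 : ℝ) • (a - aᵀ)

/-- The `2d × 2d` matrix with blocks `s - m s⁻¹ m`, `m s⁻¹`, `-s⁻¹ m`, `s⁻¹`. -/
def bigA {d : ℕ} (a : Matrix (Fin d) (Fin d) ℝ) : Matrix (Fin d ⊕ Fin d) (Fin d ⊕ Fin d) ℝ :=
  Matrix.fromBlocks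
    (symPart a - skewPart a * (symPart a)⁻¹ * skewPart a) (skewPart a * (symPart a)⁻¹)
    (-((symPart a)⁻¹ * skewPart a)) (symPart a)⁻¹

/-- The space `𝒮(I × U)` of the pairs `S ∈ 𝒞(I × U)` with `∫ T · 𝐀 S = 0` for all
`T ∈ 𝒞₀(I × U)`. -/
def solPairs {d : ℕ} (a : TS d → Matrix (Fin d) (Fin d) ℝ) (I : Set ℝ) (U : Set (Space d)) :
    Set (TS d → PairVec d) :=
  {S | S ∈ pairs I U ∧ ∀ T ∈ pairsZero I U,
    ∫ z in I ×ˢ U, (T z).ofLp ⬝ᵥ bigA (a z) *ᵥ (S z).ofLp = 0}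

end ParHom

end

noncomputable section

namespace ParHom

variable {d : ℕ}

/-! Let S = (p, g) with p = ∇u, and let f and q be the two blocks of 𝐀S. The block matrix is built
so that f = s p + m q and g = s q + m p. As m is skew, S · 𝐀S = p · s p + q · s q. Hence S · 𝐀S
controls |S|² from below and |𝐀S|² ≤ C|S|² (`bigA_bounds`). Testing the orthogonality against smooth
compactly supported pairs of 𝒞₀ gives curl q = 0 and ∂ₜq = ∇(∇ · f) (`WeakSol.of_solPairs`). The
space-time one-form (∇ · f) dt + q · dx is therefore closed, and q = ∇u*, ∂ₜu* = ∇ · f for a local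
potential u* (`exists_potential`), which is called `us` below.

With ∂ₜu = ∇ · g and ∂ₜu* = ∇ · f, expanding ∂ₜ(u u* ζ) gives, for a cutoff ζ, ∫ ζ S · 𝐀S = ∫ u u*
∂ₜζ - ∫ u f · ∇ζ - ∫ u* g · ∇ζ (`SmoothSol.energy_identity`). This is a Caccioppoli identity in
which u and u* may be shifted by constants. In the last integral g is tested against u* ∇ζ, which
lies in the parabolic H¹ space with norm bounded by the energy of 𝐀S; so that integral is at most
the weak norm N of S times the square root e of the energy (`SmoothSol.energy_le`).

The other two integrals need u - c to be small in L². Mollify u parabolically at scale δ. The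
derivative of the mollification in the scale is an average of p and g, because ∂ₜu = ∇ · g can be
integrated by parts; so u differs from its mollification by O(δ e) in L². The gradient of the
mollification consists of p and g tested against smooth kernels, hence is bounded by a negative
power of δ times N. Thus ‖u - c‖ ≤ C(δ e + δ^{-(d+5)} N) (`exists_osc_bound`, `exists_kernel_bound`,
`exists_weak_osc_bound`).

Consequently the energy at radius r is at most a small multiple of the energy at radius R plus a
negative power of R - r times N² (`exists_energy_step`). The small multiple is absorbed along a
sequence of radii (`le_of_absorb`), which is the interior estimate at unit scale
(`exists_interior_bound`). The radii are levels of a smooth convex gauge. As the fields are only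
square integrable, the energy step is proved for mollified fields and passed to the limit
(`exists_weak_energy_step`). A parabolic dilation by 3^n reduces the general case to unit scale, and
the factor 3^{-n} comes from the scaling of the dual norm (`weakBound_of_normHatDual`). -/

instance : (volume : Measure (TS d)).IsAddHaarMeasure :=
  inferInstanceAs ((volume : Measure ℝ).prod (volume : Measure (Space d))).IsAddHaarMeasure

/-- The derivative of `φ` in the direction `v`. -/
def dir (v : TS d) (φ : TS d → ℝ) (z : TS d) : ℝ := fderiv ℝ φ z v

/-- The unit vector of the time direction. -/
def et : TS d := (1, 0)

/-- The unit vectors of the space directions. -/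
def ex (i : Fin d) : TS d := (0, EuclideanSpace.single i 1)

lemma dt_eq_dir (φ : TS d → ℝ) : dt φ = dir et φ := rfl

lemma grad_apply (φ : TS d → ℝ) (z : TS d) (i : Fin d) : grad φ z i = dir (ex i) φ z := rfl

/-! ### Inequalities for integrals -/

lemma sq_lintegral_le {α : Type*} [MeasurableSpace α] (μ : Measure α) {g : α → ℝ≥0∞}
    (hg : AEMeasurable g μ) : (∫⁻ x, g x ∂μ) ^ 2 ≤ μ univ * ∫⁻ x, g x ^ 2 ∂μ := by
  have h := ENNReal.lintegral_mul_le_Lp_mul_Lq μ Real.HolderConjugate.two_two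
    (f := fun _ => 1) (g := g) aemeasurable_const hg
  simp only [Pi.mul_apply, one_mul, ENNReal.one_rpow, lintegral_one] at h
  calc (∫⁻ x, g x ∂μ) ^ 2
      ≤ (μ univ ^ (1 / 2 : ℝ) * (∫⁻ x, g x ^ (2 : ℝ) ∂μ) ^ (1 / 2 : ℝ)) ^ 2 := by gcongr
    _ = μ univ * ∫⁻ x, g x ^ 2 ∂μ := by
      rw [mul_pow, ← ENNReal.rpow_natCast, ← ENNReal.rpow_natCast, ← ENNReal.rpow_mul,
        ← ENNReal.rpow_mul]
      norm_num

/-- Cauchy-Schwarz in y for almost every x, then Tonelli. It moves an average out of a squared L²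
norm, both for averages over translations (mollifiers) and for averages over scales (the oscillation
estimate). -/
lemma lintegral_sq_lintegral_le {α β : Type*} [MeasurableSpace α] [MeasurableSpace β]
    (μ : Measure α) (ν : Measure β) [SFinite μ] [SFinite ν] {G : α → β → ℝ≥0∞}
    (hG : AEMeasurable (Function.uncurry G) (μ.prod ν)) :
    ∫⁻ x, (∫⁻ y, G x y ∂ν) ^ 2 ∂μ ≤ ν univ * ∫⁻ y, ∫⁻ x, G x y ^ 2 ∂μ ∂ν := by
  rw [← lintegral_lintegral_swap (hG.pow_const 2)]
  calc ∫⁻ x, (∫⁻ y, G x y ∂ν) ^ 2 ∂μ ≤ ∫⁻ x, ν univ * ∫⁻ y, G x y ^ 2 ∂ν ∂μ := by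
        apply lintegral_mono_ae
        filter_upwards [Measure.ae_ae_of_ae_prod hG.ae_eq_mk] with x hx
        exact sq_lintegral_le ν ⟨_, hG.measurable_mk.comp measurable_prodMk_left, hx⟩
    _ = _ := by
        refine lintegral_const_mul'' _ ?_
        exact (hG.pow_const 2).lintegral_prod_right'

lemma abs_integral_mul_le {α : Type*} [MeasurableSpace α] {μ : Measure α} {f g : α → ℝ}
    (hf : MemLp f 2 μ) (hg : MemLp g 2 μ) {a b : ℝ} (ha : 0 ≤ a) (hb : 0 ≤ b)
    (hfa : ∫ x, f x ^ 2 ∂μ ≤ a ^ 2) (hgb : ∫ x, g x ^ 2 ∂μ ≤ b ^ 2) :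
    |∫ x, f x * g x ∂μ| ≤ a * b := by
  have h := integral_mul_norm_le_Lp_mul_Lq (μ := μ) Real.HolderConjugate.two_two
    (f := f) (g := g) (by simpa using hf) (by simpa using hg)
  have e (f : α → ℝ) : ∫ x, ‖f x‖ ^ (2 : ℝ) ∂μ = ∫ x, f x ^ 2 ∂μ := by
    congr 1; ext x; norm_num
  rw [e, e, ← Real.sqrt_eq_rpow, ← Real.sqrt_eq_rpow] at h
  calc |∫ x, f x * g x ∂μ| ≤ ∫ x, ‖f x * g x‖ ∂μ := norm_integral_le_integral_norm (fun x => f x * g x)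
    _ = ∫ x, ‖f x‖ * ‖g x‖ ∂μ := by simp only [norm_mul]
    _ ≤ _ := h
    _ ≤ a * b := by
      gcongr
      · exact Real.sqrt_le_iff.2 ⟨ha, hfa⟩
      · exact Real.sqrt_le_iff.2 ⟨hb, hgb⟩

lemma integral_sq_eq_toReal {α : Type*} [MeasurableSpace α] {μ : Measure α} {f : α → ℝ}
    (hf : AEStronglyMeasurable f μ) :
    ∫ x, f x ^ 2 ∂μ = (∫⁻ x, ‖f x‖ₑ ^ 2 ∂μ).toReal := by
  rw [integral_eq_lintegral_of_nonneg_ae (ae_of_all _ fun x => sq_nonneg _) (hf.pow 2)]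
  congr 1
  refine lintegral_congr fun x => ?_
  rw [← ofReal_norm, ← ENNReal.ofReal_pow (norm_nonneg _), Real.norm_eq_abs, sq_abs]

/-! ### Smooth functions -/

lemma contDiff_dir {n : ℕ∞} {φ : TS d → ℝ} (hφ : ContDiff ℝ (n + 1) φ) (v : TS d) :
    ContDiff ℝ n (dir v φ) := by
  have : ContDiff ℝ n (fderiv ℝ φ) := hφ.fderiv_right le_rfl
  exact this.clm_apply contDiff_const

lemma contDiff_dir_infty {φ : TS d → ℝ} (hφ : ContDiff ℝ ∞ φ) (v : TS d) :
    ContDiff ℝ ∞ (dir v φ) := contDiff_dir (n := ⊤) hφ v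

lemma continuous_dir {φ : TS d → ℝ} (hφ : ContDiff ℝ 1 φ) (v : TS d) :
    Continuous (dir v φ) :=
  (hφ.continuous_fderiv one_ne_zero).clm_apply continuous_const

lemma tsupport_dir_subset (φ : TS d → ℝ) (v : TS d) : tsupport (dir v φ) ⊆ tsupport φ :=
  tsupport_fderiv_apply_subset ℝ v

lemma hasCompactSupport_dir {φ : TS d → ℝ} (hφ : HasCompactSupport φ) (v : TS d) :
    HasCompactSupport (dir v φ) := hφ.fderiv_apply ℝ v

lemma dir_mul {f g : TS d → ℝ} {z : TS d} (hf : DifferentiableAt ℝ f z)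
    (hg : DifferentiableAt ℝ g z) (v : TS d) :
    dir v (fun y => f y * g y) z = f z * dir v g z + dir v f z * g z := by
  unfold dir
  rw [fderiv_fun_mul hf hg]
  simp [mul_comm]

lemma dir_comm {φ : TS d → ℝ} (hφ : ContDiff ℝ 2 φ) (v w : TS d) :
    dir v (dir w φ) = dir w (dir v φ) := by
  ext z
  have hs : IsSymmSndFDerivAt ℝ φ z :=
    hφ.contDiffAt.isSymmSndFDerivAt (by simp)
  have hd : DifferentiableAt ℝ (fderiv ℝ φ) z :=
    ((hφ.fderiv_right (m := 1) (by norm_num)).differentiable one_ne_zero) z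
  have e (a b : TS d) : dir a (dir b φ) z = fderiv ℝ (fderiv ℝ φ) z a b := by
    unfold dir
    rw [fderiv_clm_apply hd (differentiableAt_const b)]
    simp
  rw [e, e]
  exact hs v w

lemma memLp_of_compact {f : TS d → ℝ} (hf : Continuous f) (hc : HasCompactSupport f)
    (p : ℝ≥0∞) (μ : Measure (TS d)) [IsFiniteMeasureOnCompacts μ] : MemLp f p μ :=
  hf.memLp_of_hasCompactSupport hc

lemma integrable_of_compact {f : TS d → ℝ} (hf : Continuous f) (hc : HasCompactSupport f) :
    Integrable f :=
  hf.integrable_of_hasCompactSupport hc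

lemma integral_dir_mul {f g : TS d → ℝ} (hf : ContDiff ℝ 1 f) (hg : ContDiff ℝ 1 g)
    (hc : HasCompactSupport f) (v : TS d) :
    ∫ z, dir v f z * g z = -∫ z, f z * dir v g z := by
  rw [eq_neg_iff_add_eq_zero, add_comm, ← eq_neg_iff_add_eq_zero]
  refine integral_mul_fderiv_eq_neg_fderiv_mul_of_integrable (f := f) (g := g) (v := v)
    (μ := volume) ?_ ?_ ?_ ?_ ?_
  · exact integrable_of_compact ((continuous_dir hf v).mul hg.continuous)
      ((hasCompactSupport_dir hc v).mul_right)
  · exact integrable_of_compact (hf.continuous.mul (continuous_dir hg v)) hc.mul_right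
  · exact integrable_of_compact (hf.continuous.mul hg.continuous) hc.mul_right
  · exact fun z _ => hf.differentiable one_ne_zero z
  · exact fun z _ => hg.differentiable one_ne_zero z

lemma integral_dir {f : TS d → ℝ} (hf : ContDiff ℝ 1 f) (hc : HasCompactSupport f) (v : TS d) :
    ∫ z, dir v f z = 0 := by
  have := integral_dir_mul hf (contDiff_const (c := (1 : ℝ))) hc v
  simpa [dir] using this

/-! ### Convolution -/

/-- The convolution of `F` with the kernel `φ`. -/
def cv (φ F : TS d → ℝ) (z : TS d) : ℝ := ∫ y, F y * φ (z - y)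

lemma cv_eq_convolution (φ F : TS d → ℝ) :
    cv φ F = MeasureTheory.convolution F φ (ContinuousLinearMap.mul ℝ ℝ) volume := rfl

lemma cv_flip (φ F : TS d → ℝ) (z : TS d) : cv φ F z = ∫ y, F (z - y) * φ y := by
  unfold cv
  rw [← integral_sub_left_eq_self _ volume z]
  simp

lemma contDiff_cv {φ F : TS d → ℝ} (hφ : ContDiff ℝ ∞ φ) (hc : HasCompactSupport φ)
    (hF : LocallyIntegrable F) : ContDiff ℝ ∞ (cv φ F) :=
  hc.contDiff_convolution_right (n := ⊤) (ContinuousLinearMap.mul ℝ ℝ) hF hφ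

lemma dir_cv {φ F : TS d → ℝ} (hφ : ContDiff ℝ 1 φ) (hc : HasCompactSupport φ)
    (hF : LocallyIntegrable F) (v : TS d) : dir v (cv φ F) = cv (dir v φ) F := by
  ext z
  unfold dir
  rw [cv_eq_convolution,
    (hc.hasFDerivAt_convolution_right (ContinuousLinearMap.mul ℝ ℝ) hF hφ z).fderiv]
  rw [convolution_precompR_apply _ hF (hc.fderiv ℝ) (hφ.continuous_fderiv one_ne_zero)]
  rfl

lemma hasCompactSupport_cv {φ F : TS d → ℝ} (hc : HasCompactSupport φ)
    (hF : HasCompactSupport F) : HasCompactSupport (cv φ F) := by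
  rw [cv_eq_convolution]
  exact HasCompactSupport.convolution _ hF hc

/-- A sequence of smooth mollifiers. -/
def moll (k : ℕ) : TS d → ℝ :=
  (ContDiffBump.mk (c := (0 : TS d)) (1 / (2 * (k + 1 : ℝ))) (1 / (k + 1 : ℝ)) (by positivity)
    (by rw [div_lt_div_iff₀ (by positivity) (by positivity)]; nlinarith)).normed volume

lemma contDiff_moll (k : ℕ) : ContDiff ℝ ∞ (moll k : TS d → ℝ) := ContDiffBump.contDiff_normed _

lemma hasCompactSupport_moll (k : ℕ) : HasCompactSupport (moll k : TS d → ℝ) :=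
  ContDiffBump.hasCompactSupport_normed _

lemma moll_nonneg (k : ℕ) (z : TS d) : 0 ≤ moll k z := ContDiffBump.nonneg_normed _ _

lemma integral_moll (k : ℕ) : ∫ z : TS d, moll k z = 1 := ContDiffBump.integral_normed _

lemma tsupport_moll (k : ℕ) :
    tsupport (moll k : TS d → ℝ) = Metric.closedBall 0 (1 / (k + 1 : ℝ)) :=
  ContDiffBump.tsupport_normed_eq _

/-- Translations act continuously on L²; the rest only unfolds the norm into an integral of squares.
-/
lemma tendsto_translate {F : TS d → ℝ} (hF : MemLp F 2) :
    Tendsto (fun y : TS d => ∫⁻ z, ‖F (z - y) - F z‖ₑ ^ 2) (𝓝 0) (𝓝 0) := by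
  have : Fact ((1 : ℝ≥0∞) ≤ 2) := ⟨by norm_num⟩
  have hmp (y : TS d) : MeasurePreserving (fun z : TS d => z - y) :=
    measurePreserving_sub_right volume y
  let g : C(TS d, C(TS d, TS d)) := ContinuousMap.curry ⟨fun a => a.2 - a.1, by fun_prop⟩
  have h := (Continuous.compMeasurePreservingLp (μ := (volume : Measure (TS d)))
    (continuous_const (y := hF.toLp F)) g.continuous hmp (by norm_num)).tendsto 0
  have h2 := (h.sub_const (hF.toLp F)).enorm
  have e (y : TS d) : Lp.compMeasurePreserving (g y) (hmp y) (hF.toLp F) - hF.toLp F =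
      ((hF.comp_measurePreserving (hmp y)).sub hF).toLp _ := by
    rw [MemLp.toLp_sub (hF.comp_measurePreserving (hmp y)) hF]; rfl
  have e2 (y : TS d) : ‖Lp.compMeasurePreserving (g y) (hmp y) (hF.toLp F) - hF.toLp F‖ₑ =
      eLpNorm (fun z => F (z - y) - F z) 2 volume := by
    rw [e, Lp.enorm_toLp]; rfl
  simp only [e2] at h2
  have h3 := (ENNReal.continuous_pow 2).tendsto _ |>.comp h2
  have e3 (y : TS d) : eLpNorm (fun z => F (z - y) - F z) 2 volume ^ 2
      = ∫⁻ z, ‖F (z - y) - F z‖ₑ ^ 2 := by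
    have := eLpNorm_nnreal_pow_eq_lintegral (f := fun z : TS d => F (z - y) - F z) (p := 2)
      (μ := volume) (by norm_num)
    simpa using this
  simp only [Function.comp_def, e3] at h3
  simpa using h3

/-- The mollifier is a probability density ν, so the error is an average of F(· - y) - F over y in a
shrinking ball; its squared L² norm is at most the ν-average of the translation errors. -/
lemma tendsto_lintegral_cv_moll {F : TS d → ℝ} (hF : MemLp F 2) :
    Tendsto (fun k : ℕ => ∫⁻ z, ‖cv (moll k) F z - F z‖ₑ ^ 2) atTop (𝓝 0) := by
  have hT := tendsto_translate hF
  rw [ENNReal.tendsto_nhds_zero] at hT ⊢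
  intro ε hε
  obtain ⟨r, hr, hball⟩ := Metric.eventually_nhds_iff.1 (hT ε hε)
  obtain ⟨K, hK⟩ := exists_nat_one_div_lt hr
  filter_upwards [eventually_ge_atTop K] with k hk
  have hkr : 1 / (k + 1 : ℝ) < r :=
    lt_of_le_of_lt (by apply one_div_le_one_div_of_le <;> [positivity; gcongr]) hK
  set ρ : TS d → ℝ := moll k
  set ν : Measure (TS d) := volume.withDensity fun y => ENNReal.ofReal (ρ y) with hν
  have hρm : Measurable fun y => ENNReal.ofReal (ρ y) :=
    (contDiff_moll k).continuous.measurable.ennreal_ofReal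
  have hρi : Integrable ρ :=
    integrable_of_compact (contDiff_moll k).continuous (hasCompactSupport_moll k)
  have hν1 : ν univ = 1 := by
    rw [hν, withDensity_apply _ MeasurableSet.univ, Measure.restrict_univ,
      ← ofReal_integral_eq_lintegral_ofReal hρi (ae_of_all _ (moll_nonneg k)), integral_moll]
    simp
  have : IsFiniteMeasure ν := ⟨by simp [hν1]⟩
  have hLI : LocallyIntegrable F := hF.locallyIntegrable (by norm_num)
  have hint (z : TS d) : Integrable fun y => F (z - y) * ρ y := by
    have := (hasCompactSupport_moll k).convolutionExists_right (ContinuousLinearMap.mul ℝ ℝ)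
      hLI (contDiff_moll k).continuous z
    have h2 := this.integrable.comp_sub_left z
    simpa using h2
  have key (z : TS d) : ‖cv ρ F z - F z‖ₑ ≤ ∫⁻ y, ‖F (z - y) - F z‖ₑ ∂ν := by
    have e1 : cv ρ F z - F z = ∫ y, (F (z - y) - F z) * ρ y := by
      simp only [sub_mul]
      rw [integral_sub (hint z) (hρi.const_mul _), integral_const_mul, integral_moll, cv_flip]
      simp
    rw [e1]
    refine (enorm_integral_le_lintegral_enorm _).trans ?_
    rw [hν, lintegral_withDensity_eq_lintegral_mul_non_measurable _ hρm (by simp)]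
    refine lintegral_mono fun y => ?_
    rw [enorm_mul, mul_comm, Pi.mul_apply, Real.enorm_eq_ofReal (moll_nonneg k y)]
  have hac : (volume : Measure (TS d)).prod ν ≪ volume.prod volume :=
    Measure.AbsolutelyContinuous.rfl.prod (withDensity_absolutelyContinuous _ _)
  have hae : AEMeasurable (Function.uncurry fun z y : TS d => ‖F (z - y) - F z‖ₑ)
      ((volume : Measure (TS d)).prod ν) := by
    refine AEMeasurable.mono_ac ?_ hac
    refine AEMeasurable.enorm (AEMeasurable.sub ?_ ?_)
    · exact hF.1.aemeasurable.comp_quasiMeasurePreserving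
        (quasiMeasurePreserving_sub volume volume)
    · exact hF.1.aemeasurable.comp_quasiMeasurePreserving Measure.quasiMeasurePreserving_fst
  calc ∫⁻ z, ‖cv ρ F z - F z‖ₑ ^ 2
      ≤ ∫⁻ z, (∫⁻ y, ‖F (z - y) - F z‖ₑ ∂ν) ^ 2 := by gcongr; exact key _
    _ ≤ ν univ * ∫⁻ y, ∫⁻ z, ‖F (z - y) - F z‖ₑ ^ 2 ∂volume ∂ν :=
      lintegral_sq_lintegral_le _ _ hae
    _ ≤ 1 * ∫⁻ y, ε ∂ν := by
      rw [hν1]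
      gcongr 1 * ?_
      refine lintegral_mono_ae ?_
      rw [hν, ae_withDensity_iff hρm]
      refine ae_of_all _ fun y hy => ?_
      refine hball ?_
      rw [dist_zero_right]
      have : y ∈ tsupport ρ := subset_tsupport _ fun h => hy (by simp [h])
      rw [tsupport_moll, mem_closedBall_zero_iff] at this
      exact lt_of_le_of_lt this hkr
    _ = ε := by simp [hν1]

lemma tendsto_integral_cv_moll {F : TS d → ℝ} (hF : MemLp F 2) :
    Tendsto (fun k : ℕ => ∫ z, (cv (moll k) F z - F z) ^ 2) atTop (𝓝 0) := by
  have h := (ENNReal.tendsto_toReal (by simp)).comp (tendsto_lintegral_cv_moll hF)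
  refine h.congr fun k => ?_
  rw [Function.comp_apply, integral_sq_eq_toReal]
  have := contDiff_cv (contDiff_moll k) (hasCompactSupport_moll k)
    (hF.locallyIntegrable (by norm_num))
  exact this.continuous.aestronglyMeasurable.sub hF.1

/-! ### Parabolic dilations and the oscillation estimate -/

/-- The parabolic dilation `(t, x) ↦ (σ²t, σx)`. -/
def scl (σ : ℝ) (z : TS d) : TS d := (σ ^ 2 * z.1, σ • z.2)

lemma fderiv_apply_eq (u : TS d → ℝ) (z v : TS d) :
    fderiv ℝ u z v = v.1 * dir et u z + ∑ i, v.2 i * dir (ex i) u z := by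
  have hv : v = v.1 • (et : TS d) + ∑ i, v.2 i • ex i := by
    have h2 : v.2 = ∑ i, v.2 i • (EuclideanSpace.single i (1 : ℝ)) := by
      ext j
      simp [Finset.sum_apply, Pi.single_apply]
    refine Prod.ext ?_ ?_
    · simp [et, ex, Prod.fst_sum]
    · simp only [et, ex, Prod.snd_add, Prod.smul_snd, smul_zero, zero_add, Prod.snd_sum]
      exact h2
  conv_lhs => rw [hv]
  simp [dir, map_sum]

/-- The family of curves γ is kept general because two derivatives are needed: in the scale, along s
↦ z - scl s w, and in the base point, along s ↦ s z - scl δ w. -/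
lemma hasDerivAt_integral_comp {u k : TS d → ℝ} (hu : ContDiff ℝ 1 u) (hk : Continuous k)
    {B : Set (TS d)} (hB : IsCompact B) {γ γ' : ℝ → TS d → TS d}
    (hγ : Continuous (Function.uncurry γ)) (hγ' : Continuous (Function.uncurry γ'))
    (hd : ∀ s w, HasDerivAt (fun s => γ s w) (γ' s w) s) (s₀ : ℝ) :
    HasDerivAt (fun s => ∫ w in B, u (γ s w) * k w)
      (∫ w in B, fderiv ℝ u (γ s₀ w) (γ' s₀ w) * k w) s₀ := by
  have hF' : Continuous fun p : ℝ × TS d => fderiv ℝ u (γ p.1 p.2) (γ' p.1 p.2) * k p.2 :=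
    (((hu.continuous_fderiv one_ne_zero).comp hγ).clm_apply hγ').mul (hk.comp continuous_snd)
  have hF : Continuous fun p : ℝ × TS d => u (γ p.1 p.2) * k p.2 :=
    (hu.continuous.comp hγ).mul (hk.comp continuous_snd)
  obtain ⟨C, hC⟩ := ((isCompact_Icc (a := s₀ - 1) (b := s₀ + 1)).prod hB).exists_bound_of_continuousOn
    hF'.continuousOn
  refine (hasDerivAt_integral_of_dominated_loc_of_deriv_le (μ := volume.restrict B)
    (F := fun s w => u (γ s w) * k w)
    (F' := fun s w => fderiv ℝ u (γ s w) (γ' s w) * k w)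
    (bound := fun _ => C) (Icc_mem_nhds (by linarith : s₀ - 1 < s₀) (by linarith : s₀ < s₀ + 1))
    ?_ ?_ ?_ ?_ ?_ ?_).2
  · exact Eventually.of_forall fun s =>
      (hF.comp (Continuous.prodMk_right s)).aestronglyMeasurable
  · exact (hF.comp (Continuous.prodMk_right s₀)).continuousOn.integrableOn_compact hB
  · exact (hF'.comp (Continuous.prodMk_right s₀)).aestronglyMeasurable
  · filter_upwards [ae_restrict_mem hB.measurableSet] with w hw s hs
    exact hC (s, w) ⟨hs, hw⟩
  · have : IsFiniteMeasure (volume.restrict B) := ⟨by simpa using hB.measure_lt_top⟩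
    exact integrable_const C
  · refine ae_of_all _ fun w s _ => ?_
    have := ((hu.differentiable one_ne_zero (γ s w)).hasFDerivAt.comp_hasDerivAt s (hd s w))
    exact this.mul_const (k w)

lemma continuous_scl : Continuous fun p : ℝ × TS d => scl p.1 p.2 := by
  unfold scl; fun_prop

lemma continuous_scl_right (σ : ℝ) : Continuous (scl σ : TS d → TS d) := by
  unfold scl; fun_prop

lemma contDiff_scl (σ : ℝ) {n : WithTop ℕ∞} : ContDiff ℝ n (scl σ : TS d → TS d) := by
  unfold scl; fun_prop

lemma scl_add (σ : ℝ) (z w : TS d) : scl σ (z + w) = scl σ z + scl σ w := by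
  simp [scl, mul_add]

lemma scl_smul (σ c : ℝ) (z : TS d) : scl σ (c • z) = c • scl σ z := by
  simp only [scl, Prod.smul_fst, Prod.smul_snd, smul_eq_mul, Prod.smul_mk, Prod.mk.injEq]
  exact ⟨by ring, smul_comm _ _ _⟩

/-- The parabolic dilation as a continuous linear map. -/
def sclL (σ : ℝ) : TS d →L[ℝ] TS d where
  toFun := scl σ
  map_add' := scl_add σ
  map_smul' := scl_smul σ
  cont := continuous_scl_right σ

lemma dir_comp_scl {u : TS d → ℝ} (σ : ℝ) (v z : TS d) (hu : DifferentiableAt ℝ u (scl σ z)) :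
    dir v (fun w => u (scl σ w)) z = dir (scl σ v) u (scl σ z) := by
  have h : HasFDerivAt (fun w => u (scl σ w)) ((fderiv ℝ u (scl σ z)).comp (sclL σ)) z :=
    HasFDerivAt.comp z (g := u) (f := scl σ) hu.hasFDerivAt (sclL σ).hasFDerivAt
  unfold dir
  rw [h.fderiv]
  rfl

lemma scl_et (σ : ℝ) : scl σ (et : TS d) = σ ^ 2 • et := by simp [scl, et]

lemma scl_ex (σ : ℝ) (i : Fin d) : scl σ (ex i) = σ • ex i := by simp [scl, ex]

lemma dir_smul (c : ℝ) (v : TS d) (u : TS d → ℝ) (z : TS d) : dir (c • v) u z = c * dir v u z := by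
  simp [dir]

lemma scl_scl (σ τ : ℝ) (z : TS d) : scl σ (scl τ z) = scl (σ * τ) z := by
  simp [scl, mul_pow, mul_assoc, smul_smul]

lemma scl_one (z : TS d) : scl 1 z = z := by simp [scl]

lemma hasDerivAt_scl (σ : ℝ) (w : TS d) :
    HasDerivAt (fun σ => scl σ w) (2 * σ * w.1, w.2) σ := by
  unfold scl
  refine HasDerivAt.prodMk ?_ ?_
  · simpa using (hasDerivAt_pow 2 σ).mul_const w.1
  · simpa using (hasDerivAt_id σ).smul_const w.2

lemma dir_ex_comp_sub_scl {G : TS d → ℝ} (hG : ContDiff ℝ 1 G) (σ : ℝ) (i : Fin d) (z w : TS d) :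
    dir (ex i) (fun w => G (z - scl σ w)) w = -(σ * dir (ex i) G (z - scl σ w)) := by
  have h : HasFDerivAt (fun w => G (z - scl σ w))
      ((fderiv ℝ G (z - scl σ w)).comp (-(sclL σ : TS d →L[ℝ] TS d))) w := by
    refine HasFDerivAt.comp w (g := G) (f := fun w => z - scl σ w)
      (hG.differentiable one_ne_zero _).hasFDerivAt ?_
    exact (sclL σ).hasFDerivAt.const_sub z
  unfold dir
  rw [h.fderiv]
  have : (sclL σ) (ex i) = σ • (ex i : TS d) := scl_ex σ i
  simp [this]

/-- Integration by parts in the dilated variable. -/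
lemma integral_dir_comp_sub_scl {G m k : TS d → ℝ} (hG : ContDiff ℝ 1 G) (hk : ContDiff ℝ 1 k)
    (hc : HasCompactSupport k) (hm : ContDiff ℝ 1 m) (i : Fin d) (hm0 : ∀ w, dir (ex i) m w = 0)
    (σ : ℝ) (z : TS d) :
    σ * ∫ w, dir (ex i) G (z - scl σ w) * (m w * k w)
      = ∫ w, G (z - scl σ w) * (m w * dir (ex i) k w) := by
  have hGs : ContDiff ℝ 1 fun w => G (z - scl σ w) :=
    hG.comp (contDiff_const.sub (contDiff_scl σ))
  have h := integral_dir_mul (hm.mul hk) hGs hc.mul_left (ex i)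
  have e1 : ∀ w, dir (ex i) (fun w => m w * k w) w = m w * dir (ex i) k w := fun w => by
    rw [dir_mul (hm.differentiable one_ne_zero w) (hk.differentiable one_ne_zero w), hm0]; ring
  simp only [e1, dir_ex_comp_sub_scl hG] at h
  rw [← integral_const_mul]
  rw [← integral_neg] at h
  calc _ = ∫ w, -(m w * k w * -(σ * dir (ex i) G (z - scl σ w))) := by congr 1; ext w; ring
    _ = _ := h.symm
    _ = _ := by congr 1; ext w; ring

lemma setIntegral_ball_eq {k f : TS d → ℝ} {B : Set (TS d)} (hk : tsupport k ⊆ B)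
    (hf : ∀ w, k w = 0 → f w = 0) : ∫ w in B, f w = ∫ w, f w := by
  refine setIntegral_eq_integral_of_forall_compl_eq_zero fun w hw => hf w ?_
  exact image_eq_zero_of_notMem_tsupport fun h => hw (hk h)

/-- The parabolic mollification at scale `σ` with kernel `k`. -/
def dil (k u : TS d → ℝ) (σ : ℝ) (z : TS d) : ℝ := ∫ w, u (z - scl σ w) * k w

/-! ### The mollification as a function of its scale and of its base point -/

section Dil

variable {k u : TS d → ℝ} {P G : Fin d → TS d → ℝ} {Q A : Set (TS d)}

/-- Up to sign, the derivative of `dil k u` in the scale. -/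
def dilDeriv (k : TS d → ℝ) (P G : Fin d → TS d → ℝ) (σ : ℝ) (z w : TS d) : ℝ :=
  ∑ i, (2 * w.1 * (G i (z - scl σ w) * dir (ex i) k w) + w.2 i * (P i (z - scl σ w) * k w))

lemma contDiff_fst_one : ContDiff ℝ 1 (fun w : TS d => w.1) := contDiff_fst

lemma dir_ex_fst (i : Fin d) (w : TS d) : dir (ex i) (fun w : TS d => w.1) w = 0 := by
  unfold dir
  rw [(hasFDerivAt_fst (𝕜 := ℝ) (p := w)).fderiv]
  simp [ex]

lemma continuous_sub_scl (z : TS d) : Continuous fun p : ℝ × TS d => z - scl p.1 p.2 :=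
  continuous_const.sub continuous_scl

/-- The chain rule gives -(2σ w₁ ∂ₜu + w₂ · ∇u). With ∂ₜu = ∇ · G on Q, the divergence is moved onto
the kernel, and only G and P remain, with no derivative. -/
lemma hasDerivAt_dil (hu : ContDiff ℝ 1 u) (hk : ContDiff ℝ 1 k)
    (hks : tsupport k ⊆ Metric.closedBall 0 1) (hG : ∀ i, ContDiff ℝ 1 (G i))
    (hPc : ∀ i, Continuous (P i))
    (hP : ∀ z ∈ Q, ∀ i, dir (ex i) u z = P i z)
    (hut : ∀ z ∈ Q, dir et u z = ∑ i, dir (ex i) (G i) z) (σ : ℝ) (z : TS d)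
    (hz : ∀ w ∈ Metric.closedBall 0 1, z - scl σ w ∈ Q) :
    HasDerivAt (fun σ => dil k u σ z) (-∫ w, dilDeriv k P G σ z w) σ := by
  have hc : HasCompactSupport k := HasCompactSupport.of_support_subset_isCompact
    (isCompact_closedBall 0 1) ((subset_tsupport k).trans hks)
  have hB := isCompact_closedBall (0 : TS d) 1
  have h := hasDerivAt_integral_comp hu hk.continuous hB
    (γ := fun s w => z - scl s w) (γ' := fun s w => -(2 * s * w.1, w.2))
    (continuous_sub_scl z) (by simp only [Function.uncurry_def]; fun_prop)
    (fun s w => (hasDerivAt_scl s w).const_sub z) σ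
  have e0 : (fun σ => dil k u σ z) = fun s => ∫ w in Metric.closedBall 0 1, u (z - scl s w) * k w := by
    ext s
    exact (setIntegral_ball_eq hks fun w hw => by simp [hw]).symm
  rw [e0]
  convert h using 1
  have hkz : ∀ w, w ∉ tsupport k → k w = 0 := fun w hw => image_eq_zero_of_notMem_tsupport hw
  have e1 : ∀ w ∈ Metric.closedBall (0 : TS d) 1,
      fderiv ℝ u (z - scl σ w) (-(2 * σ * w.1, w.2)) * k w =
      ∑ i, (-(2 * (σ * (dir (ex i) (G i) (z - scl σ w) * (w.1 * k w))))
        - w.2 i * (P i (z - scl σ w) * k w)) := by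
    intro w hw
    rw [map_neg, fderiv_apply_eq, hut _ (hz w hw)]
    simp only [hP _ (hz w hw)]
    rw [Finset.sum_sub_distrib, Finset.sum_neg_distrib, neg_mul, add_mul, Finset.mul_sum,
      Finset.sum_mul, Finset.sum_mul, neg_add, sub_eq_add_neg]
    congr 2
    · exact Finset.sum_congr rfl fun i _ => by ring
    · exact Finset.sum_congr rfl fun i _ => by ring
  rw [setIntegral_congr_fun hB.measurableSet e1, setIntegral_ball_eq hks
    (fun w hw => by simp [hw])]
  unfold dilDeriv
  have hcs : Continuous fun w : TS d => z - scl σ w := continuous_const.sub (continuous_scl_right σ)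
  have i1 (i : Fin d) : Integrable fun w : TS d =>
      dir (ex i) (G i) (z - scl σ w) * (w.1 * k w) := by
    refine integrable_of_compact ?_ hc.mul_left.mul_left
    exact ((continuous_dir (hG i) _).comp hcs).mul (continuous_fst.mul hk.continuous)
  have i2 (i : Fin d) : Integrable fun w : TS d => w.2 i * (P i (z - scl σ w) * k w) := by
    refine integrable_of_compact ?_ hc.mul_left.mul_left
    exact Continuous.mul (by fun_prop) (((hPc i).comp hcs).mul hk.continuous)
  have i3 (i : Fin d) : Integrable fun w : TS d =>
      G i (z - scl σ w) * (w.1 * dir (ex i) k w) := by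
    refine integrable_of_compact ?_ (hasCompactSupport_dir hc _).mul_left.mul_left
    exact ((hG i).continuous.comp hcs).mul (continuous_fst.mul (continuous_dir hk _))
  rw [integral_finsetSum _ fun i _ => ?_, integral_finsetSum _ fun i _ => ?_,
    ← Finset.sum_neg_distrib]
  · refine Finset.sum_congr rfl fun i _ => ?_
    -- Integration by parts in w uses up exactly the factor σ produced by differentiating σ². No
    -- negative power of σ appears, so the derivative stays bounded down to scale 0.
    have e2 := integral_dir_comp_sub_scl (hG i) hk hc contDiff_fst_one i (dir_ex_fst i) σ z
    simp only [← neg_add']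
    rw [integral_neg, integral_add (((i1 i).const_mul σ).const_mul 2) (i2 i),
      integral_const_mul, integral_const_mul, e2]
    have e3 : ∀ w : TS d, 2 * w.1 * (G i (z - scl σ w) * dir (ex i) k w) =
      2 * (G i (z - scl σ w) * (w.1 * dir (ex i) k w)) := fun w => by ring
    simp only [e3]
    rw [integral_add ((i3 i).const_mul 2) (i2 i), integral_const_mul]
  · exact (((i1 i).const_mul σ).const_mul 2).neg.sub (i2 i)
  · refine Integrable.add ?_ (i2 i)
    exact ((i3 i).const_mul 2).congr (ae_of_all _ fun w => by ring)

lemma continuous_dilDeriv (hk : ContDiff ℝ 1 k) (hG : ∀ i, Continuous (G i))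
    (hPc : ∀ i, Continuous (P i)) :
    Continuous fun p : TS d × ℝ × TS d => dilDeriv k P G p.2.1 p.1 p.2.2 := by
  have hcs : Continuous fun p : TS d × ℝ × TS d => p.1 - scl p.2.1 p.2.2 :=
    continuous_fst.sub (continuous_scl.comp continuous_snd)
  unfold dilDeriv
  refine continuous_finsetSum _ fun i _ => ?_
  have h1 := continuous_dir hk (ex i)
  have h2 := (hG i).comp hcs
  have h3 := (hPc i).comp hcs
  have h4 := hk.continuous
  simp only [Function.comp_def] at h2 h3
  fun_prop

/-- The fundamental theorem of calculus in the scale: at σ = 0 the dilation collapses to a point and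
the mollification is u(z), since k has integral 1. -/
lemma enorm_dil_sub_le (hu : ContDiff ℝ 1 u) (hk : ContDiff ℝ 1 k)
    (hks : tsupport k ⊆ Metric.closedBall 0 1) (hk1 : ∫ w, k w = 1)
    (hG : ∀ i, ContDiff ℝ 1 (G i)) (hPc : ∀ i, Continuous (P i))
    (hP : ∀ z ∈ Q, ∀ i, dir (ex i) u z = P i z)
    (hut : ∀ z ∈ Q, dir et u z = ∑ i, dir (ex i) (G i) z) {δ : ℝ} (hδ : 0 < δ) (z : TS d)
    (hz : ∀ σ ∈ Icc 0 δ, ∀ w ∈ Metric.closedBall 0 1, z - scl σ w ∈ Q) :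
    ‖dil k u δ z - u z‖ₑ ≤ ∫⁻ p : ℝ × TS d, ‖dilDeriv k P G p.1 z p.2‖ₑ
      ∂((volume.restrict (Icc 0 δ)).prod (volume.restrict (Metric.closedBall 0 1))) := by
  have hB := isCompact_closedBall (0 : TS d) 1
  have hzero (σ : ℝ) : ∀ w, k w = 0 → w ∉ tsupport k → dilDeriv k P G σ z w = 0 := by
    intro w h1 h2
    have h3 (i : Fin d) : dir (ex i) k w = 0 :=
      image_eq_zero_of_notMem_tsupport fun h => h2 (tsupport_dir_subset k _ h)
    simp [dilDeriv, h1, h3]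
  have hset (σ : ℝ) : ∫ w, dilDeriv k P G σ z w =
      ∫ w in Metric.closedBall 0 1, dilDeriv k P G σ z w := by
    refine (setIntegral_eq_integral_of_forall_compl_eq_zero fun w hw => ?_).symm
    have : w ∉ tsupport k := fun h => hw (hks h)
    exact hzero σ w (image_eq_zero_of_notMem_tsupport this) this
  have hcd := continuous_dilDeriv hk (fun i => (hG i).continuous) hPc
  have hcont : Continuous fun σ => ∫ w, dilDeriv k P G σ z w := by
    simp only [hset]
    exact continuous_parametric_integral_of_continuous
      (f := fun σ w => dilDeriv k P G σ z w)
      (hcd.comp (Continuous.prodMk_right z)) hB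
  have hftc := intervalIntegral.integral_eq_sub_of_hasDerivAt (a := 0) (b := δ)
    (f := fun σ => dil k u σ z) (f' := fun σ => -∫ w, dilDeriv k P G σ z w)
    (fun σ hσ => hasDerivAt_dil hu hk hks hG hPc hP hut σ z
      (hz σ (by rwa [uIcc_of_le hδ.le] at hσ)))
    (hcont.neg.intervalIntegrable _ _)
  have h0 : dil k u 0 z = u z := by
    have : ∀ w : TS d, scl 0 w = 0 := fun w => by simp [scl]
    simp [dil, this, integral_const_mul, hk1]
  rw [h0, intervalIntegral.integral_of_le hδ.le, ← integral_Icc_eq_integral_Ioc] at hftc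
  rw [← hftc]
  refine (enorm_integral_le_lintegral_enorm _).trans ?_
  rw [lintegral_prod]
  · refine lintegral_mono fun σ => ?_
    rw [enorm_neg, hset]
    exact enorm_integral_le_lintegral_enorm _
  · exact (hcd.comp (Continuous.prodMk_right z)).enorm.measurable.aemeasurable

lemma abs_dilDeriv_le {C : ℝ} (hC : 0 ≤ C) (hkC : ∀ w, |k w| ≤ C)
    (hkC' : ∀ i w, |dir (ex i) k w| ≤ C) (σ : ℝ) (z w : TS d) (hw : w ∈ Metric.closedBall 0 1) :
    |dilDeriv k P G σ z w| ≤ ∑ i, 2 * C * (|G i (z - scl σ w)| + |P i (z - scl σ w)|) := by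
  rw [mem_closedBall_zero_iff] at hw
  have h1 : |w.1| ≤ 1 := (norm_fst_le w).trans hw
  have h2 (i : Fin d) : |w.2 i| ≤ 1 :=
    (PiLp.norm_apply_le w.2 i).trans ((norm_snd_le w).trans hw)
  refine (Finset.abs_sum_le_sum_abs _ _).trans (Finset.sum_le_sum fun i _ => ?_)
  refine (abs_add_le _ _).trans ?_
  simp only [abs_mul, abs_two]
  have h3 : |w.1| * |dir (ex i) k w| ≤ 1 * C := by gcongr; exact hkC' i w
  have h4 : |w.2 i| * |k w| ≤ 1 * C := by gcongr; exacts [h2 i, hkC w]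
  have h5 := mul_le_mul_of_nonneg_right h3 (abs_nonneg (G i (z - scl σ w)))
  have h6 := mul_le_mul_of_nonneg_right h4 (abs_nonneg (P i (z - scl σ w)))
  have h7 := mul_nonneg hC (abs_nonneg (P i (z - scl σ w)))
  nlinarith

/-- The energy density of two vector fields. -/
def dens (P G : Fin d → TS d → ℝ) (z : TS d) : ℝ := ∑ i, (P i z ^ 2 + G i z ^ 2)

lemma dens_nonneg (P G : Fin d → TS d → ℝ) (z : TS d) : 0 ≤ dens P G z :=
  Finset.sum_nonneg fun _ _ => by positivity

lemma continuous_dens (hP : ∀ i, Continuous (P i)) (hG : ∀ i, Continuous (G i)) :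
    Continuous (dens P G) :=
  continuous_finsetSum _ fun i _ => ((hP i).pow 2).add ((hG i).pow 2)

lemma sq_dilDeriv_le {C : ℝ} (hC : 0 ≤ C) (hkC : ∀ w, |k w| ≤ C)
    (hkC' : ∀ i w, |dir (ex i) k w| ≤ C) (σ : ℝ) (z w : TS d) (hw : w ∈ Metric.closedBall 0 1) :
    ‖dilDeriv k P G σ z w‖ₑ ^ 2 ≤
      ENNReal.ofReal (8 * d * C ^ 2) * ENNReal.ofReal (dens P G (z - scl σ w)) := by
  have h := abs_dilDeriv_le (P := P) (G := G) hC hkC hkC' σ z w hw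
  rw [← ofReal_norm, ← ENNReal.ofReal_pow (norm_nonneg _), ← ENNReal.ofReal_mul (by positivity)]
  refine ENNReal.ofReal_le_ofReal ?_
  rw [Real.norm_eq_abs]
  calc |dilDeriv k P G σ z w| ^ 2
      ≤ (∑ i, 2 * C * (|G i (z - scl σ w)| + |P i (z - scl σ w)|)) ^ 2 := by gcongr
    _ ≤ ((Finset.univ : Finset (Fin d)).card : ℝ) *
        ∑ i, (2 * C * (|G i (z - scl σ w)| + |P i (z - scl σ w)|)) ^ 2 := sq_sum_le_card_mul_sum_sq
    _ ≤ d * ∑ i, 8 * C ^ 2 * (P i (z - scl σ w) ^ 2 + G i (z - scl σ w) ^ 2) := by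
      rw [Finset.card_univ, Fintype.card_fin]
      gcongr with i
      rw [← sq_abs (P i _), ← sq_abs (G i _)]
      have := mul_nonneg (sq_nonneg C)
        (sq_nonneg (|G i (z - scl σ w)| - |P i (z - scl σ w)|))
      nlinarith
    _ = _ := by rw [dens, ← Finset.mul_sum]; ring

/-- The gain δ² comes from the mass of the scale-kernel domain [0, δ] × ball, which enters twice:
once by Cauchy-Schwarz and once by integrating a bound that is uniform in (σ, w). -/
lemma lintegral_enorm_dil_sub_le (hu : ContDiff ℝ 1 u) (hk : ContDiff ℝ 1 k)
    (hks : tsupport k ⊆ Metric.closedBall 0 1) (hk1 : ∫ w, k w = 1)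
    {C : ℝ} (hC : 0 ≤ C) (hkC : ∀ w, |k w| ≤ C) (hkC' : ∀ i w, |dir (ex i) k w| ≤ C)
    (hG : ∀ i, ContDiff ℝ 1 (G i)) (hPc : ∀ i, Continuous (P i))
    (hP : ∀ z ∈ Q, ∀ i, dir (ex i) u z = P i z)
    (hut : ∀ z ∈ Q, dir et u z = ∑ i, dir (ex i) (G i) z) {δ : ℝ} (hδ : 0 < δ)
    (hQ : MeasurableSet Q) (hA : MeasurableSet A)
    (hz : ∀ z ∈ A, ∀ σ ∈ Icc 0 δ, ∀ w ∈ Metric.closedBall 0 1, z - scl σ w ∈ Q) :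
    ∫⁻ z in A, ‖dil k u δ z - u z‖ₑ ^ 2 ≤
      (ENNReal.ofReal δ * volume (Metric.closedBall (0 : TS d) 1)) ^ 2 *
        (ENNReal.ofReal (8 * d * C ^ 2) * ∫⁻ z in Q, ENNReal.ofReal (dens P G z)) := by
  set ν := ((volume : Measure ℝ).restrict (Icc 0 δ)).prod
    ((volume : Measure (TS d)).restrict (Metric.closedBall 0 1)) with hν
  have hcd := continuous_dilDeriv (P := P) hk (fun i => (hG i).continuous) hPc
  have hν1 : ν univ = ENNReal.ofReal δ * volume (Metric.closedBall (0 : TS d) 1) := by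
    rw [hν, ← univ_prod_univ, Measure.prod_prod]; simp
  have hdm : Measurable fun z => ENNReal.ofReal (dens P G z) :=
    (continuous_dens hPc fun i => (hG i).continuous).measurable.ennreal_ofReal
  calc ∫⁻ z in A, ‖dil k u δ z - u z‖ₑ ^ 2
      ≤ ∫⁻ z in A, (∫⁻ p, ‖dilDeriv k P G p.1 z p.2‖ₑ ∂ν) ^ 2 := by
        refine setLIntegral_mono' hA fun z hzA => ?_
        gcongr
        exact enorm_dil_sub_le hu hk hks hk1 hG hPc hP hut hδ z (hz z hzA)
    _ ≤ ν univ * ∫⁻ p, ∫⁻ z in A, ‖dilDeriv k P G p.1 z p.2‖ₑ ^ 2 ∂volume ∂ν :=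
        lintegral_sq_lintegral_le (volume.restrict A) ν
          (G := fun z p => ‖dilDeriv k P G p.1 z p.2‖ₑ) hcd.enorm.measurable.aemeasurable
    _ ≤ ν univ * ∫⁻ p, (ENNReal.ofReal (8 * d * C ^ 2) *
          ∫⁻ z in Q, ENNReal.ofReal (dens P G z)) ∂ν := by
        gcongr ν univ * ?_
        refine lintegral_mono_ae ?_
        rw [hν, Measure.prod_restrict]
        filter_upwards [ae_restrict_mem
          (measurableSet_Icc.prod Metric.isClosed_closedBall.measurableSet)] with p hp
        calc ∫⁻ z in A, ‖dilDeriv k P G p.1 z p.2‖ₑ ^ 2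
            ≤ ∫⁻ z in A, ENNReal.ofReal (8 * d * C ^ 2) *
                Q.indicator (fun z => ENNReal.ofReal (dens P G z)) (z - scl p.1 p.2) := by
              refine setLIntegral_mono' hA fun z hzA => ?_
              rw [indicator_of_mem (hz z hzA p.1 hp.1 p.2 hp.2)]
              exact sq_dilDeriv_le hC hkC hkC' p.1 z p.2 hp.2
          _ ≤ ∫⁻ z, ENNReal.ofReal (8 * d * C ^ 2) *
                Q.indicator (fun z => ENNReal.ofReal (dens P G z)) (z - scl p.1 p.2) :=
              setLIntegral_le_lintegral _ _
          _ = ENNReal.ofReal (8 * d * C ^ 2) *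
                ∫⁻ z, Q.indicator (fun z => ENNReal.ofReal (dens P G z)) (z - scl p.1 p.2) :=
              lintegral_const_mul' _ _ ENNReal.ofReal_ne_top
          _ = _ := by
              -- The energy density was cut off to Q before the domain was enlarged from A to the
              -- whole space, so translation invariance returns exactly the energy on Q.
              rw [lintegral_sub_right_eq_self
                (fun z => Q.indicator (fun z => ENNReal.ofReal (dens P G z)) z),
                lintegral_indicator hQ]
    _ = _ := by
        rw [lintegral_const, hν1]; ring

/-- The mean value inequality along the segment from 0 to z, which stays in A. The spatial
derivatives of the mollification are averages of P; its time derivative is an average of ∇ · G, and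
moving the divergence onto the kernel at scale δ costs δ⁻¹. -/
lemma abs_dil_sub_dil_zero_le (hu : ContDiff ℝ 1 u) (hk : ContDiff ℝ 1 k)
    (hks : tsupport k ⊆ Metric.closedBall 0 1)
    (hG : ∀ i, ContDiff ℝ 1 (G i)) (hPc : ∀ i, Continuous (P i))
    (hP : ∀ z ∈ Q, ∀ i, dir (ex i) u z = P i z)
    (hut : ∀ z ∈ Q, dir et u z = ∑ i, dir (ex i) (G i) z) {δ N Z : ℝ} (hδ : 0 < δ) (hδ1 : δ ≤ 1)
    (hN : 0 ≤ N)
    (hstar : ∀ z ∈ A, ∀ s ∈ Icc (0 : ℝ) 1, s • z ∈ A) (hAZ : A ⊆ Metric.closedBall 0 Z)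
    (hz : ∀ z ∈ A, ∀ w ∈ Metric.closedBall 0 1, z - scl δ w ∈ Q)
    (hPN : ∀ z ∈ A, ∀ i, |∫ w, P i (z - scl δ w) * k w| ≤ N)
    (hGN : ∀ z ∈ A, ∀ i, |∫ w, G i (z - scl δ w) * dir (ex i) k w| ≤ N) (z : TS d)
    (hzA : z ∈ A) : |dil k u δ z - dil k u δ 0| ≤ 2 * d * Z * (δ⁻¹ * N) := by
  have hc : HasCompactSupport k := HasCompactSupport.of_support_subset_isCompact
    (isCompact_closedBall 0 1) ((subset_tsupport k).trans hks)
  have hB := isCompact_closedBall (0 : TS d) 1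
  have hd (s : ℝ) := hasDerivAt_integral_comp hu hk.continuous hB
    (γ := fun s w => s • z - scl δ w) (γ' := fun _ _ => z)
    (by
      have := continuous_scl_right (d := d) δ
      simp only [Function.uncurry_def]; fun_prop) (by fun_prop)
    (fun s w => by simpa using ((hasDerivAt_id s).smul_const z).sub_const (scl δ w)) s
  have e0 : ∀ y, dil k u δ y = ∫ w in Metric.closedBall 0 1, u (y - scl δ w) * k w := by
    intro y
    exact (setIntegral_ball_eq hks fun w hw => by simp [hw]).symm
  have hZ : ‖z‖ ≤ Z := by simpa using hAZ hzA
  have hcs (y : TS d) : Continuous fun w : TS d => y - scl δ w :=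
    continuous_const.sub (continuous_scl_right δ)
  have hbound : ∀ s ∈ Icc (0 : ℝ) 1,
      ‖∫ w in Metric.closedBall 0 1, fderiv ℝ u (s • z - scl δ w) z * k w‖
        ≤ 2 * d * Z * (δ⁻¹ * N) := by
    intro s hs
    have hsA := hstar z hzA s hs
    have i1 (i : Fin d) : Integrable fun w : TS d =>
        z.1 * (dir (ex i) (G i) (s • z - scl δ w) * (1 * k w)) :=
      (integrable_of_compact (((continuous_dir (hG i) _).comp (hcs _)).mul
        (continuous_const.mul hk.continuous)) hc.mul_left.mul_left).const_mul _
    have i2 (i : Fin d) : Integrable fun w : TS d =>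
        z.2 i * (P i (s • z - scl δ w) * k w) :=
      (integrable_of_compact (((hPc i).comp (hcs _)).mul hk.continuous) hc.mul_left).const_mul _
    have e1 : ∫ w in Metric.closedBall 0 1, fderiv ℝ u (s • z - scl δ w) z * k w =
        ∑ i, (z.1 * (δ⁻¹ * ∫ w, G i (s • z - scl δ w) * dir (ex i) k w)
          + z.2 i * ∫ w, P i (s • z - scl δ w) * k w) := by
      have e2 : ∀ w ∈ Metric.closedBall (0 : TS d) 1,
          fderiv ℝ u (s • z - scl δ w) z * k w =
          ∑ i, (z.1 * (dir (ex i) (G i) (s • z - scl δ w) * (1 * k w))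
            + z.2 i * (P i (s • z - scl δ w) * k w)) := by
        intro w hw
        have hq := hz _ hsA w hw
        rw [fderiv_apply_eq, hut _ hq]
        simp only [hP _ hq]
        rw [Finset.sum_add_distrib, add_mul, Finset.mul_sum, Finset.sum_mul, Finset.sum_mul]
        congr 1
        · exact Finset.sum_congr rfl fun i _ => by ring
        · exact Finset.sum_congr rfl fun i _ => by ring
      rw [setIntegral_congr_fun hB.measurableSet e2, setIntegral_ball_eq hks
        (fun w hw => by simp [hw]), integral_finsetSum]
      swap
      · exact fun i _ => (i1 i).add (i2 i)
      refine Finset.sum_congr rfl fun i _ => ?_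
      have e3 := integral_dir_comp_sub_scl (hG i) hk hc (contDiff_const (c := (1 : ℝ))) i
        (fun w => by simp [dir]) δ (s • z)
      rw [integral_add (i1 i) (i2 i), integral_const_mul, integral_const_mul]
      simp only [one_mul] at e3 ⊢
      rw [← e3, inv_mul_cancel_left₀ hδ.ne']
    rw [e1]
    refine (norm_sum_le _ _).trans ?_
    have hz1 : |z.1| ≤ Z := (norm_fst_le z).trans hZ
    have hz2 (i : Fin d) : |z.2 i| ≤ Z :=
      (PiLp.norm_apply_le z.2 i).trans ((norm_snd_le z).trans hZ)
    have hZ0 : 0 ≤ Z := (norm_nonneg z).trans hZ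
    have hδi : 1 ≤ δ⁻¹ := (one_le_inv₀ hδ).2 hδ1
    calc _ ≤ ∑ i : Fin d, 2 * Z * (δ⁻¹ * N) := by
          refine Finset.sum_le_sum fun i _ => ?_
          rw [Real.norm_eq_abs]
          refine (abs_add_le _ _).trans ?_
          rw [abs_mul, abs_mul, abs_mul, abs_of_nonneg (a := δ⁻¹) (by positivity)]
          have a1 : |z.1| * (δ⁻¹ * |∫ w, G i (s • z - scl δ w) * dir (ex i) k w|)
              ≤ Z * (δ⁻¹ * N) := by gcongr; exact hGN _ hsA i
          have a2 : |z.2 i| * |∫ w, P i (s • z - scl δ w) * k w| ≤ Z * (δ⁻¹ * N) := by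
            gcongr
            · exact hz2 i
            · exact (hPN _ hsA i).trans (le_mul_of_one_le_left hN hδi)
          linarith
      _ = _ := by simp; ring
  have := (convex_Icc (0 : ℝ) 1).norm_image_sub_le_of_norm_hasDerivWithin_le
    (fun s _ => (hd s).hasDerivWithinAt) hbound (left_mem_Icc.2 zero_le_one)
    (right_mem_Icc.2 zero_le_one)
  simpa [e0] using this

/-- A function with spatial gradient `P` and time derivative `∇ · G` oscillates little if
the mollifications of `P` and `G` are small. -/
theorem exists_osc_bound (hk : ContDiff ℝ 1 k)
    (hks : tsupport k ⊆ Metric.closedBall 0 1) (hk1 : ∫ w, k w = 1) {Z : ℝ} :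
    ∃ C, 0 < C ∧ ∀ (u : TS d → ℝ) (P G : Fin d → TS d → ℝ) (Q A : Set (TS d)) (δ N : ℝ),
      ContDiff ℝ 1 u → (∀ i, ContDiff ℝ 1 (G i)) → (∀ i, Continuous (P i)) →
      (∀ z ∈ Q, ∀ i, dir (ex i) u z = P i z) →
      (∀ z ∈ Q, dir et u z = ∑ i, dir (ex i) (G i) z) → 0 < δ → δ ≤ 1 → 0 ≤ N →
      MeasurableSet Q → MeasurableSet A → Q ⊆ Metric.closedBall 0 Z →
      A ⊆ Metric.closedBall 0 Z →
      (∀ z ∈ A, ∀ s ∈ Icc (0 : ℝ) 1, s • z ∈ A) →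
      (∀ z ∈ A, ∀ σ ∈ Icc 0 δ, ∀ w ∈ Metric.closedBall 0 1, z - scl σ w ∈ Q) →
      (∀ z ∈ A, ∀ i, |∫ w, P i (z - scl δ w) * k w| ≤ N) →
      (∀ z ∈ A, ∀ i, |∫ w, G i (z - scl δ w) * dir (ex i) k w| ≤ N) →
      ∃ c, ∫ z in A, (u z - c) ^ 2 ≤ C * (δ ^ 2 * ∫ z in Q, dens P G z) + C * (δ⁻¹ * N) ^ 2 := by
  have hc : HasCompactSupport k := HasCompactSupport.of_support_subset_isCompact
    (isCompact_closedBall 0 1) ((subset_tsupport k).trans hks)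
  obtain ⟨C0, hC0⟩ := hk.continuous.bounded_above_of_compact_support hc
  have hC1 (i : Fin d) : ∃ C, ∀ w, ‖dir (ex i) k w‖ ≤ C :=
    (continuous_dir hk (ex i)).bounded_above_of_compact_support (hasCompactSupport_dir hc _)
  choose C1 hC1 using hC1
  have hC0n : 0 ≤ C0 := (norm_nonneg _).trans (hC0 0)
  have hC1n (i : Fin d) : 0 ≤ C1 i := (norm_nonneg _).trans (hC1 i 0)
  set C := C0 + ∑ i, C1 i with hCdef
  have hC : 0 ≤ C := add_nonneg hC0n (Finset.sum_nonneg fun i _ => hC1n i)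
  have hkC : ∀ w, |k w| ≤ C := fun w => (hC0 w).trans
    (le_add_of_nonneg_right (Finset.sum_nonneg fun i _ => hC1n i))
  have hkC' : ∀ i w, |dir (ex i) k w| ≤ C := fun i w => (hC1 i w).trans
    ((Finset.single_le_sum (fun i _ => hC1n i) (Finset.mem_univ i)).trans
      (le_add_of_nonneg_left hC0n))
  set v1 := (volume (Metric.closedBall (0 : TS d) 1)).toReal
  set vZ := (volume (Metric.closedBall (0 : TS d) Z)).toReal
  -- The two factors 2 come from splitting (u - c)² through the mollification; the final 1 only
  -- ensures positivity.
  refine ⟨2 * (v1 ^ 2 * (8 * d * C ^ 2)) + 2 * ((2 * d * Z) ^ 2 * vZ) + 1, by positivity, ?_⟩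
  intro u P G Q A δ N hu hG hPc hP hut hδ hδ1 hN hQ hA hQZ hAZ hstar hz hPN hGN
  -- The constant is the value at the origin of the mollification at scale δ.
  refine ⟨dil k u δ 0, ?_⟩
  have hdc := continuous_dens hPc fun i => (hG i).continuous
  have hdQ : IntegrableOn (dens P G) Q :=
    (hdc.continuousOn.integrableOn_compact (isCompact_closedBall 0 Z)).mono_set hQZ
  have h1 := lintegral_enorm_dil_sub_le hu hk hks hk1 hC hkC hkC' hG hPc hP hut hδ hQ hA hz
  have h2 := abs_dil_sub_dil_zero_le hu hk hks hG hPc hP hut hδ hδ1 hN hstar hAZ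
    (fun z hzA w hw => hz z hzA δ (right_mem_Icc.2 hδ.le) w hw) hPN hGN
  rw [← ofReal_integral_eq_lintegral_ofReal hdQ (ae_of_all _ (dens_nonneg P G))] at h1
  set I := ∫ z in Q, dens P G z
  have hI : 0 ≤ I := integral_nonneg (dens_nonneg P G)
  have hv1 : volume (Metric.closedBall (0 : TS d) 1) = ENNReal.ofReal v1 :=
    (ENNReal.ofReal_toReal (isCompact_closedBall _ _).measure_lt_top.ne).symm
  have hvZ : volume (Metric.closedBall (0 : TS d) Z) = ENNReal.ofReal vZ :=
    (ENNReal.ofReal_toReal (isCompact_closedBall _ _).measure_lt_top.ne).symm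
  have hv1n : 0 ≤ v1 := ENNReal.toReal_nonneg
  have hvZn : 0 ≤ vZ := ENNReal.toReal_nonneg
  rw [hv1, ← ENNReal.ofReal_mul hδ.le, ← ENNReal.ofReal_pow (by positivity),
    ← ENNReal.ofReal_mul (by positivity), ← ENNReal.ofReal_mul (by positivity)] at h1
  have h3 : ∫⁻ z in A, ‖u z - dil k u δ 0‖ₑ ^ 2 ≤
      ENNReal.ofReal (2 * ((δ * v1) ^ 2 * (8 * d * C ^ 2 * I)) +
        2 * (2 * d * Z * (δ⁻¹ * N)) ^ 2 * vZ) := by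
    calc ∫⁻ z in A, ‖u z - dil k u δ 0‖ₑ ^ 2
        ≤ ∫⁻ z in A, (ENNReal.ofReal 2 * ‖dil k u δ z - u z‖ₑ ^ 2 +
            ENNReal.ofReal (2 * (2 * d * Z * (δ⁻¹ * N)) ^ 2)) := by
          refine setLIntegral_mono' hA fun z hzA => ?_
          rw [← ofReal_norm, ← ofReal_norm, ← ENNReal.ofReal_pow (norm_nonneg _),
            ← ENNReal.ofReal_pow (norm_nonneg _),
            ← ENNReal.ofReal_mul zero_le_two,
            ← ENNReal.ofReal_add (by positivity) (by positivity)]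
          refine ENNReal.ofReal_le_ofReal ?_
          have h4 := h2 z hzA
          simp only [Real.norm_eq_abs]
          rw [sq_abs, sq_abs]
          have h5 : (dil k u δ z - dil k u δ 0) ^ 2 ≤ (2 * d * Z * (δ⁻¹ * N)) ^ 2 :=
            sq_le_sq' (by linarith [(abs_le.1 h4).1]) (abs_le.1 h4).2
          nlinarith [sq_nonneg (2 * dil k u δ z - u z - dil k u δ 0)]
      _ = ENNReal.ofReal 2 * (∫⁻ z in A, ‖dil k u δ z - u z‖ₑ ^ 2) +
            ENNReal.ofReal (2 * (2 * d * Z * (δ⁻¹ * N)) ^ 2) * volume A := by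
          rw [lintegral_add_right _ measurable_const, lintegral_const_mul' _ _ (by simp),
            setLIntegral_const]
      _ ≤ ENNReal.ofReal 2 * ENNReal.ofReal ((δ * v1) ^ 2 * (8 * d * C ^ 2 * I)) +
            ENNReal.ofReal (2 * (2 * d * Z * (δ⁻¹ * N)) ^ 2) * ENNReal.ofReal vZ := by
          gcongr
          exact (measure_mono hAZ).trans hvZ.le
      _ = _ := by
          rw [ENNReal.ofReal_add (by positivity) (by positivity),
            ENNReal.ofReal_mul (q := (δ * v1) ^ 2 * (8 * d * C ^ 2 * I)) zero_le_two,
            ENNReal.ofReal_mul (p := 2 * (2 * d * Z * (δ⁻¹ * N)) ^ 2) (by positivity)]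
  rw [integral_sq_eq_toReal (f := fun z => u z - dil k u δ 0)
    (hu.continuous.sub continuous_const).aestronglyMeasurable]
  refine (ENNReal.toReal_mono ENNReal.ofReal_ne_top h3).trans ?_
  rw [ENNReal.toReal_ofReal (by positivity)]
  have a1 : 0 ≤ δ ^ 2 * I := by positivity
  have a2 : 0 ≤ (δ⁻¹ * N) ^ 2 := by positivity
  have a3 : 0 ≤ 2 * (v1 ^ 2 * (8 * d * C ^ 2)) := by positivity
  have a4 : 0 ≤ 2 * ((2 * d * Z) ^ 2 * vZ) := by positivity
  nlinarith [mul_nonneg a3 a2, mul_nonneg a4 a1]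

end Dil

lemma contDiff_two_of_infty {φ : TS d → ℝ} (h : ContDiff ℝ ∞ φ) : ContDiff ℝ 2 φ :=
  contDiff_infty.1 h 2

lemma contDiff_one_of_infty {φ : TS d → ℝ} (h : ContDiff ℝ ∞ φ) : ContDiff ℝ 1 φ :=
  contDiff_infty.1 h 1

/-! ### Changes of variables -/

lemma scl_eq_prodMap (σ : ℝ) :
    (scl σ : TS d → TS d) = Prod.map (fun t => σ ^ 2 • t) (fun x => σ • x) := by
  ext z : 1; rfl

/-- The parabolic homogeneous dimension is d + 2, as time counts twice. -/
lemma map_scl {σ : ℝ} (hσ : 0 < σ) :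
    Measure.map (scl σ) (volume : Measure (TS d)) =
      ENNReal.ofReal ((σ ^ (d + 2))⁻¹) • volume := by
  have h1 := Measure.map_addHaar_smul (volume : Measure ℝ) (r := σ ^ 2) (by positivity)
  have h2 := Measure.map_addHaar_smul (volume : Measure (Space d)) (r := σ) (by positivity)
  rw [scl_eq_prodMap, Measure.volume_eq_prod, ← Measure.map_prod_map _ _ (by fun_prop) (by fun_prop),
    h1, h2, Measure.prod_smul_left, Measure.prod_smul_right, smul_smul,
    ← ENNReal.ofReal_mul (by positivity)]
  congr 2
  rw [abs_of_nonneg (by positivity), abs_of_nonneg (by positivity), ← mul_inv, pow_add]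
  simp [mul_comm]

/-- The parabolic dilation as a homeomorphism. -/
def sclHomeo {σ : ℝ} (hσ : 0 < σ) : TS d ≃ₜ TS d where
  toFun := scl σ
  invFun := scl σ⁻¹
  left_inv z := by rw [scl_scl, inv_mul_cancel₀ hσ.ne', scl_one]
  right_inv z := by rw [scl_scl, mul_inv_cancel₀ hσ.ne', scl_one]
  continuous_toFun := continuous_scl_right σ
  continuous_invFun := continuous_scl_right _

lemma integral_comp_scl {σ : ℝ} (hσ : 0 < σ) (F : TS d → ℝ) :
    ∫ z, F (scl σ z) = (σ ^ (d + 2))⁻¹ * ∫ z, F z := by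
  have h := (sclHomeo (d := d) hσ).measurableEmbedding.integral_map (μ := volume) F
  have e : ((sclHomeo hσ : TS d ≃ₜ TS d) : TS d → TS d) = scl σ := rfl
  rw [e, map_scl hσ, integral_smul_measure, ENNReal.toReal_ofReal (by positivity)] at h
  rw [← h, smul_eq_mul]

lemma norm_scl_le {σ δ : ℝ} (h0 : 0 ≤ σ) (hσ : σ ≤ δ) (hδ : δ ≤ 1) {w : TS d}
    (hw : w ∈ Metric.closedBall 0 1) : ‖scl σ w‖ ≤ δ := by
  rw [mem_closedBall_zero_iff] at hw
  have h1 := (norm_fst_le w).trans hw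
  have h2 := (norm_snd_le w).trans hw
  unfold scl
  rw [Prod.norm_mk, norm_mul, norm_smul, Real.norm_of_nonneg (sq_nonneg σ), Real.norm_of_nonneg h0]
  refine max_le ?_ ?_
  · nlinarith [norm_nonneg w.1]
  · nlinarith [norm_nonneg w.2]

lemma norm_et : ‖(et : TS d)‖ = 1 := by simp [et, Prod.norm_mk]

lemma norm_ex (i : Fin d) : ‖(ex i : TS d)‖ = 1 := by simp [ex, Prod.norm_mk]

/-! ### A smooth convex gauge and its cutoff functions -/

/-- A smooth function whose sublevel sets interpolate between two consecutive cylinders. -/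
structure IsGauge (V₀ V : Set (TS d)) (h : TS d → ℝ) : Prop where
  contDiff : ContDiff ℝ ∞ h
  inner : V₀ ⊆ {z | h z < 1}
  compact : IsCompact {z | h z ≤ 3}
  outer : {z | h z ≤ 3} ⊆ V
  convex : Convex ℝ {z | h z < 3}
  star : ∀ z, ∀ s ∈ Icc (0 : ℝ) 1, h (s • z) ≤ h z

/-- The gauge is c (t^{2d} + ∑ xᵢ^{2d}), a smooth convex substitute for the sup norm. On the inner
cylinder each of the d + 1 powers is below 4^{-d}, so c = 4^d / (d + 1) gives a value below 1.
Conversely a value at most 3 forces every coordinate below 3/2 in modulus, since c (3/2)^{2d} = 9^d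
/ (d + 1) exceeds 3. The exponent grows with d to compensate the number of coordinates. -/
lemma exists_gauge (hd : 2 ≤ d) :
    ∃ h : TS d → ℝ, IsGauge (interval 0 ×ˢ cube d 0) (interval 1 ×ˢ cube d 1) h := by
  set c : ℝ := 4 ^ d / (d + 1) with hc
  have hcpos : 0 < c := by positivity
  have hev : Even (2 * d) := even_two_mul d
  set h : TS d → ℝ := fun z => c * (z.1 ^ (2 * d) + ∑ i, z.2 i ^ (2 * d)) with hh
  have hsm : ContDiff ℝ ∞ h := by
    have : ∀ i : Fin d, ContDiff ℝ ∞ fun z : TS d => z.2 i := fun i => by fun_prop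
    refine contDiff_const.mul (ContDiff.add (contDiff_fst.pow _) ?_)
    exact ContDiff.sum fun i _ => (this i).pow _
  have hcoord {z : TS d} (hz : h z ≤ 3) : |z.1| < 3 / 2 ∧ ∀ i, |z.2 i| < 3 / 2 := by
    have hb : (3 : ℝ) < c * (3 / 2) ^ (2 * d) := by
      have : c * (3 / 2) ^ (2 * d) = 9 ^ d / (d + 1) := by
        rw [hc, pow_mul, div_mul_eq_mul_div, ← mul_pow]; norm_num
      rw [this, lt_div_iff₀ (by positivity)]
      have hB : (1 : ℝ) + d * 8 ≤ (1 + 8) ^ d := one_add_mul_le_pow (by norm_num) d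
      have h2 : (2 : ℝ) ≤ d := by exact_mod_cast hd
      norm_num at hB
      nlinarith
    have key (x : ℝ) (hx : c * x ^ (2 * d) ≤ 3) : |x| < 3 / 2 := by
      have h1 : |x| ^ (2 * d) < (3 / 2 : ℝ) ^ (2 * d) := by
        rw [hev.pow_abs]
        exact lt_of_mul_lt_mul_left (hx.trans_lt hb) hcpos.le
      exact lt_of_pow_lt_pow_left₀ _ (by norm_num) h1
    have hs (i : Fin d) : z.2 i ^ (2 * d) ≤ ∑ i, z.2 i ^ (2 * d) :=
      Finset.single_le_sum (f := fun i => z.2 i ^ (2 * d)) (fun i _ => hev.pow_nonneg _)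
        (Finset.mem_univ i)
    have hs0 : 0 ≤ ∑ i, z.2 i ^ (2 * d) := Finset.sum_nonneg fun i _ => hev.pow_nonneg _
    have h1 : 0 ≤ z.1 ^ (2 * d) := hev.pow_nonneg _
    refine ⟨key _ (le_trans ?_ hz), fun i => key _ (le_trans ?_ hz)⟩
    · exact mul_le_mul_of_nonneg_left (by linarith) hcpos.le
    · exact mul_le_mul_of_nonneg_left (by linarith [hs i]) hcpos.le
  refine ⟨h, hsm, ?_, ?_, ?_, ?_, ?_⟩
  · rintro z ⟨hz1, hz2⟩
    have key (x : ℝ) (hx : x ∈ Ioo (-(1 / 2 : ℝ)) (1 / 2)) : x ^ (2 * d) < (1 / 4) ^ d := by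
      rw [← hev.pow_abs, pow_mul]
      have : |x| < 1 / 2 := abs_lt.2 hx
      refine pow_lt_pow_left₀ ?_ (by positivity) (by omega)
      nlinarith [abs_nonneg x]
    have h1 := key z.1 (by simpa [interval] using hz1)
    have h2 (i : Fin d) := key (z.2 i) (by simpa [cube] using hz2 i)
    have h3 : ∑ i, z.2 i ^ (2 * d) ≤ ∑ i : Fin d, (1 / 4 : ℝ) ^ d :=
      Finset.sum_le_sum fun i _ => (h2 i).le
    simp only [Finset.sum_const, Finset.card_univ, Fintype.card_fin, nsmul_eq_mul] at h3
    change h z < 1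
    calc h z < c * ((1 / 4 : ℝ) ^ d + d * (1 / 4) ^ d) :=
          mul_lt_mul_of_pos_left (by linarith) hcpos
      _ = 1 := by
        rw [hc, one_div, inv_pow]; field_simp; ring
  · refine Metric.isCompact_of_isClosed_isBounded (isClosed_le hsm.continuous continuous_const) ?_
    have hbdd : Bornology.IsBounded ((Icc (-2) 2 : Set ℝ) ×ˢ
        (WithLp.ofLp ⁻¹' (Set.pi univ fun _ => Icc (-2) 2) : Set (Space d))) := by
      refine (Metric.isBounded_Icc _ _).prod ?_
      have hcl : IsCompact (Set.pi univ fun _ : Fin d => Icc (-2 : ℝ) 2) :=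
        isCompact_univ_pi fun _ => isCompact_Icc
      exact ((PiLp.homeomorph 2 fun _ : Fin d => ℝ).isCompact_preimage.2 hcl).isBounded
    refine hbdd.subset fun z hz => ?_
    obtain ⟨h1, h2⟩ := hcoord hz
    refine ⟨abs_le.1 (by linarith), fun i _ => abs_le.1 (by linarith [h2 i])⟩
  · intro z hz
    obtain ⟨h1, h2⟩ := hcoord hz
    refine ⟨?_, fun i => ?_⟩
    · have := abs_lt.1 h1
      simp only [interval, mem_Ioo]
      norm_num
      exact ⟨by linarith, by linarith⟩
    · have := abs_lt.1 (h2 i)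
      norm_num
      exact ⟨by linarith, by linarith⟩
  · have hconv : ConvexOn ℝ univ h := by
      have e1 : ConvexOn ℝ univ fun z : TS d => z.1 ^ (2 * d) :=
        (hev.convexOn_pow (𝕜 := ℝ)).comp_linearMap (LinearMap.fst ℝ ℝ (Space d))
      have e2 (i : Fin d) : ConvexOn ℝ univ fun z : TS d => z.2 i ^ (2 * d) :=
        (hev.convexOn_pow (𝕜 := ℝ)).comp_linearMap
          ((EuclideanSpace.proj i : Space d →L[ℝ] ℝ).toLinearMap ∘ₗ LinearMap.snd ℝ ℝ (Space d))
      have e3 : ConvexOn ℝ univ fun z : TS d => ∑ i, z.2 i ^ (2 * d) := by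
        have : ∀ s : Finset (Fin d), ConvexOn ℝ univ fun z : TS d => ∑ i ∈ s, z.2 i ^ (2 * d) := by
          intro s
          induction s using Finset.induction_on with
          | empty => simpa using convexOn_const 0 convex_univ
          | insert a s ha ih => simp only [Finset.sum_insert ha]; exact (e2 a).add ih
        exact this _
      simpa [hh, smul_eq_mul] using (e1.add e3).smul hcpos.le
    simpa using hconv.convex_lt 3
  · intro z s hs
    have key (x : ℝ) : (s * x) ^ (2 * d) ≤ x ^ (2 * d) := by
      rw [mul_pow]
      exact mul_le_of_le_one_left (hev.pow_nonneg _) (pow_le_one₀ hs.1 hs.2)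
    simp only [hh, Prod.smul_fst, Prod.smul_snd, PiLp.smul_apply, smul_eq_mul]
    exact mul_le_mul_of_nonneg_left (add_le_add (key _) (Finset.sum_le_sum fun i _ => key _)) hcpos.le

namespace IsGauge

variable {V₀ V : Set (TS d)} {h : TS d → ℝ}

lemma continuous (hg : IsGauge V₀ V h) : Continuous h := hg.contDiff.continuous

/-- Small translations move the sublevel sets of the gauge by little. -/
lemma exists_margin (hg : IsGauge V₀ V h) :
    ∃ c, 0 < c ∧ c ≤ 1 ∧ ∀ z, h z ≤ 3 → ∀ v : TS d, ∀ τ, 0 < τ → τ ≤ 1 → ‖v‖ ≤ c * τ →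
      h (z + v) < h z + τ := by
  obtain ⟨Z, hZ⟩ := hg.compact.isBounded.subset_closedBall (0 : TS d)
  -- The extra 1 in the radius leaves room for a translation of norm at most 1.
  obtain ⟨K, hK⟩ := (contDiff_one_of_infty hg.contDiff).contDiffOn.exists_lipschitzOnWith (s := Metric.closedBall 0 (Z + 1))
      one_ne_zero (convex_closedBall _ _) (isCompact_closedBall _ _)
  refine ⟨1 / (K + 1), by positivity, ?_, ?_⟩
  · rw [div_le_one (by positivity)]
    exact le_add_of_nonneg_left K.2
  · intro z hz v τ hτ hτ1 hv
    have hK0 : (0 : ℝ) ≤ K := K.2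
    have hv1 : ‖v‖ ≤ 1 := hv.trans (by
      rw [div_mul_eq_mul_div, one_mul, div_le_one (by positivity)]; linarith)
    have hz1 : ‖z‖ ≤ Z := by simpa using hZ hz
    have := hK.dist_le_mul (z + v) (by
      rw [mem_closedBall_zero_iff]; exact (norm_add_le _ _).trans (by linarith)) z (by
      rw [mem_closedBall_zero_iff]; linarith)
    rw [Real.dist_eq, dist_eq_norm, add_sub_cancel_left] at this
    have h2 : K * ‖v‖ < τ := by
      calc K * ‖v‖ ≤ K * (1 / (K + 1) * τ) := by gcongr
        _ = (K / (K + 1)) * τ := by ring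
        _ < 1 * τ := by
          gcongr
          rw [div_lt_one (by positivity)]; linarith
        _ = τ := one_mul τ
    linarith [(abs_le.1 this).2]

end IsGauge

lemma dir_dir_eq {φ : TS d → ℝ} (hφ : ContDiff ℝ 2 φ) (v w z : TS d) :
    dir v (dir w φ) z = fderiv ℝ (fderiv ℝ φ) z v w := by
  have hd : DifferentiableAt ℝ (fderiv ℝ φ) z :=
    ((hφ.fderiv_right (m := 1) (by norm_num)).differentiable one_ne_zero) z
  unfold dir
  rw [fderiv_clm_apply hd (differentiableAt_const w)]
  simp

lemma hasCompactSupport_deriv_smoothTransition :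
    HasCompactSupport (deriv Real.smoothTransition) := by
  refine HasCompactSupport.intro (isCompact_Icc (a := (0 : ℝ)) (b := 1)) fun x hx => ?_
  rcases lt_or_ge x 0 with h | h
  · have : Real.smoothTransition =ᶠ[𝓝 x] fun _ => 0 := by
      filter_upwards [Iio_mem_nhds h] with y hy
      exact Real.smoothTransition.zero_of_nonpos (le_of_lt hy)
    rw [this.deriv_eq]; simp
  · have h1 : 1 < x := by
      by_contra h2
      exact hx ⟨h, not_lt.1 h2⟩
    have : Real.smoothTransition =ᶠ[𝓝 x] fun _ => 1 := by
      filter_upwards [Ioi_mem_nhds h1] with y hy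
      exact Real.smoothTransition.one_of_one_le (le_of_lt hy)
    rw [this.deriv_eq]; simp

/-- A cutoff function between the sublevel sets `{h ≤ r}` and `{h ≤ r₁}`. -/
structure IsCutoff (h : TS d → ℝ) (r r₁ M : ℝ) (ζ : TS d → ℝ) : Prop where
  contDiff : ContDiff ℝ ∞ ζ
  nonneg : ∀ z, 0 ≤ ζ z
  le_one : ∀ z, ζ z ≤ 1
  eq_one : ∀ z, h z ≤ r → ζ z = 1
  supp : tsupport ζ ⊆ {z | h z ≤ r₁}
  dir_le : ∀ z v, ‖v‖ ≤ 1 → |dir v ζ z| ≤ M / (r₁ - r)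
  dir_dir_le : ∀ z v w, ‖v‖ ≤ 1 → ‖w‖ ≤ 1 → |dir v (dir w ζ) z| ≤ M / (r₁ - r) ^ 2

/-- The cutoff is a fixed smooth transition composed with (r₁ - h)/(r₁ - r). Derivatives of h are
bounded on the compact set {h ≤ 3}, so one M serves all levels; r₁ - r ≤ 1 lets the first-order
contribution to the second derivative be bounded by the inverse square. -/
lemma IsGauge.exists_cutoff {V₀ V : Set (TS d)} {h : TS d → ℝ} (hg : IsGauge V₀ V h) :
    ∃ M, 0 < M ∧ ∀ r r₁, r < r₁ → r₁ ≤ r + 1 → r₁ < 3 → ∃ ζ, IsCutoff h r r₁ M ζ := by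
  have hθ : ContDiff ℝ ∞ Real.smoothTransition := Real.smoothTransition.contDiff
  have hθ' : ContDiff ℝ ∞ (deriv Real.smoothTransition) :=
    (contDiff_infty_iff_deriv.1 hθ).2
  obtain ⟨M1, hM1⟩ := hθ'.continuous.bounded_above_of_compact_support
    hasCompactSupport_deriv_smoothTransition
  obtain ⟨M2, hM2⟩ := ((contDiff_infty_iff_deriv.1 hθ').2).continuous.bounded_above_of_compact_support
    hasCompactSupport_deriv_smoothTransition.deriv
  have hf1 : ContDiff ℝ ∞ (fderiv ℝ h) := hg.contDiff.fderiv_right le_rfl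
  have hf2 : ContDiff ℝ ∞ (fderiv ℝ (fderiv ℝ h)) := hf1.fderiv_right le_rfl
  obtain ⟨M3, hM3⟩ := hg.compact.exists_bound_of_continuousOn hf1.continuous.continuousOn
  obtain ⟨M4, hM4⟩ := IsCompact.exists_bound_of_continuousOn (E := TS d →L[ℝ] TS d →L[ℝ] ℝ)
    hg.compact hf2.continuous.continuousOn
  have hM1n : 0 ≤ M1 := (norm_nonneg _).trans (hM1 0)
  have hM2n : 0 ≤ M2 := (norm_nonneg _).trans (hM2 0)
  refine ⟨M1 * |M3| + M2 * |M3| ^ 2 + M1 * |M4| + 1, by positivity, fun r r₁ hr hr1 hr3 => ?_⟩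
  set τ := r₁ - r with hτ
  have hτ0 : 0 < τ := sub_pos.2 hr
  have hτ1 : τ ≤ 1 := by linarith
  set l : TS d → ℝ := fun z => (r₁ - h z) / τ with hl
  have hlc : ContDiff ℝ ∞ l := (contDiff_const.sub hg.contDiff).div_const _
  set ζ : TS d → ℝ := fun z => Real.smoothTransition (l z) with hζ
  have hζc : ContDiff ℝ ∞ ζ := hθ.comp hlc
  have hdl (v z : TS d) : dir v l z = -(dir v h z) / τ := by
    have : HasFDerivAt l (τ⁻¹ • (-fderiv ℝ h z)) z := by
      have h1 := ((hg.contDiff.differentiable (by simp) z).hasFDerivAt.const_sub r₁).const_smul τ⁻¹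
      refine h1.congr_of_eventuallyEq (Eventually.of_forall fun y => ?_)
      simp [hl, div_eq_inv_mul]
    unfold dir
    rw [this.fderiv]
    simp [div_eq_inv_mul]
  have hcomp (ψ : ℝ → ℝ) (hψ : ContDiff ℝ ∞ ψ) (v z : TS d) :
      dir v (fun z => ψ (l z)) z = deriv ψ (l z) * dir v l z := by
    have h1 := ((hψ.differentiable (by simp) (l z)).hasDerivAt.comp_hasFDerivAt z
      (hlc.differentiable (by simp) z).hasFDerivAt)
    unfold dir
    have e : (fun z => ψ (l z)) = ψ ∘ l := rfl
    rw [e, h1.fderiv]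
    simp
  have hsupp : tsupport ζ ⊆ {z | h z ≤ r₁} := by
    refine closure_minimal (fun z hz => ?_) (isClosed_le hg.continuous continuous_const)
    by_contra hlt
    refine hz (Real.smoothTransition.zero_of_nonpos ?_)
    exact div_nonpos_of_nonpos_of_nonneg (by
      have : ¬ h z ≤ r₁ := hlt
      linarith [not_le.1 this]) hτ0.le
  have hM5 : ∀ z v, h z ≤ 3 → ‖v‖ ≤ 1 → |dir v h z| ≤ |M3| := fun z v hz hv =>
    calc |dir v h z| ≤ ‖fderiv ℝ h z‖ * ‖v‖ := (fderiv ℝ h z).le_opNorm v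
      _ ≤ |M3| * 1 := by gcongr; exact (hM3 z hz).trans (le_abs_self _)
      _ = |M3| := mul_one _
  have hM6 : ∀ z v w, h z ≤ 3 → ‖v‖ ≤ 1 → ‖w‖ ≤ 1 → |dir v (dir w h) z| ≤ |M4| := by
    intro z v w hz hv hw
    rw [dir_dir_eq (contDiff_two_of_infty hg.contDiff)]
    calc |fderiv ℝ (fderiv ℝ h) z v w| ≤ ‖fderiv ℝ (fderiv ℝ h) z‖ * ‖v‖ * ‖w‖ :=
          (fderiv ℝ (fderiv ℝ h) z).le_opNorm₂ v w
      _ ≤ |M4| * 1 * 1 := by gcongr; exact (hM4 z hz).trans (le_abs_self _)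
      _ = |M4| := by ring
  have hd1 (v z : TS d) : dir v ζ z = deriv Real.smoothTransition (l z) * (-(dir v h z) / τ) := by
    rw [hζ, hcomp _ hθ, hdl]
  refine ⟨ζ, hζc, fun z => Real.smoothTransition.nonneg _, fun z => Real.smoothTransition.le_one _,
    fun z hz => Real.smoothTransition.one_of_one_le ?_, hsupp, ?_, ?_⟩
  · rw [hl, le_div_iff₀ hτ0]; linarith
  · intro z v hv
    by_cases hz : z ∈ tsupport ζ
    · have hz3 : h z ≤ 3 := (hsupp hz).out.trans hr3.le
      rw [hd1, abs_mul, abs_div, abs_neg, abs_of_pos hτ0, ← mul_div_assoc]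
      gcongr
      have := mul_le_mul (hM1 (l z)) (hM5 z v hz3 hv) (abs_nonneg _) hM1n
      rw [Real.norm_eq_abs] at this
      have h1 : 0 ≤ M2 * |M3| ^ 2 := by positivity
      have h2 : 0 ≤ M1 * |M4| := by positivity
      linarith
    · rw [image_eq_zero_of_notMem_tsupport fun h => hz (tsupport_dir_subset ζ v h)]
      simp only [abs_zero]; positivity
  · intro z v w hv hw
    by_cases hz : z ∈ tsupport ζ
    · have hz3 : h z ≤ 3 := (hsupp hz).out.trans hr3.le
      have e1 : dir w ζ = fun z => deriv Real.smoothTransition (l z) * (-(dir w h z) / τ) := by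
        ext z; exact hd1 w z
      have hdw : ContDiff ℝ ∞ fun z => -(dir w h z) / τ :=
        (contDiff_dir_infty hg.contDiff w).neg.div_const _
      have e2 : dir v (fun z => -(dir w h z) / τ) z = -(dir v (dir w h) z) / τ := by
        have h1 := ((contDiff_dir_infty hg.contDiff w).differentiable (by simp) z).hasFDerivAt
        have h2 : HasFDerivAt (fun z => -(dir w h z) / τ) (τ⁻¹ • (-fderiv ℝ (dir w h) z)) z := by
          refine (h1.neg.const_smul τ⁻¹).congr_of_eventuallyEq (Eventually.of_forall fun y => ?_)
          simp [div_eq_inv_mul]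
        unfold dir at h2 ⊢
        rw [h2.fderiv]
        simp [div_eq_inv_mul]
      rw [e1, dir_mul (f := fun z => deriv Real.smoothTransition (l z)) ((hθ'.comp hlc).differentiable (by simp) z)
        (hdw.differentiable (by simp) z), e2, hcomp _ hθ', hdl]
      set a := deriv Real.smoothTransition (l z)
      set b := deriv (deriv Real.smoothTransition) (l z)
      have ha : |a| ≤ M1 := hM1 (l z)
      have hb : |b| ≤ M2 := hM2 (l z)
      have h1 := hM5 z v hz3 hv
      have h2 := hM5 z w hz3 hw
      have h3 := hM6 z v w hz3 hv hw
      have e3 : a * (-dir v (dir w h) z / τ) + b * (-dir v h z / τ) * (-dir w h z / τ) =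
          (-(a * dir v (dir w h) z * τ) + b * (dir v h z * dir w h z)) / τ ^ 2 := by
        field_simp
      rw [e3, abs_div, abs_of_pos (a := τ ^ 2) (by positivity)]
      gcongr
      refine (abs_add_le _ _).trans ?_
      rw [abs_neg, abs_mul, abs_mul, abs_mul, abs_mul, abs_of_pos hτ0]
      have h4 : |a| * |dir v (dir w h) z| * τ ≤ M1 * |M4| * 1 := by gcongr
      have h5 : |b| * (|dir v h z| * |dir w h z|) ≤ M2 * (|M3| * |M3|) := by gcongr
      have h6 : 0 ≤ M1 * |M3| := by positivity
      nlinarith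
    · rw [image_eq_zero_of_notMem_tsupport fun h => hz
        (tsupport_dir_subset ζ w (tsupport_dir_subset _ v h))]
      simp only [abs_zero]; positivity

/-! ### Bounds on functions tested against parabolic competitors -/

/-- `N` bounds the (non-normalized) norm of `F` in the dual of a parabolic Sobolev space on `V`. -/
def WeakBound (V : Set (TS d)) (N : ℝ) (F : TS d → ℝ) : Prop :=
  ∀ (w : TS d → ℝ) (K : ℝ), ContDiff ℝ 1 w → HasCompactSupport w → tsupport w ⊆ V → 0 < K →
    ∫ z, w z ^ 2 ≤ K ^ 2 → (∀ i, ∫ z, dir (ex i) w z ^ 2 ≤ K ^ 2) →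
    (∀ (φ : TS d → ℝ) (A : ℝ), ContDiff ℝ ∞ φ → HasCompactSupport φ → 0 < A →
      ∫ z, φ z ^ 2 ≤ A ^ 2 → (∀ i, ∫ z, dir (ex i) φ z ^ 2 ≤ A ^ 2) →
      |∫ z, w z * dt φ z| ≤ K * A) →
    |∫ z, F z * w z| ≤ N * K

lemma WeakBound.mono_set {V W : Set (TS d)} {N : ℝ} {F : TS d → ℝ} (h : WeakBound V N F)
    (hW : W ⊆ V) : WeakBound W N F :=
  fun w K h1 h2 h3 => h w K h1 h2 (h3.trans hW)

lemma setIntegral_sq_le {f : TS d → ℝ} (hf : Continuous f) (hc : HasCompactSupport f)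
    (Q : Set (TS d)) : ∫ z in Q, f z ^ 2 ≤ ∫ z, f z ^ 2 := by
  refine setIntegral_le_integral ?_ (ae_of_all _ fun z => sq_nonneg _)
  exact integrable_of_compact (hf.pow 2) (by simp only [pow_two]; exact hc.mul_left)

lemma memLp_restrict_of_continuous {f : TS d → ℝ} (hf : Continuous f) {Q : Set (TS d)} {Z : ℝ}
    (hQ : Q ⊆ Metric.closedBall 0 Z) : MemLp f 2 (volume.restrict Q) := by
  have hK := isCompact_closedBall (0 : TS d) Z
  obtain ⟨C, hC⟩ := hK.exists_bound_of_continuousOn hf.continuousOn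
  have : IsFiniteMeasure (volume.restrict (Metric.closedBall (0 : TS d) Z)) :=
    ⟨by simpa using hK.measure_lt_top⟩
  have : MemLp f 2 (volume.restrict (Metric.closedBall 0 Z)) :=
    MemLp.of_bound hf.aestronglyMeasurable C
      ((ae_restrict_mem hK.measurableSet).mono fun z hz => hC z hz)
  exact this.mono_measure (Measure.restrict_mono hQ le_rfl)

/-- The L² norm dominates the dual norm. This provides a crude weak bound for f and q, for which no
small weak norm is available. -/
lemma weakBound_of_integral_le {Q : Set (TS d)} {N Z : ℝ} {F : TS d → ℝ} (hN : 0 ≤ N)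
    (hF : Continuous F) (hQ : Q ⊆ Metric.closedBall 0 Z) (hFN : ∫ z in Q, F z ^ 2 ≤ N ^ 2) :
    WeakBound Q N F := by
  intro w K hw hc hs hK hwK _ _
  have e : ∫ z, F z * w z = ∫ z in Q, F z * w z := by
    refine (setIntegral_eq_integral_of_forall_compl_eq_zero fun z hz => ?_).symm
    rw [image_eq_zero_of_notMem_tsupport fun h => hz (hs h), mul_zero]
  rw [e]
  exact abs_integral_mul_le (memLp_restrict_of_continuous hF hQ)
    (memLp_restrict_of_continuous hw.continuous hQ) hN hK.le hFN
    ((setIntegral_sq_le hw.continuous hc Q).trans hwK)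

lemma integral_sq_le_of_bound {f : TS d → ℝ} {b Z : ℝ} (hfb : ∀ z, |f z| ≤ b)
    (hs : ∀ z, z ∉ Metric.closedBall (0 : TS d) Z → f z = 0) :
    ∫ z, f z ^ 2 ≤ b ^ 2 * (volume (Metric.closedBall (0 : TS d) Z)).toReal := by
  have e : ∫ z, f z ^ 2 = ∫ z in Metric.closedBall 0 Z, f z ^ 2 := by
    refine (setIntegral_eq_integral_of_forall_compl_eq_zero fun z hz => ?_).symm
    rw [hs z hz]; ring
  rw [e]
  refine (le_abs_self _).trans ?_
  rw [← Real.norm_eq_abs]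
  refine norm_setIntegral_le_of_norm_le_const (isCompact_closedBall _ _).measure_lt_top
    fun z _ => ?_
  rw [Real.norm_eq_abs, abs_pow]
  gcongr
  exact hfb z

lemma dir_comp_const_sub {f : TS d → ℝ} (z v y : TS d) (hf : DifferentiableAt ℝ f (z - y)) :
    dir v (fun y => f (z - y)) y = -dir v f (z - y) := by
  have h : HasFDerivAt (fun y => f (z - y)) ((fderiv ℝ f (z - y)).comp
      (-(ContinuousLinearMap.id ℝ (TS d)))) y :=
    HasFDerivAt.comp y (g := f) (f := fun y => z - y) hf.hasFDerivAt
      ((hasFDerivAt_id y).const_sub z)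
  unfold dir
  rw [h.fderiv]
  simp

/-- After a change of variables the integral is δ^{-(d+2)} times F tested against the rescaled
kernel. The parabolic norm of that kernel costs a further δ^{-2}, from its time derivative. -/
lemma exists_kernel_bound {k : TS d → ℝ} (hk : ContDiff ℝ ∞ k)
    (hks : tsupport k ⊆ Metric.closedBall 0 1) (Z : ℝ) :
    ∃ C, 0 < C ∧ ∀ (F : TS d → ℝ) (V : Set (TS d)) (N δ : ℝ) (z : TS d), WeakBound V N F →
      0 < δ → δ ≤ 1 → (∀ w ∈ Metric.closedBall 0 1, z - scl δ w ∈ V) →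
      V ⊆ Metric.closedBall 0 Z →
      |∫ w, F (z - scl δ w) * k w| ≤ C * δ⁻¹ ^ (d + 4) * N := by
  have hc : HasCompactSupport k := HasCompactSupport.of_support_subset_isCompact
    (isCompact_closedBall 0 1) ((subset_tsupport k).trans hks)
  have hk1 := contDiff_one_of_infty hk
  obtain ⟨C0, hC0⟩ := hk.continuous.bounded_above_of_compact_support hc
  have hfk : Continuous (fderiv ℝ k) := hk1.continuous_fderiv one_ne_zero
  obtain ⟨C1, hC1⟩ := hfk.bounded_above_of_compact_support (hc.fderiv ℝ)
  set vZ := (volume (Metric.closedBall (0 : TS d) Z)).toReal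
  have hvZ : 0 ≤ vZ := ENNReal.toReal_nonneg
  set C := |C0| + |C1| + 1
  have hC : 0 < C := by positivity
  have hkC (y : TS d) : |k y| ≤ C := (hC0 y).trans (by
    have := le_abs_self C0; have := abs_nonneg C1; simp only [C]; linarith)
  have hdC (v y : TS d) (hv : ‖v‖ = 1) : |dir v k y| ≤ C :=
    calc |dir v k y| ≤ ‖fderiv ℝ k y‖ * ‖v‖ := (fderiv ℝ k y).le_opNorm v
      _ ≤ C1 := by rw [hv, mul_one]; exact hC1 y
      _ ≤ C := by have := le_abs_self C1; have := abs_nonneg C0; simp only [C]; linarith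
  refine ⟨C * (1 + vZ), by positivity, fun F V N δ z hF hδ hδ1 hz hV => ?_⟩
  have hδi : 1 ≤ δ⁻¹ := (one_le_inv₀ hδ).2 hδ1
  set κ : TS d → ℝ := fun y => k (scl δ⁻¹ (z - y))
  have hks' : ContDiff ℝ ∞ fun y => k (scl δ⁻¹ y) := hk.comp (contDiff_scl δ⁻¹)
  have hκ : ContDiff ℝ ∞ κ := hks'.comp (contDiff_const.sub contDiff_id)
  have hκs : tsupport κ ⊆ V ∩ Metric.closedBall 0 Z := by
    intro y hy
    have h1 : scl δ⁻¹ (z - y) ∈ tsupport k :=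
      tsupport_comp_subset_preimage k (f := fun y => scl δ⁻¹ (z - y))
        ((continuous_scl_right _).comp (continuous_const.sub continuous_id)) hy
    have h2 := hz _ (hks h1)
    rw [scl_scl, mul_inv_cancel₀ hδ.ne', scl_one, sub_sub_cancel] at h2
    exact ⟨h2, hV h2⟩
  have hκc : HasCompactSupport κ := HasCompactSupport.of_support_subset_isCompact
    (isCompact_closedBall 0 Z) fun y hy => (hκs (subset_tsupport _ hy)).2
  have hκ1 := contDiff_one_of_infty hκ
  have hdκ (v y : TS d) : dir v κ y = -dir (scl δ⁻¹ v) k (scl δ⁻¹ (z - y)) := by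
    rw [dir_comp_const_sub (f := fun y => k (scl δ⁻¹ y)) z v y (hks'.differentiable (by simp) _),
      dir_comp_scl _ _ _ (hk.differentiable (by simp) _)]
  have hz0 (y : TS d) (hy : y ∉ Metric.closedBall (0 : TS d) Z) : κ y = 0 :=
    image_eq_zero_of_notMem_tsupport fun h => hy (hκs h).2
  have hz1 (v y : TS d) (hy : y ∉ Metric.closedBall (0 : TS d) Z) : dir v κ y = 0 :=
    image_eq_zero_of_notMem_tsupport fun h => hy (hκs (tsupport_dir_subset _ _ h)).2
  -- One bound for the kernel and its first derivatives: as δ ≤ 1, the factor δ⁻² of the time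
  -- derivative is the worst, and 1 + vZ dominates the square root of the volume of the support.
  set K := C * δ⁻¹ ^ 2 * (1 + vZ)
  have hK : 0 < K := by positivity
  have hbK {f : TS d → ℝ} (h1 : ∀ y, |f y| ≤ C * δ⁻¹ ^ 2)
      (h2 : ∀ y, y ∉ Metric.closedBall (0 : TS d) Z → f y = 0) : ∫ y, f y ^ 2 ≤ K ^ 2 := by
    refine (integral_sq_le_of_bound h1 h2).trans ?_
    rw [show K ^ 2 = (C * δ⁻¹ ^ 2) ^ 2 * (1 + vZ) ^ 2 by simp only [K]; ring]
    gcongr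
    change vZ ≤ _
    nlinarith
  have hbx (i : Fin d) (y : TS d) : |dir (ex i) κ y| ≤ C * δ⁻¹ ^ 2 := by
    rw [hdκ, abs_neg, scl_ex, dir_smul, abs_mul, abs_of_pos (by positivity), mul_comm]
    gcongr
    · exact hdC _ _ (norm_ex i)
    · nlinarith
  have hbt (y : TS d) : |dir et κ y| ≤ C * δ⁻¹ ^ 2 := by
    rw [hdκ, abs_neg, scl_et, dir_smul, abs_mul, abs_of_pos (by positivity), mul_comm]
    gcongr
    exact hdC _ _ norm_et
  have hb0 (y : TS d) : |κ y| ≤ C * δ⁻¹ ^ 2 := by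
    refine (hkC _).trans (le_mul_of_one_le_right hC.le ?_)
    nlinarith
  have hmain := hF κ K hκ1 hκc (fun y hy => (hκs hy).1) hK (hbK hb0 hz0)
    (fun i => hbK (hbx i) (hz1 _)) (by
      -- The kernel has its time derivative in L², so after integration by parts the L² bound on φ
      -- suffices.
      intro φ A hφ hφc hA hφA _
      have e := integral_dir_mul hκ1 (contDiff_one_of_infty hφ) hκc et
      rw [dt_eq_dir, ← abs_neg, ← e]
      exact abs_integral_mul_le
        (memLp_of_compact (continuous_dir hκ1 _) (hasCompactSupport_dir hκc _) 2 volume)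
        (memLp_of_compact hφ.continuous hφc 2 volume) hK.le hA.le (hbK hbt (hz1 _)) hφA)
  have e1 := integral_comp_scl hδ fun y => F (z - y) * k (scl δ⁻¹ y)
  simp only [scl_scl, inv_mul_cancel₀ hδ.ne', scl_one] at e1
  have e2 : ∫ y, F (z - y) * k (scl δ⁻¹ y) = ∫ y, F y * κ y := by
    rw [← integral_sub_left_eq_self (fun y => F (z - y) * k (scl δ⁻¹ y)) volume z]
    simp [κ]
  rw [e1, e2, abs_mul, abs_of_pos (by positivity)]
  calc (δ ^ (d + 2))⁻¹ * |∫ y, F y * κ y| ≤ (δ ^ (d + 2))⁻¹ * (N * K) := by gcongr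
    _ = _ := by simp only [K, inv_pow]; ring

/-- The two averages in the oscillation estimate are tests against k and ∂ᵢk, so each is at most a
multiple of δ^{-(d+4)} N. The remaining δ⁻¹ of the oscillation estimate gives the exponent d + 5. -/
theorem exists_weak_osc_bound (d : ℕ) {Z : ℝ} :
    ∃ C, 0 < C ∧ ∀ (u : TS d → ℝ) (P G : Fin d → TS d → ℝ) (Q A : Set (TS d)) (δ N e : ℝ),
      ContDiff ℝ 1 u → (∀ i, ContDiff ℝ 1 (G i)) → (∀ i, Continuous (P i)) →
      (∀ z ∈ Q, ∀ i, dir (ex i) u z = P i z) →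
      (∀ z ∈ Q, dir et u z = ∑ i, dir (ex i) (G i) z) → 0 < δ → δ ≤ 1 → 0 ≤ N → 0 ≤ e →
      MeasurableSet Q → MeasurableSet A → Q ⊆ Metric.closedBall 0 Z →
      A ⊆ Metric.closedBall 0 Z →
      (∀ z ∈ A, ∀ s ∈ Icc (0 : ℝ) 1, s • z ∈ A) →
      (∀ z ∈ A, ∀ σ ∈ Icc 0 δ, ∀ w ∈ Metric.closedBall 0 1, z - scl σ w ∈ Q) →
      (∀ i, WeakBound Q N (P i)) → (∀ i, WeakBound Q N (G i)) →
      ∫ z in Q, dens P G z ≤ e ^ 2 →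
      ∃ c, ∫ z in A, (u z - c) ^ 2 ≤ (C * (δ * e + δ⁻¹ ^ (d + 5) * N)) ^ 2 := by
  set k : TS d → ℝ := moll 0
  have hk : ContDiff ℝ ∞ k := contDiff_moll 0
  have hks : tsupport k ⊆ Metric.closedBall 0 1 := by
    rw [tsupport_moll]; simp
  obtain ⟨C0, hC0, hosc⟩ := exists_osc_bound (contDiff_one_of_infty hk) hks (integral_moll 0) (Z := Z)
  obtain ⟨C1, hC1, hker⟩ := exists_kernel_bound hk hks Z
  have hker' (i : Fin d) := exists_kernel_bound (contDiff_dir_infty hk (ex i))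
    ((tsupport_dir_subset k (ex i)).trans hks) Z
  choose C2 hC2 hker2 using hker'
  set D := C1 + ∑ i, C2 i
  have hS : 0 ≤ ∑ i, C2 i := Finset.sum_nonneg fun i _ => (hC2 i).le
  have hD : 0 < D := by positivity
  refine ⟨(1 + C0) * (1 + D), by positivity, ?_⟩
  intro u P G Q A δ N e hu hG hPc hP hut hδ hδ1 hN he hQ hA hQZ hAZ hstar hz hPN hGN hE
  set N' := D * δ⁻¹ ^ (d + 4) * N
  have hzδ : ∀ z ∈ A, ∀ w ∈ Metric.closedBall 0 1, z - scl δ w ∈ Q :=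
    fun z hzA => hz z hzA δ (right_mem_Icc.2 hδ.le)
  obtain ⟨c, hc⟩ := hosc u P G Q A δ N' hu hG hPc hP hut hδ hδ1 (by positivity) hQ hA hQZ hAZ
    hstar hz
    (fun z hzA i => (hker (P i) Q N δ z (hPN i) hδ hδ1 (hzδ z hzA) hQZ).trans (by
      simp only [N']; gcongr; simp only [D]; linarith))
    (fun z hzA i => (hker2 i (G i) Q N δ z (hGN i) hδ hδ1 (hzδ z hzA) hQZ).trans (by
      simp only [N']; gcongr
      exact (Finset.single_le_sum (fun i _ => (hC2 i).le) (Finset.mem_univ i)).trans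
        (by simp only [D]; linarith)))
  refine ⟨c, hc.trans ?_⟩
  set a := δ * e
  set b := δ⁻¹ ^ (d + 5) * N
  have ha : 0 ≤ a := by positivity
  have hb : 0 ≤ b := by positivity
  have e1 : δ⁻¹ * N' = D * b := by simp only [N', b]; ring
  calc C0 * (δ ^ 2 * ∫ z in Q, dens P G z) + C0 * (δ⁻¹ * N') ^ 2
      ≤ C0 * (δ ^ 2 * e ^ 2) + C0 * (δ⁻¹ * N') ^ 2 := by gcongr
    _ = C0 * (a ^ 2 + D ^ 2 * b ^ 2) := by rw [e1]; simp only [a]; ring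
    _ ≤ (1 + C0) ^ 2 * ((1 + D) ^ 2 * (a + b) ^ 2) := by
      have h1 : C0 ≤ (1 + C0) ^ 2 := by nlinarith
      have h2 : a ^ 2 + D ^ 2 * b ^ 2 ≤ (1 + D) ^ 2 * (a + b) ^ 2 := by
        have : (1 + D) ^ 2 * (a + b) ^ 2 = a ^ 2 + D ^ 2 * b ^ 2 +
          ((2 * D + D ^ 2) * a ^ 2 + (1 + 2 * D) * b ^ 2 + (1 + D) ^ 2 * (2 * a * b)) := by ring
        rw [this]
        have : 0 ≤ ((2 * D + D ^ 2) * a ^ 2 + (1 + 2 * D) * b ^ 2 + (1 + D) ^ 2 * (2 * a * b)) := by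
          positivity
        linarith
      exact mul_le_mul h1 h2 (by positivity) (by positivity)
    _ = _ := by ring

/-! ### The localized energy estimate for smooth solution pairs -/

/-- Smooth fields with `∇u = p`, `∂ₜu = ∇ · g`, `∇us = q`, `∂ₜus = ∇ · f` in `O`. -/
structure SmoothSol (O : Set (TS d)) (u us : TS d → ℝ) (p g q f : Fin d → TS d → ℝ) : Prop where
  u_smooth : ContDiff ℝ 1 u
  us_smooth : ContDiff ℝ 1 us
  p_cont : ∀ i, Continuous (p i)
  q_cont : ∀ i, Continuous (q i)
  g_smooth : ∀ i, ContDiff ℝ 1 (g i)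
  f_smooth : ∀ i, ContDiff ℝ 1 (f i)
  grad_u : ∀ z ∈ O, ∀ i, dir (ex i) u z = p i z
  dt_u : ∀ z ∈ O, dir et u z = ∑ i, dir (ex i) (g i) z
  grad_us : ∀ z ∈ O, ∀ i, dir (ex i) us z = q i z
  dt_us : ∀ z ∈ O, dir et us z = ∑ i, dir (ex i) (f i) z

lemma dir_sub_const (u : TS d → ℝ) (c : ℝ) (v : TS d) : dir v (fun z => u z - c) = dir v u := by
  ext z; unfold dir; rw [fderiv_sub_const]

section SmoothSol

variable {O : Set (TS d)} {u us : TS d → ℝ} {p g q f : Fin d → TS d → ℝ}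

lemma SmoothSol.sub_const (h : SmoothSol O u us p g q f) (c c' : ℝ) :
    SmoothSol O (fun z => u z - c) (fun z => us z - c') p g q f where
  u_smooth := h.u_smooth.sub contDiff_const
  us_smooth := h.us_smooth.sub contDiff_const
  p_cont := h.p_cont
  q_cont := h.q_cont
  g_smooth := h.g_smooth
  f_smooth := h.f_smooth
  grad_u := by simpa only [dir_sub_const] using h.grad_u
  dt_u := by simpa only [dir_sub_const] using h.dt_u
  grad_us := by simpa only [dir_sub_const] using h.grad_us
  dt_us := by simpa only [dir_sub_const] using h.dt_us

lemma dir_mul_mul {a b ζ : TS d → ℝ} {z : TS d} (ha : DifferentiableAt ℝ a z)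
    (hb : DifferentiableAt ℝ b z) (hζ : DifferentiableAt ℝ ζ z) (v : TS d) :
    dir v (fun z => a z * b z * ζ z) z =
      a z * b z * dir v ζ z + (a z * dir v b z + dir v a z * b z) * ζ z := by
  rw [dir_mul (f := fun z => a z * b z) (ha.mul hb) hζ, dir_mul ha hb]

/-- In ∂ₜ(u us ζ) - ∇ · (u f ζ) - ∇ · (us g ζ) the terms u ∇ · f and us ∇ · g cancel against ∂ₜus
and ∂ₜu. What remains is the energy density and terms in which ζ is differentiated. -/
lemma SmoothSol.energy_identity (h : SmoothSol O u us p g q f) {ζ : TS d → ℝ}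
    (hζ : ContDiff ℝ 1 ζ) (hc : HasCompactSupport ζ) (hζO : tsupport ζ ⊆ O) :
    ∫ z, ζ z * ∑ i, (p i z * f i z + q i z * g i z) =
      (∫ z, u z * (us z * dir et ζ z)) - (∑ i, ∫ z, u z * (f i z * dir (ex i) ζ z))
        - ∑ i, ∫ z, g i z * (us z * dir (ex i) ζ z) := by
  have hu := h.u_smooth
  have hus := h.us_smooth
  have hX : ContDiff ℝ 1 fun z => u z * us z * ζ z := (hu.mul hus).mul hζ
  have hY (i : Fin d) : ContDiff ℝ 1 fun z => u z * f i z * ζ z := (hu.mul (h.f_smooth i)).mul hζ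
  have hW (i : Fin d) : ContDiff ℝ 1 fun z => us z * g i z * ζ z :=
    (hus.mul (h.g_smooth i)).mul hζ
  have iX := integral_dir hX hc.mul_left et
  have iY (i : Fin d) := integral_dir (hY i) hc.mul_left (ex i)
  have iW (i : Fin d) := integral_dir (hW i) hc.mul_left (ex i)
  have nX : Integrable (dir et fun z => u z * us z * ζ z) :=
    integrable_of_compact (continuous_dir hX _) (hasCompactSupport_dir hc.mul_left _)
  have nY (i : Fin d) : Integrable (dir (ex i) fun z => u z * f i z * ζ z) :=
    integrable_of_compact (continuous_dir (hY i) _) (hasCompactSupport_dir hc.mul_left _)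
  have nW (i : Fin d) : Integrable (dir (ex i) fun z => us z * g i z * ζ z) :=
    integrable_of_compact (continuous_dir (hW i) _) (hasCompactSupport_dir hc.mul_left _)
  have n1 : Integrable fun z => u z * (us z * dir et ζ z) :=
    integrable_of_compact (hu.continuous.mul (hus.continuous.mul (continuous_dir hζ _)))
      (hasCompactSupport_dir hc _).mul_left.mul_left
  have n2 (i : Fin d) : Integrable fun z => u z * (f i z * dir (ex i) ζ z) :=
    integrable_of_compact
      (hu.continuous.mul ((h.f_smooth i).continuous.mul (continuous_dir hζ _)))
      (hasCompactSupport_dir hc _).mul_left.mul_left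
  have n3 (i : Fin d) : Integrable fun z => g i z * (us z * dir (ex i) ζ z) :=
    integrable_of_compact
      ((h.g_smooth i).continuous.mul (hus.continuous.mul (continuous_dir hζ _)))
      (hasCompactSupport_dir hc _).mul_left.mul_left
  have hpt (z : TS d) : ζ z * ∑ i, (p i z * f i z + q i z * g i z) =
      u z * (us z * dir et ζ z) - (∑ i, u z * (f i z * dir (ex i) ζ z))
        - (∑ i, g i z * (us z * dir (ex i) ζ z))
        - (dir et (fun z => u z * us z * ζ z) z
          - (∑ i, dir (ex i) (fun z => u z * f i z * ζ z) z)
          - ∑ i, dir (ex i) (fun z => us z * g i z * ζ z) z) := by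
    have du := hu.differentiable one_ne_zero z
    have dus := hus.differentiable one_ne_zero z
    have dζ := hζ.differentiable one_ne_zero z
    have df (i : Fin d) := (h.f_smooth i).differentiable one_ne_zero z
    have dg (i : Fin d) := (h.g_smooth i).differentiable one_ne_zero z
    have e1 := dir_mul_mul du dus dζ et
    have e2 (i : Fin d) := dir_mul_mul du (df i) dζ (ex i)
    have e3 (i : Fin d) := dir_mul_mul dus (dg i) dζ (ex i)
    simp only [e1, e2, e3]
    by_cases hz : z ∈ tsupport ζ
    · have hzO := hζO hz
      simp only [h.grad_u z hzO, h.grad_us z hzO, h.dt_u z hzO, h.dt_us z hzO]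
      simp only [add_mul, Finset.sum_add_distrib, mul_add, Finset.mul_sum, Finset.sum_mul]
      simp only [mul_assoc, mul_comm, mul_left_comm]
      ring
    · have h0 : ζ z = 0 := image_eq_zero_of_notMem_tsupport hz
      have h1 (v : TS d) : dir v ζ z = 0 :=
        image_eq_zero_of_notMem_tsupport fun h => hz (tsupport_dir_subset ζ v h)
      simp [h0, h1]
  simp only [hpt]
  rw [integral_sub, integral_sub, integral_sub n1, integral_sub, integral_sub nX,
    integral_finsetSum _ fun i _ => n2 i, integral_finsetSum _ fun i _ => n3 i,
    integral_finsetSum _ fun i _ => nY i, integral_finsetSum _ fun i _ => nW i, iX]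
  · simp [iY, iW]
  · exact integrable_finsetSum _ fun i _ => nY i
  · exact nX.sub (integrable_finsetSum _ fun i _ => nY i)
  · exact integrable_finsetSum _ fun i _ => nW i
  · exact integrable_finsetSum _ fun i _ => n2 i
  · exact n1.sub (integrable_finsetSum _ fun i _ => n2 i)
  · exact integrable_finsetSum _ fun i _ => n3 i
  · exact (n1.sub (integrable_finsetSum _ fun i _ => n2 i)).sub
      (integrable_finsetSum _ fun i _ => n3 i)
  · exact (nX.sub (integrable_finsetSum _ fun i _ => nY i)).sub
      (integrable_finsetSum _ fun i _ => nW i)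

end SmoothSol

/-! ### Bounding the localized energy -/

section Energy

variable {O A : Set (TS d)} {u us : TS d → ℝ} {p g q f : Fin d → TS d → ℝ}

lemma integral_mul_eq_setIntegral {a b : TS d → ℝ} {A : Set (TS d)} (hA : tsupport b ⊆ A) :
    ∫ z, a z * b z = ∫ z in A, a z * b z := by
  refine (setIntegral_eq_integral_of_forall_compl_eq_zero fun z hz => ?_).symm
  rw [image_eq_zero_of_notMem_tsupport fun h => hz (hA h), mul_zero]

/-- The square integral of a product with a bounded function supported in `A`. -/
lemma integral_mul_sq_le {a b : TS d → ℝ} {A : Set (TS d)} {L X Z : ℝ}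
    (ha : Continuous a) (hAZ : A ⊆ Metric.closedBall 0 Z)
    (hb : ∀ z, |b z| ≤ L) (hbA : ∀ z, z ∉ A → b z = 0) (haX : ∫ z in A, a z ^ 2 ≤ X ^ 2) :
    ∫ z, (a z * b z) ^ 2 ≤ (L * X) ^ 2 := by
  have e : ∫ z, (a z * b z) ^ 2 = ∫ z in A, (a z * b z) ^ 2 := by
    refine (setIntegral_eq_integral_of_forall_compl_eq_zero fun z hz => ?_).symm
    rw [hbA z hz]; ring
  rw [e, mul_pow]
  calc ∫ z in A, (a z * b z) ^ 2 ≤ ∫ z in A, L ^ 2 * a z ^ 2 := by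
        refine integral_mono_of_nonneg (ae_of_all _ fun z => sq_nonneg _)
          ((memLp_restrict_of_continuous ha hAZ).integrable_sq.const_mul _)
          (ae_of_all _ fun z => ?_)
        simp only [mul_pow]
        rw [mul_comm]
        gcongr ?_ * _
        rw [← sq_abs]
        exact pow_le_pow_left₀ (abs_nonneg _) (hb z) 2
    _ = L ^ 2 * ∫ z in A, a z ^ 2 := integral_const_mul _ _
    _ ≤ _ := by gcongr

/-- Each term of the identity has one small factor. Those with u are estimated by Cauchy-Schwarz
with the L² bound U. The term with g is estimated by duality with the competitor us ∂ᵢζ, whose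
parabolic norm is at most 4(d + 1)LX because ∇us = q and ∂ₜus = ∇ · f. -/
lemma SmoothSol.energy_le (h : SmoothSol O u us p g q f) {ζ : TS d → ℝ} {L U X N Z : ℝ}
    {V : Set (TS d)}
    (hζ : ContDiff ℝ ∞ ζ) (hζA : tsupport ζ ⊆ A) (hAO : A ⊆ O) (hAV : A ⊆ V)
    (hAZ : A ⊆ Metric.closedBall 0 Z)
    (hL : 0 < L) (hL1 : ∀ z v, ‖v‖ ≤ 1 → |dir v ζ z| ≤ L)
    (hL2 : ∀ z v w, ‖v‖ ≤ 1 → ‖w‖ ≤ 1 → |dir v (dir w ζ) z| ≤ L)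
    (hU : 0 ≤ U) (hX : 0 < X) (hN : 0 ≤ N)
    (huU : ∫ z in A, u z ^ 2 ≤ U ^ 2) (husX : ∫ z in A, us z ^ 2 ≤ X ^ 2)
    (hqX : ∀ i, ∫ z in A, q i z ^ 2 ≤ X ^ 2) (hfX : ∀ i, ∫ z in A, f i z ^ 2 ≤ X ^ 2)
    (hgN : ∀ i, WeakBound V N (g i)) :
    ∫ z, ζ z * ∑ i, (p i z * f i z + q i z * g i z) ≤
      4 * (d + 1) ^ 2 * L * X * (U + N) := by
  have hc : HasCompactSupport ζ := HasCompactSupport.of_support_subset_isCompact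
    (isCompact_closedBall 0 Z) ((subset_tsupport ζ).trans (hζA.trans hAZ))
  have hζ1 := contDiff_one_of_infty hζ
  have hus := h.us_smooth
  have hdζ (v : TS d) : ContDiff ℝ ∞ (dir v ζ) := contDiff_dir_infty hζ v
  have hdζ1 (v : TS d) : ContDiff ℝ 1 (dir v ζ) := contDiff_one_of_infty (hdζ v)
  have hdc (v : TS d) : HasCompactSupport (dir v ζ) := hasCompactSupport_dir hc v
  have hs1 (v : TS d) : tsupport (dir v ζ) ⊆ A := (tsupport_dir_subset _ _).trans hζA
  have hs2 (v w : TS d) : tsupport (dir v (dir w ζ)) ⊆ A := (tsupport_dir_subset _ _).trans (hs1 w)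
  have hz1 (v z : TS d) (hz : z ∉ A) : dir v ζ z = 0 :=
    image_eq_zero_of_notMem_tsupport fun h => hz (hs1 v h)
  have hz2 (v w z : TS d) (hz : z ∉ A) : dir v (dir w ζ) z = 0 :=
    image_eq_zero_of_notMem_tsupport fun h => hz (hs2 v w h)
  have net : ‖(et : TS d)‖ ≤ 1 := norm_et.le
  have nex (i : Fin d) : ‖(ex i : TS d)‖ ≤ 1 := (norm_ex i).le
  rw [h.energy_identity hζ1 hc (hζA.trans hAO)]
  -- the two terms with `u`
  have hterm (a : TS d → ℝ) (ha : Continuous a) (haX : ∫ z in A, a z ^ 2 ≤ X ^ 2) (v : TS d)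
      (hv : ‖v‖ ≤ 1) : |∫ z, u z * (a z * dir v ζ z)| ≤ U * (L * X) := by
    have hcont : Continuous fun z => a z * dir v ζ z := ha.mul (hdζ v).continuous
    have hcc : HasCompactSupport fun z => a z * dir v ζ z := (hdc v).mul_left
    rw [integral_mul_eq_setIntegral (A := A) ((tsupport_mul_subset_right).trans (hs1 v))]
    refine abs_integral_mul_le (memLp_restrict_of_continuous h.u_smooth.continuous hAZ)
      (memLp_restrict_of_continuous hcont hAZ) hU (by positivity) huU ?_
    exact (setIntegral_sq_le hcont hcc A).trans
      (integral_mul_sq_le ha hAZ (fun z => hL1 z v hv) (fun z => hz1 v z) haX)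
  have t1 := (abs_le.1 (hterm us hus.continuous husX et net)).2
  have t2 (i : Fin d) := (abs_le.1 (hterm (f i) (h.f_smooth i).continuous (hfX i) (ex i) (nex i))).1
  -- the term tested by duality
  have t3 (i : Fin d) : |∫ z, g i z * (us z * dir (ex i) ζ z)| ≤ N * (4 * (d + 1) * L * X) := by
    set w : TS d → ℝ := fun z => us z * dir (ex i) ζ z
    have hw : ContDiff ℝ 1 w := hus.mul (hdζ1 _)
    have hwc : HasCompactSupport w := (hdc _).mul_left
    have hws : tsupport w ⊆ A := (tsupport_mul_subset_right).trans (hs1 _)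
    have hd0 : (0 : ℝ) ≤ d := Nat.cast_nonneg d
    have hLX : 0 < L * X := by positivity
    have hdw (v z : TS d) : dir v w z = us z * dir v (dir (ex i) ζ) z + dir v us z * dir (ex i) ζ z :=
      dir_mul (hus.differentiable one_ne_zero z) ((hdζ1 _).differentiable one_ne_zero z) v
    refine hgN i w (4 * (d + 1) * L * X) hw hwc (hws.trans hAV) (by positivity) ?_ ?_ ?_
    · refine (integral_mul_sq_le hus.continuous hAZ (fun z => hL1 z _ (nex i))
        (fun z => hz1 _ z) husX).trans ?_
      gcongr
      nlinarith
    · intro j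
      have e1 (z : TS d) : dir (ex j) w z ^ 2 ≤
          2 * (us z * dir (ex j) (dir (ex i) ζ) z) ^ 2 + 2 * (q j z * dir (ex i) ζ z) ^ 2 := by
        rw [hdw]
        by_cases hz : z ∈ A
        · rw [h.grad_us z (hAO hz)]
          exact add_sq_le.trans (by linarith)
        · rw [hz1 _ z hz, hz2 _ _ z hz]; simp
      have i1 : Integrable fun z => (us z * dir (ex j) (dir (ex i) ζ) z) ^ 2 := by
        refine (memLp_of_compact (f := fun z => us z * dir (ex j) (dir (ex i) ζ) z) ?_ ?_
          2 volume).integrable_sq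
        · exact hus.continuous.mul (continuous_dir (hdζ1 _) _)
        · exact (hasCompactSupport_dir (hdc _) _).mul_left
      have i2 : Integrable fun z => (q j z * dir (ex i) ζ z) ^ 2 := by
        refine (memLp_of_compact (f := fun z => q j z * dir (ex i) ζ z) ?_ ?_
          2 volume).integrable_sq
        · exact (h.q_cont j).mul (hdζ1 _).continuous
        · exact (hdc _).mul_left
      calc ∫ z, dir (ex j) w z ^ 2
          ≤ ∫ z, (2 * (us z * dir (ex j) (dir (ex i) ζ) z) ^ 2 +
              2 * (q j z * dir (ex i) ζ z) ^ 2) :=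
            integral_mono_of_nonneg (ae_of_all _ fun z => sq_nonneg _)
              ((i1.const_mul 2).add (i2.const_mul 2)) (ae_of_all _ e1)
        _ = 2 * (∫ z, (us z * dir (ex j) (dir (ex i) ζ) z) ^ 2) +
              2 * ∫ z, (q j z * dir (ex i) ζ z) ^ 2 := by
            rw [integral_add (i1.const_mul 2) (i2.const_mul 2), integral_const_mul,
              integral_const_mul]
        _ ≤ 2 * (L * X) ^ 2 + 2 * (L * X) ^ 2 := by
            gcongr
            · exact integral_mul_sq_le hus.continuous hAZ (fun z => hL2 z _ _ (nex j) (nex i))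
                (fun z => hz2 _ _ z) husX
            · exact integral_mul_sq_le (h.q_cont j) hAZ (fun z => hL1 z _ (nex i))
                (fun z => hz1 _ z) (hqX j)
        _ = (2 * (L * X)) ^ 2 := by ring
        _ ≤ _ := by
            refine pow_le_pow_left₀ (by positivity) ?_ 2
            nlinarith
    · intro φ B hφ hφc hB hφB hφB'
      have hφ1 := contDiff_one_of_infty hφ
      have mφ : MemLp φ 2 volume := memLp_of_compact hφ.continuous hφc 2 volume
      have mdφ (v : TS d) : MemLp (dir v φ) 2 volume :=
        memLp_of_compact (continuous_dir hφ1 v) (hasCompactSupport_dir hφc v) 2 volume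
      have e0 := integral_dir_mul hw hφ1 hwc et
      rw [dt_eq_dir, ← abs_neg, ← e0]
      have hψ (j : Fin d) : ContDiff ℝ 1 fun z => f j z * dir (ex i) ζ z :=
        (h.f_smooth j).mul (hdζ1 _)
      have hψc (j : Fin d) : HasCompactSupport fun z => f j z * dir (ex i) ζ z := (hdc _).mul_left
      -- With ∂ₜus = ∇ · f, the product (∇ · f) ∂ᵢζ is written as a divergence minus f · ∇∂ᵢζ. The
      -- divergence then falls on φ, which is where the gradient bound on φ is needed.
      have e1 (z : TS d) : dir et w z * φ z = us z * dir et (dir (ex i) ζ) z * φ z +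
          ∑ j, (dir (ex j) (fun z => f j z * dir (ex i) ζ z) z * φ z
            - f j z * dir (ex j) (dir (ex i) ζ) z * φ z) := by
        rw [hdw]
        have e2 (j : Fin d) : dir (ex j) (fun z => f j z * dir (ex i) ζ z) z =
            f j z * dir (ex j) (dir (ex i) ζ) z + dir (ex j) (f j) z * dir (ex i) ζ z :=
          dir_mul ((h.f_smooth j).differentiable one_ne_zero z)
            ((hdζ1 _).differentiable one_ne_zero z) _
        simp only [e2, add_mul, add_sub_cancel_left]
        rw [← Finset.sum_mul, ← Finset.sum_mul]
        by_cases hz : z ∈ A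
        · rw [h.dt_us z (hAO hz)]
        · rw [hz1 _ z hz]; simp
      simp only [e1]
      have m1 : MemLp (fun z => us z * dir et (dir (ex i) ζ) z) 2 volume :=
        memLp_of_compact (hus.continuous.mul (continuous_dir (hdζ1 _) _))
          (hasCompactSupport_dir (hdc _) _).mul_left 2 volume
      have m2 (j : Fin d) : MemLp (fun z => f j z * dir (ex j) (dir (ex i) ζ) z) 2 volume :=
        memLp_of_compact ((h.f_smooth j).continuous.mul (continuous_dir (hdζ1 _) _))
          (hasCompactSupport_dir (hdc _) _).mul_left 2 volume
      have m3 (j : Fin d) : MemLp (fun z => f j z * dir (ex i) ζ z) 2 volume :=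
        memLp_of_compact (hψ j).continuous (hψc j) 2 volume
      have m4 (j : Fin d) : MemLp (dir (ex j) fun z => f j z * dir (ex i) ζ z) 2 volume :=
        memLp_of_compact (continuous_dir (hψ j) _) (hasCompactSupport_dir (hψc j) _) 2 volume
      have b1 : |∫ z, us z * dir et (dir (ex i) ζ) z * φ z| ≤ L * X * B :=
        abs_integral_mul_le m1 mφ hLX.le hB.le (integral_mul_sq_le hus.continuous hAZ
          (fun z => hL2 z _ _ net (nex i)) (fun z => hz2 _ _ z) husX) hφB
      have b2 (j : Fin d) : |∫ z, f j z * dir (ex j) (dir (ex i) ζ) z * φ z| ≤ L * X * B :=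
        abs_integral_mul_le (m2 j) mφ hLX.le hB.le
          (integral_mul_sq_le (h.f_smooth j).continuous hAZ
          (fun z => hL2 z _ _ (nex j) (nex i)) (fun z => hz2 _ _ z) (hfX j)) hφB
      have b3 (j : Fin d) : |∫ z, dir (ex j) (fun z => f j z * dir (ex i) ζ z) z * φ z| ≤
          L * X * B := by
        rw [integral_dir_mul (hψ j) hφ1 (hψc j), abs_neg]
        exact abs_integral_mul_le (m3 j) (mdφ _) hLX.le hB.le
          (integral_mul_sq_le (h.f_smooth j).continuous hAZ
          (fun z => hL1 z _ (nex i)) (fun z => hz1 _ z) (hfX j)) (hφB' j)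
      have n2 (j : Fin d) : Integrable fun z => f j z * dir (ex j) (dir (ex i) ζ) z * φ z :=
        (m2 j).integrable_mul mφ
      have n4 (j : Fin d) : Integrable fun z =>
          dir (ex j) (fun z => f j z * dir (ex i) ζ z) z * φ z := (m4 j).integrable_mul mφ
      have n1 : Integrable fun z => us z * dir et (dir (ex i) ζ) z * φ z := m1.integrable_mul mφ
      have n5 (j : Fin d) : Integrable fun z =>
          dir (ex j) (fun z => f j z * dir (ex i) ζ z) z * φ z
            - f j z * dir (ex j) (dir (ex i) ζ) z * φ z := (n4 j).sub (n2 j)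
      rw [integral_add n1 (integrable_finsetSum _ fun j _ => n5 j),
        integral_finsetSum _ fun j _ => n5 j]
      refine (abs_add_le _ _).trans ?_
      have b4 : |∑ j, ∫ z, (dir (ex j) (fun z => f j z * dir (ex i) ζ z) z * φ z
            - f j z * dir (ex j) (dir (ex i) ζ) z * φ z)| ≤ ∑ j : Fin d, 2 * (L * X * B) := by
        refine (Finset.abs_sum_le_sum_abs _ _).trans (Finset.sum_le_sum fun j _ => ?_)
        rw [integral_sub (n4 j) (n2 j)]
        refine (abs_sub _ _).trans ?_
        linarith [b2 j, b3 j]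
      simp only [Finset.sum_const, Finset.card_univ, Fintype.card_fin, nsmul_eq_mul] at b4
      have : 0 ≤ d * (L * X * B) := by positivity
      have : 0 ≤ L * X * B := by positivity
      nlinarith
  have s2 : ∑ i : Fin d, (-(U * (L * X))) ≤ ∑ i, ∫ z, u z * (f i z * dir (ex i) ζ z) :=
    Finset.sum_le_sum fun i _ => t2 i
  have s3 : ∑ i : Fin d, (-(N * (4 * (d + 1) * L * X))) ≤
      ∑ i, ∫ z, g i z * (us z * dir (ex i) ζ z) :=
    Finset.sum_le_sum fun i _ => (abs_le.1 (t3 i)).1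
  simp only [Finset.sum_const, Finset.card_univ, Fintype.card_fin, nsmul_eq_mul] at s2 s3
  have hd0 : (0 : ℝ) ≤ d := Nat.cast_nonneg d
  have k1 : 0 ≤ U * (L * X) := by positivity
  have k2 : 0 ≤ N * (L * X) := by positivity
  calc _ ≤ U * (L * X) + d * (U * (L * X)) + d * (N * (4 * (d + 1) * L * X)) := by linarith
    _ ≤ 4 * (d + 1) ^ 2 * L * X * (U + N) := by
      have : 4 * (d + 1) ^ 2 * L * X * (U + N) -
        (U * (L * X) + d * (U * (L * X)) + d * (N * (4 * (d + 1) * L * X))) =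
        (4 * d ^ 2 + 7 * d + 3) * (U * (L * X)) + (4 * d + 4) * (N * (L * X)) := by ring
      have : 0 ≤ (4 * (d : ℝ) ^ 2 + 7 * d + 3) * (U * (L * X)) + (4 * d + 4) * (N * (L * X)) := by
        positivity
      linarith

/-- The localized energy of a smooth solution pair is controlled by a small fraction of the energy
on a larger set and the weak norms of the pair. -/
theorem exists_energy_step {V₀ V : Set (TS d)} {h : TS d → ℝ} (hg : IsGauge V₀ V h) {M : ℝ}
    (hM : 0 < M) :
    ∃ B c : ℝ, 0 < B ∧ 0 < c ∧ c ≤ 1 ∧ ∀ r R : ℝ, r < R → R ≤ r + 1 → R ≤ 2 → ∀ ζ,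
      IsCutoff h r ((r + R) / 2) M ζ → ∀ u us p g q f, SmoothSol {z | h z < 2} u us p g q f →
      ∀ e δ N : ℝ, 0 < e → 0 < δ → δ ≤ c * (R - r) → 0 ≤ N →
      ∫ z in {z | h z < R}, dens p g z ≤ e ^ 2 → ∫ z in {z | h z < R}, dens q f z ≤ e ^ 2 →
      (∀ i, WeakBound V N (p i)) → (∀ i, WeakBound V N (g i)) →
      ∫ z, ζ z * ∑ i, (p i z * f i z + q i z * g i z) ≤
        B * (R - r)⁻¹ ^ (d + 7) * e * (δ * e + δ⁻¹ ^ (d + 5) * N) := by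
  obtain ⟨Z, hZ⟩ := hg.compact.isBounded.subset_closedBall (0 : TS d)
  have hZ' : {z | h z ≤ 3} ⊆ Metric.closedBall 0 |Z| :=
    hZ.trans (Metric.closedBall_subset_closedBall (le_abs_self Z))
  obtain ⟨c0, hc0, hc01, hmar⟩ := hg.exists_margin
  obtain ⟨C, hC, hosc⟩ := exists_weak_osc_bound d (Z := |Z|)
  -- The cutoff lives on half of the gap, whence 4M and the bound c0/2 for the admissible scale. The
  -- other factors are the constants of X and U + N below. In the power of (R - r)⁻¹, d + 5 comes
  -- from `us` and 2 from the second derivatives of the cutoff.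
  refine ⟨4 * (d + 1) ^ 2 * (4 * M) * ((2 * C + 1) * (2 * c0⁻¹) ^ (d + 5)) * (C + 1), c0 / 2,
    by positivity, by positivity, by linarith, ?_⟩
  intro r R hrR hR1 hR2 ζ hζ u us p g q f hs e δ N he hδ hδτ hN hE1 hE2 hpN hgN
  set τ := R - r with hτ
  have hτ0 : 0 < τ := sub_pos.2 hrR
  have hτ1 : τ ≤ 1 := by linarith
  set Q : Set (TS d) := {z | h z < R}
  set A : Set (TS d) := {z | h z ≤ (r + R) / 2}
  have hQm : MeasurableSet Q := (isOpen_lt hg.continuous continuous_const).measurableSet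
  have hAm : MeasurableSet A := (isClosed_le hg.continuous continuous_const).measurableSet
  have hQ3 : Q ⊆ {z | h z ≤ 3} := fun z hz => by
    have : h z < R := hz
    change h z ≤ 3; linarith
  have hAQ : A ⊆ Q := fun z hz => by
    have : h z ≤ (r + R) / 2 := hz
    change h z < R; linarith
  have hQZ := hQ3.trans hZ'
  have hQV := hQ3.trans hg.outer
  have hQO : Q ⊆ {z | h z < 2} := fun z hz => by
    have : h z < R := hz
    change h z < 2; linarith
  have hstar : ∀ z ∈ A, ∀ s ∈ Icc (0 : ℝ) 1, s • z ∈ A :=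
    fun z hz s hs => (hg.star z s hs).trans hz
  -- The other half of the gap, between the levels (r + R)/2 and R, is left for the translations in
  -- the mollification.
  have hmove : ∀ δ : ℝ, δ ≤ c0 / 2 * τ → ∀ z ∈ A, ∀ σ ∈ Icc 0 δ,
      ∀ w ∈ Metric.closedBall 0 1, z - scl σ w ∈ Q := by
    intro δ hδ z hz σ hσ w hw
    have hz' : h z ≤ (r + R) / 2 := hz
    have h1 := hmar z (by linarith) (-scl σ w) (τ / 2) (by positivity) (by linarith) (by
      rw [norm_neg]
      refine (norm_scl_le hσ.1 hσ.2 ?_ hw).trans (hδ.trans (by linarith))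
      nlinarith)
    rw [← sub_eq_add_neg] at h1
    change h (z - scl σ w) < R
    linarith
  have hδ1 : δ ≤ 1 := by nlinarith
  -- the oscillation of `u`
  obtain ⟨a, ha⟩ := hosc u p g Q A δ N e hs.u_smooth hs.g_smooth hs.p_cont
    (fun z hz => hs.grad_u z (hQO hz)) (fun z hz => hs.dt_u z (hQO hz)) hδ hδ1 hN he.le hQm hAm hQZ
    (hAQ.trans hQZ) hstar (hmove δ hδτ) (fun i => (hpN i).mono_set hQV)
    (fun i => (hgN i).mono_set hQV) hE1
  -- the oscillation of `us`
  set δ' := c0 / 2 * τ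
  have hδ'0 : 0 < δ' := by positivity
  have hδ'1 : δ' ≤ 1 := by simp only [δ']; nlinarith
  have hcomp (i : Fin d) : ∫ z in Q, q i z ^ 2 ≤ e ^ 2 ∧ ∫ z in Q, f i z ^ 2 ≤ e ^ 2 := by
    have hdi : IntegrableOn (dens q f) Q :=
      ((continuous_dens hs.q_cont fun i => (hs.f_smooth i).continuous).continuousOn.integrableOn_compact
        (isCompact_closedBall 0 |Z|)).mono_set hQZ
    have hterm (z : TS d) : q i z ^ 2 + f i z ^ 2 ≤ dens q f z :=
      Finset.single_le_sum (f := fun i => q i z ^ 2 + f i z ^ 2) (fun i _ => by positivity)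
        (Finset.mem_univ i)
    constructor
    · refine le_trans (integral_mono_of_nonneg (ae_of_all _ fun z => sq_nonneg _) hdi
        (ae_of_all _ fun z => ?_)) hE2
      exact le_trans (by nlinarith [sq_nonneg (f i z)]) (hterm z)
    · refine le_trans (integral_mono_of_nonneg (ae_of_all _ fun z => sq_nonneg _) hdi
        (ae_of_all _ fun z => ?_)) hE2
      exact le_trans (by nlinarith [sq_nonneg (q i z)]) (hterm z)
  -- Only a bound of order e is needed here, not a small one. So the scale is the largest admissible
  -- one, and the weak norms of q and f are bounded by their L² norms.
  obtain ⟨b, hb⟩ := hosc us q f Q A δ' e e hs.us_smooth hs.f_smooth hs.q_cont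
    (fun z hz => hs.grad_us z (hQO hz)) (fun z hz => hs.dt_us z (hQO hz)) hδ'0 hδ'1 he.le he.le
    hQm hAm hQZ
    (hAQ.trans hQZ) hstar (hmove δ' le_rfl)
    (fun i => weakBound_of_integral_le he.le (hs.q_cont i) hQZ (hcomp i).1)
    (fun i => weakBound_of_integral_le he.le (hs.f_smooth i).continuous hQZ (hcomp i).2) hE2
  set U := C * (δ * e + δ⁻¹ ^ (d + 5) * N)
  set X := (2 * C + 1) * δ'⁻¹ ^ (d + 5) * e
  have hδ'i : 1 ≤ δ'⁻¹ ^ (d + 5) := one_le_pow₀ ((one_le_inv₀ hδ'0).2 hδ'1)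
  have hδi : 1 ≤ δ⁻¹ ^ (d + 5) := one_le_pow₀ ((one_le_inv₀ hδ).2 hδ1)
  have heX : e ≤ X := by
    simp only [X]
    rw [mul_assoc]
    have h1 : e ≤ δ'⁻¹ ^ (d + 5) * e := le_mul_of_one_le_left he.le hδ'i
    nlinarith [mul_nonneg hC.le (he.le.trans h1)]
  have hXU : C * (δ' * e + δ'⁻¹ ^ (d + 5) * e) ≤ X := by
    simp only [X]
    have h1 : δ' * e ≤ δ'⁻¹ ^ (d + 5) * e := by gcongr; linarith
    nlinarith [mul_nonneg hC.le he.le, mul_le_mul_of_nonneg_left h1 hC.le,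
      mul_pos (lt_of_lt_of_le one_pos hδ'i) he]
  have hAint {a : TS d → ℝ} (ha : Continuous a) (haQ : ∫ z in Q, a z ^ 2 ≤ e ^ 2) :
      ∫ z in A, a z ^ 2 ≤ X ^ 2 := by
    refine le_trans ?_ (haQ.trans (pow_le_pow_left₀ he.le heX 2))
    refine setIntegral_mono_set ?_ (ae_of_all _ fun z => sq_nonneg _) hAQ.eventuallyLE
    exact (memLp_restrict_of_continuous ha hQZ).integrable_sq
  have hL : (r + R) / 2 - r = τ / 2 := by rw [hτ]; ring
  have hMτ : M / (τ / 2) ≤ M / (τ / 2) ^ 2 := by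
    gcongr
    nlinarith
  have hdir := hζ.dir_le
  have hdirdir := hζ.dir_dir_le
  rw [hL] at hdir hdirdir
  -- The equations are unchanged when constants are subtracted from both potentials, so the
  -- oscillations take the place of the functions.
  have hen := (hs.sub_const a b).energy_le (A := A) (L := M / (τ / 2) ^ 2) (U := U) (X := X) (N := N)
    (V := V) (Z := |Z|) hζ.contDiff hζ.supp (hAQ.trans hQO) (hAQ.trans hQV) (hAQ.trans hQZ)
    (by positivity) (fun z v hv => (hdir z v hv).trans hMτ) hdirdir (by positivity) (by positivity)
    hN ha (hb.trans (pow_le_pow_left₀ (by positivity) hXU 2))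
    (fun i => hAint (hs.q_cont i) (hcomp i).1)
    (fun i => hAint (hs.f_smooth i).continuous (hcomp i).2) hgN
  refine hen.trans ?_
  have hUN : U + N ≤ (C + 1) * (δ * e + δ⁻¹ ^ (d + 5) * N) := by
    simp only [U]
    have h1 : N ≤ δ⁻¹ ^ (d + 5) * N := le_mul_of_one_le_left hN hδi
    have h2 : 0 ≤ δ * e := by positivity
    nlinarith
  have hδ'e : δ'⁻¹ = 2 * c0⁻¹ * τ⁻¹ := by
    simp only [δ']; field_simp
  calc 4 * (d + 1) ^ 2 * (M / (τ / 2) ^ 2) * X * (U + N)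
      ≤ 4 * (d + 1) ^ 2 * (M / (τ / 2) ^ 2) * X *
          ((C + 1) * (δ * e + δ⁻¹ ^ (d + 5) * N)) := by gcongr
    _ = _ := by
      simp only [X]
      rw [hδ'e, mul_pow _ τ⁻¹, show d + 7 = (d + 5) + 2 by ring, pow_add τ⁻¹ (d + 5) 2]
      field_simp
      ring

end Energy

/-! ### Weak solution pairs and their regularization -/

/-- Fields in `L²` which in `V` satisfy, in the sense of distributions, `∇u = p`, `∂ₜu = ∇ · g`,
`∂ᵢqⱼ = ∂ⱼqᵢ` and `∂ₜq = ∇(∇ · f)`. -/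
structure WeakSol (V : Set (TS d)) (u : TS d → ℝ) (p g q f : Fin d → TS d → ℝ) : Prop where
  u_memLp : MemLp u 2
  p_memLp : ∀ i, MemLp (p i) 2
  g_memLp : ∀ i, MemLp (g i) 2
  q_memLp : ∀ i, MemLp (q i) 2
  f_memLp : ∀ i, MemLp (f i) 2
  p_supp : ∀ i, HasCompactSupport (p i)
  g_supp : ∀ i, HasCompactSupport (g i)
  q_supp : ∀ i, HasCompactSupport (q i)
  f_supp : ∀ i, HasCompactSupport (f i)
  grad_u : ∀ φ, IsTest V φ → ∀ i, ∫ z, u z * dir (ex i) φ z = -∫ z, p i z * φ z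
  dt_u : ∀ φ, IsTest V φ → ∑ i, ∫ z, g i z * dir (ex i) φ z = ∫ z, u z * dir et φ z
  curl_q : ∀ φ, IsTest V φ → ∀ i j, ∫ z, q i z * dir (ex j) φ z = ∫ z, q j z * dir (ex i) φ z
  dt_q : ∀ φ, IsTest V φ → ∀ i,
    ∑ j, ∫ z, f j z * dir (ex j) (dir (ex i) φ) z = -∫ z, q i z * dir et φ z

lemma IsTest.comp_const_sub {V : Set (TS d)} {ρ : TS d → ℝ} {η : ℝ} (hρ : ContDiff ℝ ∞ ρ)
    (hs : tsupport ρ ⊆ Metric.closedBall 0 η) {z : TS d} (hz : Metric.closedBall z η ⊆ V) :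
    IsTest V fun y => ρ (z - y) := by
  have hsub : tsupport (fun y => ρ (z - y)) ⊆ Metric.closedBall z η := by
    intro y hy
    have h1 := hs (tsupport_comp_subset_preimage ρ (f := fun y => z - y) (by fun_prop) hy)
    rw [mem_closedBall_zero_iff, ← dist_eq_norm] at h1
    rwa [Metric.mem_closedBall, dist_comm]
  refine ⟨hρ.comp (contDiff_const.sub contDiff_id), ?_, hsub.trans hz⟩
  exact HasCompactSupport.of_support_subset_isCompact (isCompact_closedBall z η)
    ((subset_tsupport _).trans hsub)

/-! ### Equations satisfied by the mollified fields -/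

section Regularize

variable {V : Set (TS d)} {u : TS d → ℝ} {p g q f : Fin d → TS d → ℝ} {ρ : TS d → ℝ} {η : ℝ}
  {z : TS d}

lemma integral_mul_dir_const_sub (hρ : ContDiff ℝ ∞ ρ) (hc : HasCompactSupport ρ)
    {F : TS d → ℝ} (hF : LocallyIntegrable F) (v z : TS d) :
    ∫ y, F y * dir v (fun y => ρ (z - y)) y = -dir v (cv ρ F) z := by
  rw [dir_cv (contDiff_one_of_infty hρ) hc hF]
  unfold cv
  rw [← integral_neg]
  congr 1
  ext y
  rw [dir_comp_const_sub z v y (hρ.differentiable (by simp) _)]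
  ring

lemma integral_mul_dir_dir_const_sub (hρ : ContDiff ℝ ∞ ρ) (hc : HasCompactSupport ρ)
    {F : TS d → ℝ} (hF : LocallyIntegrable F) (v w z : TS d) :
    ∫ y, F y * dir v (dir w (fun y => ρ (z - y))) y = dir v (dir w (cv ρ F)) z := by
  have hw := contDiff_dir_infty hρ w
  rw [dir_cv (contDiff_one_of_infty hρ) hc hF,
    dir_cv (contDiff_one_of_infty hw) (hasCompactSupport_dir hc w) hF]
  unfold cv
  congr 1
  ext y
  have e1 : dir w (fun y => ρ (z - y)) = fun y => -dir w ρ (z - y) := by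
    ext x
    exact dir_comp_const_sub z w x (hρ.differentiable (by simp) _)
  have e2 : dir v (fun y => -dir w ρ (z - y)) y = -dir v (fun y => dir w ρ (z - y)) y := by
    unfold dir
    rw [fderiv_fun_neg]; rfl
  rw [e1, e2, dir_comp_const_sub z v y (hw.differentiable (by simp) _), neg_neg]

variable (h : WeakSol V u p g q f) (hρ : ContDiff ℝ ∞ ρ)
  (hs : tsupport ρ ⊆ Metric.closedBall 0 η)

lemma _root_.MeasureTheory.MemLp.locInt {F : TS d → ℝ} (hF : MemLp F 2) : LocallyIntegrable F :=
  hF.locallyIntegrable (by norm_num)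

include h hρ hs

/-- The reflected kernel y ↦ ρ(z - y) is an admissible test function when the η-ball around z lies
in V. Each weak equation, tested with it, becomes a pointwise equation for the convolutions. -/
lemma WeakSol.dir_ex_cv (hc : HasCompactSupport ρ) (hz : Metric.closedBall z η ⊆ V) (i : Fin d) :
    dir (ex i) (cv ρ u) z = cv ρ (p i) z := by
  have e := h.grad_u _ (IsTest.comp_const_sub hρ hs hz) i
  rw [integral_mul_dir_const_sub hρ hc h.u_memLp.locInt] at e
  exact neg_injective e

lemma WeakSol.dir_et_cv (hc : HasCompactSupport ρ) (hz : Metric.closedBall z η ⊆ V) :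
    dir et (cv ρ u) z = ∑ i, dir (ex i) (cv ρ (g i)) z := by
  have e := h.dt_u _ (IsTest.comp_const_sub hρ hs hz)
  simp only [integral_mul_dir_const_sub hρ hc h.u_memLp.locInt,
    integral_mul_dir_const_sub hρ hc (h.g_memLp _).locInt, Finset.sum_neg_distrib] at e
  exact (neg_injective e).symm

lemma WeakSol.dir_ex_cv_comm (hc : HasCompactSupport ρ) (hz : Metric.closedBall z η ⊆ V)
    (i j : Fin d) : dir (ex j) (cv ρ (q i)) z = dir (ex i) (cv ρ (q j)) z := by
  have e := h.curl_q _ (IsTest.comp_const_sub hρ hs hz) i j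
  simp only [integral_mul_dir_const_sub hρ hc (h.q_memLp _).locInt] at e
  exact neg_injective e

lemma WeakSol.dir_et_cv_q (hc : HasCompactSupport ρ) (hz : Metric.closedBall z η ⊆ V)
    (i : Fin d) :
    dir et (cv ρ (q i)) z = dir (ex i) (fun z => ∑ j, dir (ex j) (cv ρ (f j)) z) z := by
  have e := h.dt_q _ (IsTest.comp_const_sub hρ hs hz) i
  simp only [integral_mul_dir_const_sub hρ hc (h.q_memLp _).locInt,
    integral_mul_dir_dir_const_sub hρ hc (h.f_memLp _).locInt, neg_neg] at e
  rw [← e]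
  have hsm (j : Fin d) := contDiff_cv hρ hc (h.f_memLp j).locInt
  have e2 : dir (ex i) (fun z => ∑ j, dir (ex j) (cv ρ (f j)) z) z =
      ∑ j, dir (ex i) (dir (ex j) (cv ρ (f j))) z := by
    unfold dir
    rw [fderiv_fun_sum fun j _ => ?_]
    · simp
    · exact (contDiff_dir_infty (hsm j) (ex j)).differentiable (by simp) z
  rw [e2]
  exact Finset.sum_congr rfl fun j _ => by rw [dir_comm (contDiff_two_of_infty (hsm j))]

end Regularize

/-- A closed one-form with time component `α` and space components `q` is exact on a convex set. -/
lemma exists_potential {O : Set (TS d)} (hO : IsOpen O) (hconv : Convex ℝ O) {α : TS d → ℝ}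
    {q : Fin d → TS d → ℝ} (hα : ContDiff ℝ 1 α) (hq : ∀ i, ContDiff ℝ 1 (q i))
    (hcurl : ∀ z ∈ O, ∀ i j, dir (ex j) (q i) z = dir (ex i) (q j) z)
    (hdt : ∀ z ∈ O, ∀ i, dir et (q i) z = dir (ex i) α z) :
    ∃ w : TS d → ℝ, ContDiffOn ℝ 1 w O ∧ (∀ z ∈ O, dir et w z = α z) ∧
      ∀ z ∈ O, ∀ i, dir (ex i) w z = q i z := by
  set T : TS d →L[ℝ] ℝ := ContinuousLinearMap.fst ℝ ℝ (Space d)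
  set X : Fin d → TS d →L[ℝ] ℝ := fun i =>
    (EuclideanSpace.proj i : Space d →L[ℝ] ℝ).comp (ContinuousLinearMap.snd ℝ ℝ (Space d))
  set θ : TS d → TS d →L[ℝ] ℝ := fun z => α z • T + ∑ i, q i z • X i
  have hθ : ContDiff ℝ 1 θ := by
    refine ContDiff.add (hα.smul contDiff_const) (ContDiff.sum fun i _ => ?_)
    exact (hq i).smul contDiff_const
  have hθv (z v : TS d) : θ z v = α z * v.1 + ∑ i, q i z * v.2 i := by
    simp [θ, T, X]
  have hder (a x y : TS d) : fderiv ℝ θ a x y = dir x α a * y.1 + ∑ i, dir x (q i) a * y.2 i := by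
    have h1 : HasFDerivAt θ ((fderiv ℝ α a).smulRight T + ∑ i, (fderiv ℝ (q i) a).smulRight (X i))
        a := by
      refine HasFDerivAt.add ?_ (HasFDerivAt.fun_sum fun i _ => ?_)
      · exact (hα.differentiable one_ne_zero a).hasFDerivAt.smul_const T
      · exact ((hq i).differentiable one_ne_zero a).hasFDerivAt.smul_const (X i)
    rw [h1.fderiv]
    simp [dir, T, X]
  -- The derivative of the form is symmetric: the space-space entries agree by `hcurl`, the
  -- time-space entries by `hdt`.
  obtain ⟨w, hw⟩ := hconv.exists_forall_hasFDerivAt_of_fderiv_symmetric hO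
    (hθ.differentiable one_ne_zero).differentiableOn (by
      intro a ha x y
      have hx (F : TS d → ℝ) (v : TS d) : dir v F a = v.1 * dir et F a + ∑ i, v.2 i * dir (ex i) F a :=
        fderiv_apply_eq F a v
      rw [hder, hder]
      simp only [hx _ x, hx _ y, hdt a ha, add_mul, Finset.sum_add_distrib, Finset.sum_mul]
      have e1 : ∑ i, ∑ j, x.2 j * dir (ex j) (q i) a * y.2 i =
          ∑ i, ∑ j, y.2 j * dir (ex j) (q i) a * x.2 i := by
        rw [Finset.sum_comm]
        refine Finset.sum_congr rfl fun i _ => Finset.sum_congr rfl fun j _ => ?_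
        rw [hcurl a ha]; ring
      rw [e1]
      have e2 : ∑ i, x.2 i * dir (ex i) α a * y.1 = ∑ i, y.1 * dir (ex i) α a * x.2 i :=
        Finset.sum_congr rfl fun i _ => by ring
      have e3 : ∑ i, x.1 * dir (ex i) α a * y.2 i = ∑ i, y.2 i * dir (ex i) α a * x.1 :=
        Finset.sum_congr rfl fun i _ => by ring
      rw [e2, e3]
      ring)
  refine ⟨w, ?_, ?_, ?_⟩
  · refine (contDiffOn_succ_iff_fderiv_of_isOpen (n := 0) hO).2 ⟨?_, by simp, ?_⟩
    · exact fun z hz => (hw z hz).differentiableAt.differentiableWithinAt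
    · exact contDiffOn_zero.2 (hθ.continuous.continuousOn.congr fun z hz => (hw z hz).fderiv)
  · intro z hz
    unfold dir
    rw [(hw z hz).fderiv, hθv]
    simp [et]
  · intro z hz i
    unfold dir
    rw [(hw z hz).fderiv, hθv]
    simp [ex]

/-- The mollified fields satisfy the equations pointwise on the convex set {h < 3}, where the closed
form has a potential. Multiplying the potential by a cutoff that is 1 on {h ≤ 2} makes it C¹ on the
whole space and leaves it unchanged where the equations are used. -/
lemma WeakSol.exists_smoothSol {V₀ V : Set (TS d)} {h : TS d → ℝ} (hg : IsGauge V₀ V h)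
    {u : TS d → ℝ} {p g q f : Fin d → TS d → ℝ} (hw : WeakSol V u p g q f) {ρ : TS d → ℝ} {η : ℝ}
    (hρ : ContDiff ℝ ∞ ρ) (hs : tsupport ρ ⊆ Metric.closedBall 0 η)
    (hη : ∀ z, h z ≤ 3 → Metric.closedBall z η ⊆ V) :
    ∃ us, SmoothSol {z | h z < 2} (cv ρ u) us (fun i => cv ρ (p i)) (fun i => cv ρ (g i))
      (fun i => cv ρ (q i)) (fun i => cv ρ (f i)) := by
  have hc : HasCompactSupport ρ := HasCompactSupport.of_support_subset_isCompact
    (isCompact_closedBall 0 η) ((subset_tsupport ρ).trans hs)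
  have sm {F : TS d → ℝ} (hF : MemLp F 2) : ContDiff ℝ ∞ (cv ρ F) := contDiff_cv hρ hc hF.locInt
  have sm1 {F : TS d → ℝ} (hF : MemLp F 2) : ContDiff ℝ 1 (cv ρ F) :=
    contDiff_one_of_infty (sm hF)
  set O : Set (TS d) := {z | h z < 3}
  have hO : IsOpen O := isOpen_lt hg.continuous continuous_const
  have hOV (z : TS d) (hz : z ∈ O) : Metric.closedBall z η ⊆ V := hη z (le_of_lt hz)
  obtain ⟨w, hwc, hwt, hwx⟩ := exists_potential hO hg.convex
    (α := fun z => ∑ j, dir (ex j) (cv ρ (f j)) z)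
    (ContDiff.sum fun j _ => contDiff_one_of_infty (contDiff_dir_infty (sm (hw.f_memLp j)) _))
    (fun i => sm1 (hw.q_memLp i))
    (fun z hz i j => hw.dir_ex_cv_comm hρ hs hc (hOV z hz) i j)
    (fun z hz i => hw.dir_et_cv_q hρ hs hc (hOV z hz) i)
  obtain ⟨M, hM, hcut⟩ := hg.exists_cutoff
  obtain ⟨χ, hχ⟩ := hcut 2 (5 / 2) (by norm_num) (by norm_num) (by norm_num)
  have hcd : ContDiff ℝ 1 fun z => χ z * w z := by
    refine contDiff_iff_contDiffAt.2 fun z => ?_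
    by_cases hz : z ∈ tsupport fun z => χ z * w z
    swap
    · exact contDiffAt_const.congr_of_eventuallyEq (notMem_tsupport_iff_eventuallyEq.1 hz)
    have hz1 : z ∈ tsupport χ := tsupport_mul_subset_left hz
    have hz2 : h z ≤ 5 / 2 := hχ.supp hz1
    have hzO : z ∈ O := by change h z < 3; linarith
    exact (contDiff_one_of_infty hχ.contDiff).contDiffAt.mul (hwc.contDiffAt (hO.mem_nhds hzO))
  have hdir (z : TS d) (hz : h z < 2) (v : TS d) :
      dir v (fun z => χ z * w z) z = dir v w z := by
    have : (fun z => χ z * w z) =ᶠ[𝓝 z] w := by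
      filter_upwards [(isOpen_lt hg.continuous continuous_const).mem_nhds hz] with y hy
      rw [hχ.eq_one y (le_of_lt hy), one_mul]
    unfold dir
    rw [this.fderiv_eq]
  have hin (z : TS d) (hz : h z < 2) : z ∈ O := by change h z < 3; linarith
  exact ⟨fun z => χ z * w z,
    { u_smooth := sm1 hw.u_memLp
      us_smooth := hcd
      p_cont := fun i => (sm1 (hw.p_memLp i)).continuous
      q_cont := fun i => (sm1 (hw.q_memLp i)).continuous
      g_smooth := fun i => sm1 (hw.g_memLp i)
      f_smooth := fun i => sm1 (hw.f_memLp i)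
      grad_u := fun z hz i => hw.dir_ex_cv hρ hs hc (hOV z (hin z hz)) i
      dt_u := fun z hz => hw.dir_et_cv hρ hs hc (hOV z (hin z hz))
      grad_us := fun z hz i => (hdir z hz _).trans (hwx z (hin z hz) i)
      dt_us := fun z hz => (hdir z hz _).trans (hwt z (hin z hz)) }⟩

/-! ### Passage to the limit -/

/-- Strong L² convergence of both factors: expand the difference of the products into three terms
and apply Cauchy-Schwarz to each. -/
lemma tendsto_integral_mul {α : Type*} [MeasurableSpace α] {μ : Measure α} {F G : α → ℝ}
    {Fk Gk : ℕ → α → ℝ} (hF : MemLp F 2 μ) (hG : MemLp G 2 μ) (hFk : ∀ k, MemLp (Fk k) 2 μ)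
    (hGk : ∀ k, MemLp (Gk k) 2 μ)
    (h1 : Tendsto (fun k => ∫ z, (Fk k z - F z) ^ 2 ∂μ) atTop (𝓝 0))
    (h2 : Tendsto (fun k => ∫ z, (Gk k z - G z) ^ 2 ∂μ) atTop (𝓝 0)) :
    Tendsto (fun k => ∫ z, Fk k z * Gk k z ∂μ) atTop (𝓝 (∫ z, F z * G z ∂μ)) := by
  set a : ℕ → ℝ := fun k => √(∫ z, (Fk k z - F z) ^ 2 ∂μ)
  set b : ℕ → ℝ := fun k => √(∫ z, (Gk k z - G z) ^ 2 ∂μ)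
  set A := √(∫ z, F z ^ 2 ∂μ)
  set B := √(∫ z, G z ^ 2 ∂μ)
  have sq {H : α → ℝ} : ∫ z, H z ^ 2 ∂μ ≤ (√(∫ z, H z ^ 2 ∂μ)) ^ 2 :=
    (Real.sq_sqrt (integral_nonneg fun z => sq_nonneg _)).ge
  have ha : Tendsto a atTop (𝓝 0) := by simpa using h1.sqrt
  have hb : Tendsto b atTop (𝓝 0) := by simpa using h2.sqrt
  rw [tendsto_iff_norm_sub_tendsto_zero]
  refine squeeze_zero (fun k => norm_nonneg _) (g := fun k => a k * b k + a k * B + A * b k) ?_ ?_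
  · intro k
    have d1 : MemLp (fun z => Fk k z - F z) 2 μ := (hFk k).sub hF
    have d2 : MemLp (fun z => Gk k z - G z) 2 μ := (hGk k).sub hG
    have e : (∫ z, Fk k z * Gk k z ∂μ) - ∫ z, F z * G z ∂μ =
        ((∫ z, (Fk k z - F z) * (Gk k z - G z) ∂μ) + ∫ z, (Fk k z - F z) * G z ∂μ)
          + ∫ z, F z * (Gk k z - G z) ∂μ := by
      have i1 : Integrable (fun z => (Fk k z - F z) * (Gk k z - G z)) μ := d1.integrable_mul d2
      have i2 : Integrable (fun z => (Fk k z - F z) * G z) μ := d1.integrable_mul hG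
      have i3 : Integrable (fun z => F z * (Gk k z - G z)) μ := hF.integrable_mul d2
      have i4 : Integrable (fun z => Fk k z * Gk k z) μ := (hFk k).integrable_mul (hGk k)
      have i5 : Integrable (fun z => F z * G z) μ := hF.integrable_mul hG
      have i12 : Integrable (fun z => (Fk k z - F z) * (Gk k z - G z) + (Fk k z - F z) * G z) μ :=
        i1.add i2
      rw [← integral_sub i4 i5, ← integral_add i1 i2, ← integral_add i12 i3]
      congr 1; ext z; ring
    rw [e, Real.norm_eq_abs]
    refine (abs_add_le _ _).trans (add_le_add ((abs_add_le _ _).trans (add_le_add ?_ ?_)) ?_)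
    · exact abs_integral_mul_le d1 d2 (Real.sqrt_nonneg _) (Real.sqrt_nonneg _) sq sq
    · exact abs_integral_mul_le d1 hG (Real.sqrt_nonneg _) (Real.sqrt_nonneg _) sq sq
    · exact abs_integral_mul_le hF d2 (Real.sqrt_nonneg _) (Real.sqrt_nonneg _) sq sq
  · have := ((ha.mul hb).add (ha.mul_const B)).add (hb.const_mul A)
    simpa using this

lemma memLp_cv_moll {F : TS d → ℝ} (hF : MemLp F 2) (hc : HasCompactSupport F) (k : ℕ) :
    MemLp (cv (moll k) F) 2 :=
  memLp_of_compact (contDiff_cv (contDiff_moll k) (hasCompactSupport_moll k) hF.locInt).continuous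
    (hasCompactSupport_cv (hasCompactSupport_moll k) hc) 2 volume

lemma tendsto_setIntegral_cv_moll {F : TS d → ℝ} (hF : MemLp F 2) (hc : HasCompactSupport F)
    (Q : Set (TS d)) :
    Tendsto (fun k : ℕ => ∫ z in Q, (cv (moll k) F z - F z) ^ 2) atTop (𝓝 0) := by
  refine squeeze_zero (fun k => integral_nonneg fun z => sq_nonneg _) (fun k => ?_)
    (tendsto_integral_cv_moll hF)
  refine setIntegral_le_integral ?_ (ae_of_all _ fun z => sq_nonneg _)
  exact ((memLp_cv_moll hF hc k).sub hF).integrable_sq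

lemma tendsto_dens_cv_moll {P G : Fin d → TS d → ℝ} (hP : ∀ i, MemLp (P i) 2)
    (hG : ∀ i, MemLp (G i) 2) (hPc : ∀ i, HasCompactSupport (P i))
    (hGc : ∀ i, HasCompactSupport (G i)) (Q : Set (TS d)) :
    Tendsto (fun k : ℕ => ∫ z in Q, dens (fun i => cv (moll k) (P i))
      (fun i => cv (moll k) (G i)) z) atTop (𝓝 (∫ z in Q, dens P G z)) := by
  have e {P G : Fin d → TS d → ℝ} (hP : ∀ i, MemLp (P i) 2) (hG : ∀ i, MemLp (G i) 2) :
      ∫ z in Q, dens P G z = ∑ i, ((∫ z in Q, P i z * P i z) + ∫ z in Q, G i z * G i z) := by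
    have i1 (i : Fin d) : Integrable (fun z => P i z * P i z) (volume.restrict Q) :=
      ((hP i).restrict Q).integrable_mul ((hP i).restrict Q)
    have i2 (i : Fin d) : Integrable (fun z => G i z * G i z) (volume.restrict Q) :=
      ((hG i).restrict Q).integrable_mul ((hG i).restrict Q)
    unfold dens
    simp only [pow_two]
    have i3 (i : Fin d) : Integrable (fun z => P i z * P i z + G i z * G i z)
        (volume.restrict Q) := (i1 i).add (i2 i)
    rw [integral_finsetSum _ fun i _ => i3 i]
    exact Finset.sum_congr rfl fun i _ => integral_add (i1 i) (i2 i)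
  rw [e hP hG]
  simp only [e (fun i => memLp_cv_moll (hP i) (hPc i) _) (fun i => memLp_cv_moll (hG i) (hGc i) _)]
  refine tendsto_finsetSum _ fun i _ => Tendsto.add ?_ ?_
  · exact tendsto_integral_mul ((hP i).restrict Q) ((hP i).restrict Q)
      (fun k => (memLp_cv_moll (hP i) (hPc i) k).restrict Q)
      (fun k => (memLp_cv_moll (hP i) (hPc i) k).restrict Q)
      (tendsto_setIntegral_cv_moll (hP i) (hPc i) Q) (tendsto_setIntegral_cv_moll (hP i) (hPc i) Q)
  · exact tendsto_integral_mul ((hG i).restrict Q) ((hG i).restrict Q)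
      (fun k => (memLp_cv_moll (hG i) (hGc i) k).restrict Q)
      (fun k => (memLp_cv_moll (hG i) (hGc i) k).restrict Q)
      (tendsto_setIntegral_cv_moll (hG i) (hGc i) Q) (tendsto_setIntegral_cv_moll (hG i) (hGc i) Q)

/-- Mollification changes F by little in L², hence by little in the dual norm. No commutation of the
mollifier with the competitors is needed. -/
lemma WeakBound.cv_moll {V : Set (TS d)} {N : ℝ} {F : TS d → ℝ} (h : WeakBound V N F)
    (hF : MemLp F 2) (hc : HasCompactSupport F) (k : ℕ) {N' : ℝ}
    (hN' : N + √(∫ z, (cv (moll k) F z - F z) ^ 2) ≤ N') : WeakBound V N' (cv (moll k) F) := by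
  intro w K hw hwc hws hK h1 h2 h3
  have mw : MemLp w 2 volume := memLp_of_compact hw.continuous hwc 2 volume
  have md : MemLp (fun z => cv (moll k) F z - F z) 2 := (memLp_cv_moll hF hc k).sub hF
  have i1 : Integrable fun z => F z * w z := hF.integrable_mul mw
  have i2 : Integrable fun z => (cv (moll k) F z - F z) * w z := md.integrable_mul mw
  have e : ∫ z, cv (moll k) F z * w z =
      (∫ z, F z * w z) + ∫ z, (cv (moll k) F z - F z) * w z := by
    rw [← integral_add i1 i2]
    congr 1; ext z; ring
  rw [e]
  refine (abs_add_le _ _).trans ?_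
  have b1 := h w K hw hwc hws hK h1 h2 h3
  have b2 := abs_integral_mul_le md mw (Real.sqrt_nonneg _) hK.le
    (Real.sq_sqrt (integral_nonneg fun z => sq_nonneg _)).ge h1
  calc _ ≤ N * K + √(∫ z, (cv (moll k) F z - F z) ^ 2) * K := add_le_add b1 b2
    _ = (N + √(∫ z, (cv (moll k) F z - F z) ^ 2)) * K := by ring
    _ ≤ N' * K := by gcongr

/-! ### The interior estimate at unit scale -/

/-- Absorption of a small multiple of a bounded quantity by iteration over nested radii. -/
lemma le_of_absorb {E : ℝ → ℝ} {M D θ : ℝ} {m : ℕ} (hM : ∀ r, 1 ≤ r → r ≤ 2 → E r ≤ M)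
    (h0 : ∀ r, 0 ≤ E r) (hD : 0 ≤ D) (hθ : θ * 2 ^ (m + 1) ≤ 1)
    (h : ∀ r R, 1 ≤ r → r < R → R ≤ 2 → E r ≤ θ * E R + D * (R - r)⁻¹ ^ m) :
    E 1 ≤ 2 ^ (m + 1) * D := by
  -- Radii increasing from 1 to 2 with dyadic gaps 2^{-(j+1)}.
  set ρ : ℕ → ℝ := fun j => 2 - (1 / 2) ^ j
  have hp (j : ℕ) : (0 : ℝ) < (1 / 2) ^ j := by positivity
  have hp1 (j : ℕ) : ((1 : ℝ) / 2) ^ j ≤ 1 := pow_le_one₀ (by norm_num) (by norm_num)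
  have hρ1 (j : ℕ) : 1 ≤ ρ j := by have := hp1 j; simp only [ρ]; linarith
  have hρ2 (j : ℕ) : ρ j ≤ 2 := by have := hp j; simp only [ρ]; linarith
  have hd (j : ℕ) : ρ (j + 1) - ρ j = (1 / 2) ^ (j + 1) := by simp only [ρ, pow_succ]; ring
  -- The weight 2^{-mj} offsets the growth of the gap term. It turns the absorption condition into a
  -- contraction by 1/2.
  set b : ℕ → ℝ := fun j => E (ρ j) * ((1 / 2) ^ m) ^ j
  have hstep (j : ℕ) : b j ≤ 1 / 2 * b (j + 1) + D * 2 ^ m := by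
    have h1 := h (ρ j) (ρ (j + 1)) (hρ1 j) (by have := hd j; have := hp (j + 1); linarith)
      (hρ2 _)
    rw [hd] at h1
    have e1 : (((1 : ℝ) / 2) ^ (j + 1))⁻¹ ^ m * ((1 / 2) ^ m) ^ j = 2 ^ m := by
      rw [← inv_pow, ← pow_mul, ← pow_mul]
      norm_num
      rw [show (j + 1) * m = m * j + m by ring, pow_add, mul_right_comm, ← mul_pow]
      norm_num
    have e2 : θ * E (ρ (j + 1)) * ((1 / 2) ^ m) ^ j ≤ 1 / 2 * b (j + 1) := by
      have e3 : θ * E (ρ (j + 1)) * ((1 / 2) ^ m) ^ j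
          = (θ * 2 ^ (m + 1)) * (1 / 2 * b (j + 1)) := by
        simp only [b, pow_succ]
        have : ((1 : ℝ) / 2) ^ m * 2 ^ m = 1 := by rw [← mul_pow]; norm_num
        linear_combination (-θ * E (ρ (j + 1)) * ((1 / 2) ^ m) ^ j) * this
      rw [e3]
      exact mul_le_of_le_one_left (by have := h0 (ρ (j + 1)); positivity) hθ
    calc b j ≤ (θ * E (ρ (j + 1)) + D * (((1 : ℝ) / 2) ^ (j + 1))⁻¹ ^ m) * ((1 / 2) ^ m) ^ j := by
          simp only [b]; gcongr
      _ = θ * E (ρ (j + 1)) * ((1 / 2) ^ m) ^ j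
            + D * ((((1 : ℝ) / 2) ^ (j + 1))⁻¹ ^ m * ((1 / 2) ^ m) ^ j) := by ring
      _ ≤ _ := by rw [e1]; linarith
  have hb (j : ℕ) : b j ≤ |M| := by
    have h1 : b j ≤ E (ρ j) :=
      mul_le_of_le_one_right (h0 _) (pow_le_one₀ (by positivity) (hp1 m))
    exact h1.trans ((hM _ (hρ1 j) (hρ2 j)).trans (le_abs_self M))
  -- Iterating k times sums the geometric series of D 2^m to at most 2^{m+1} D; the remainder
  -- vanishes because E is bounded a priori.
  have hind (k : ℕ) : ∀ j, b j ≤ 2 ^ (m + 1) * D + |M| * (1 / 2) ^ k := by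
    induction k with
    | zero =>
      intro j
      have := hb j
      have : 0 ≤ 2 ^ (m + 1) * D := by positivity
      simp only [pow_zero, mul_one]; linarith
    | succ k ih =>
      intro j
      have h1 := hstep j
      have h2 := ih (j + 1)
      rw [pow_succ] at h2 ⊢
      rw [pow_succ]
      linarith
  have hl : Tendsto (fun k : ℕ => 2 ^ (m + 1) * D + |M| * (1 / 2 : ℝ) ^ k) atTop
      (𝓝 (2 ^ (m + 1) * D + |M| * 0)) :=
    ((tendsto_pow_atTop_nhds_zero_of_lt_one (by norm_num) (by norm_num)).const_mul _).const_add _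
  have hf := ge_of_tendsto' hl fun k => hind k 0
  simpa [b, ρ, show (2 : ℝ) - 1 = 1 by norm_num] using hf

lemma integrable_dens {P G : Fin d → TS d → ℝ} (hP : ∀ i, MemLp (P i) 2)
    (hG : ∀ i, MemLp (G i) 2) : Integrable (dens P G) := by
  unfold dens
  exact integrable_finsetSum _ fun i _ => (hP i).integrable_sq.add (hG i).integrable_sq

lemma memLp_cutoff_mul {ζ F : TS d → ℝ} (hζ : Continuous ζ) (h0 : ∀ z, 0 ≤ ζ z)
    (h1 : ∀ z, ζ z ≤ 1) (hF : MemLp F 2) : MemLp (fun z => ζ z * F z) 2 := by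
  refine hF.of_le (hζ.aestronglyMeasurable.mul hF.1) (ae_of_all _ fun z => ?_)
  rw [norm_mul, Real.norm_of_nonneg (h0 z)]
  exact mul_le_of_le_one_left (norm_nonneg _) (h1 z)

lemma tendsto_integral_cutoff {ζ F G : TS d → ℝ} (hζ : Continuous ζ) (h0 : ∀ z, 0 ≤ ζ z)
    (h1 : ∀ z, ζ z ≤ 1) (hF : MemLp F 2) (hG : MemLp G 2) (hFc : HasCompactSupport F)
    (hGc : HasCompactSupport G) :
    Tendsto (fun k => ∫ z, ζ z * cv (moll k) F z * cv (moll k) G z) atTop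
      (𝓝 (∫ z, ζ z * F z * G z)) := by
  refine tendsto_integral_mul (memLp_cutoff_mul hζ h0 h1 hF) hG
    (fun k => memLp_cutoff_mul hζ h0 h1 (memLp_cv_moll hF hFc k)) (memLp_cv_moll hG hGc) ?_
    (tendsto_integral_cv_moll hG)
  refine squeeze_zero (fun k => integral_nonneg fun z => sq_nonneg _) (fun k => ?_)
    (tendsto_integral_cv_moll hF)
  have hd : MemLp (fun z => cv (moll k) F z - F z) 2 := (memLp_cv_moll hF hFc k).sub hF
  refine integral_mono_of_nonneg (ae_of_all _ fun z => sq_nonneg _) hd.integrable_sq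
    (ae_of_all _ fun z => ?_)
  change (ζ z * _ - ζ z * _) ^ 2 ≤ _
  rw [← mul_sub, mul_pow]
  exact mul_le_of_le_one_left (sq_nonneg _) (pow_le_one₀ (h0 z) (h1 z))

lemma integral_cutoff_energy {ζ : TS d → ℝ} (hζ : Continuous ζ) (h0 : ∀ z, 0 ≤ ζ z)
    (h1 : ∀ z, ζ z ≤ 1) {p g q f : Fin d → TS d → ℝ} (hp : ∀ i, MemLp (p i) 2)
    (hg : ∀ i, MemLp (g i) 2) (hq : ∀ i, MemLp (q i) 2) (hf : ∀ i, MemLp (f i) 2) :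
    Integrable (fun z => ζ z * ∑ i, (p i z * f i z + q i z * g i z)) ∧
    ∫ z, ζ z * ∑ i, (p i z * f i z + q i z * g i z) =
      ∑ i, ((∫ z, ζ z * p i z * f i z) + ∫ z, ζ z * q i z * g i z) := by
  have i1 (i : Fin d) : Integrable fun z => ζ z * p i z * f i z :=
    (memLp_cutoff_mul hζ h0 h1 (hp i)).integrable_mul (hf i)
  have i2 (i : Fin d) : Integrable fun z => ζ z * q i z * g i z :=
    (memLp_cutoff_mul hζ h0 h1 (hq i)).integrable_mul (hg i)
  have i3 (i : Fin d) : Integrable fun z => ζ z * p i z * f i z + ζ z * q i z * g i z :=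
    (i1 i).add (i2 i)
  have e : (fun z => ζ z * ∑ i, (p i z * f i z + q i z * g i z)) =
      fun z => ∑ i, (ζ z * p i z * f i z + ζ z * q i z * g i z) := by
    ext z
    rw [Finset.mul_sum]
    exact Finset.sum_congr rfl fun i _ => by ring
  rw [e]
  refine ⟨integrable_finsetSum _ fun i _ => i3 i, ?_⟩
  rw [integral_finsetSum _ fun i _ => i3 i]
  exact Finset.sum_congr rfl fun i _ => integral_add (i1 i) (i2 i)

/-- One step of the interior estimate for weak solutions. -/
lemma exists_weak_energy_step {V₀ V : Set (TS d)} {h : TS d → ℝ} (hg : IsGauge V₀ V h)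
    (hV : IsOpen V) :
    ∃ B c : ℝ, 0 < B ∧ 0 < c ∧ c ≤ 1 ∧ ∀ u p g q f, WeakSol V u p g q f → ∀ cE N : ℝ, 0 ≤ cE →
      0 ≤ N → (∀ z, cE * dens p g z ≤ ∑ i, (p i z * f i z + q i z * g i z)) →
      (∀ i, WeakBound V N (p i)) → (∀ i, WeakBound V N (g i)) →
      ∀ r R e δ : ℝ, 1 ≤ r → r < R → R ≤ 2 → 0 < e → 0 < δ → δ ≤ c * (R - r) →
      ∫ z in {z | h z < R}, dens p g z < e ^ 2 → ∫ z in {z | h z < R}, dens q f z < e ^ 2 →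
      cE * ∫ z in {z | h z < r}, dens p g z ≤
        B * (R - r)⁻¹ ^ (d + 7) * e * (δ * e + δ⁻¹ ^ (d + 5) * N) := by
  obtain ⟨M, hM, hcut⟩ := hg.exists_cutoff
  obtain ⟨B, c, hB, hc, hc1, hstep⟩ := exists_energy_step hg hM
  refine ⟨B, c, hB, hc, hc1, ?_⟩
  intro u p g q f hw cE N hcE hN hell hpN hgN r R e δ hr hrR hR he hδ hδc hE1 hE2
  obtain ⟨ζ, hζ⟩ := hcut r ((r + R) / 2) (by linarith) (by linarith) (by linarith)
  have hζc := hζ.contDiff.continuous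
  obtain ⟨η, hη, hηV⟩ := hg.compact.exists_cthickening_subset_open hV hg.outer
  have hηV' (z : TS d) (hz : h z ≤ 3) {κ : ℝ} (hκ : κ ≤ η) : Metric.closedBall z κ ⊆ V :=
    (Metric.closedBall_subset_closedBall hκ).trans
      ((Metric.closedBall_subset_cthickening (show z ∈ {z | h z ≤ 3} from hz) η).trans hηV)
  -- A weak bound for all mollified components at once: N plus the L² mollification errors, which
  -- tend to 0.
  set Nk : ℕ → ℝ := fun k => N + ∑ i, (√(∫ z, (cv (moll k) (p i) z - p i z) ^ 2) +
    √(∫ z, (cv (moll k) (g i) z - g i z) ^ 2))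
  have hNk : Tendsto Nk atTop (𝓝 N) := by
    have : Tendsto Nk atTop (𝓝 (N + ∑ i : Fin d, (√0 + √0))) := by
      refine Tendsto.const_add _ (tendsto_finsetSum _ fun i _ => Tendsto.add ?_ ?_)
      · exact (tendsto_integral_cv_moll (hw.p_memLp i)).sqrt
      · exact (tendsto_integral_cv_moll (hw.g_memLp i)).sqrt
    simpa using this
  have hi (k : ℕ) (i : Fin d) : √(∫ z, (cv (moll k) (p i) z - p i z) ^ 2) +
      √(∫ z, (cv (moll k) (g i) z - g i z) ^ 2) ≤ Nk k - N := by
    simp only [Nk, add_sub_cancel_left]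
    exact Finset.single_le_sum (f := fun i => √(∫ z, (cv (moll k) (p i) z - p i z) ^ 2) +
      √(∫ z, (cv (moll k) (g i) z - g i z) ^ 2)) (fun i _ => by positivity) (Finset.mem_univ i)
  have hNN (k : ℕ) : N ≤ Nk k := by
    simp only [Nk]
    exact le_add_of_nonneg_right (Finset.sum_nonneg fun i _ => by positivity)
  -- The energy hypotheses are strict so that the mollified energies are eventually below the same
  -- e².
  have t1 := (tendsto_dens_cv_moll hw.p_memLp hw.g_memLp hw.p_supp hw.g_supp
    {z | h z < R}).eventually_lt_const hE1
  have t2 := (tendsto_dens_cv_moll hw.q_memLp hw.f_memLp hw.q_supp hw.f_supp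
    {z | h z < R}).eventually_lt_const hE2
  have t3 : ∀ᶠ k : ℕ in atTop, 1 / ((k : ℝ) + 1) < η :=
    tendsto_one_div_add_atTop_nhds_zero_nat.eventually_lt_const hη
  have hlim : ∫ z, ζ z * ∑ i, (p i z * f i z + q i z * g i z) ≤
      B * (R - r)⁻¹ ^ (d + 7) * e * (δ * e + δ⁻¹ ^ (d + 5) * N) := by
    have hL : Tendsto (fun k => ∫ z, ζ z * ∑ i, (cv (moll k) (p i) z * cv (moll k) (f i) z +
        cv (moll k) (q i) z * cv (moll k) (g i) z)) atTop
        (𝓝 (∫ z, ζ z * ∑ i, (p i z * f i z + q i z * g i z))) := by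
      rw [(integral_cutoff_energy hζc hζ.nonneg hζ.le_one hw.p_memLp hw.g_memLp hw.q_memLp
        hw.f_memLp).2]
      simp only [fun k => (integral_cutoff_energy hζc hζ.nonneg hζ.le_one
        (fun i => memLp_cv_moll (hw.p_memLp i) (hw.p_supp i) k)
        (fun i => memLp_cv_moll (hw.g_memLp i) (hw.g_supp i) k)
        (fun i => memLp_cv_moll (hw.q_memLp i) (hw.q_supp i) k)
        (fun i => memLp_cv_moll (hw.f_memLp i) (hw.f_supp i) k)).2]
      refine tendsto_finsetSum _ fun i _ => Tendsto.add ?_ ?_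
      · exact tendsto_integral_cutoff hζc hζ.nonneg hζ.le_one (hw.p_memLp i) (hw.f_memLp i)
          (hw.p_supp i) (hw.f_supp i)
      · exact tendsto_integral_cutoff hζc hζ.nonneg hζ.le_one (hw.q_memLp i) (hw.g_memLp i)
          (hw.q_supp i) (hw.g_supp i)
    have hRt : Tendsto (fun k => B * (R - r)⁻¹ ^ (d + 7) * e * (δ * e + δ⁻¹ ^ (d + 5) * Nk k))
        atTop (𝓝 (B * (R - r)⁻¹ ^ (d + 7) * e * (δ * e + δ⁻¹ ^ (d + 5) * N))) :=
      ((hNk.const_mul _).const_add _).const_mul _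
    refine le_of_tendsto_of_tendsto hL hRt ?_
    filter_upwards [t1, t2, t3] with k k1 k2 k3
    obtain ⟨us, hus⟩ := hw.exists_smoothSol hg (contDiff_moll k) (tsupport_moll k).subset
      (fun z hz => hηV' z hz k3.le)
    refine hstep r R hrR (by linarith) hR ζ hζ _ us _ _ _ _ hus e δ (Nk k) he hδ hδc
      (hN.trans (hNN k)) k1.le k2.le (fun i => ?_) fun i => ?_
    · refine (hpN i).cv_moll (hw.p_memLp i) (hw.p_supp i) k ?_
      have := hi k i
      have := Real.sqrt_nonneg (∫ z, (cv (moll k) (g i) z - g i z) ^ 2)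
      linarith
    · refine (hgN i).cv_moll (hw.g_memLp i) (hw.g_supp i) k ?_
      have := hi k i
      have := Real.sqrt_nonneg (∫ z, (cv (moll k) (p i) z - p i z) ^ 2)
      linarith
  -- The ellipticity is pointwise and is used only for the limit fields: mollification does not
  -- commute with the coefficients.
  refine le_trans ?_ hlim
  have hdi := integrable_dens hw.p_memLp hw.g_memLp
  have hQm : MeasurableSet {z | h z < r} :=
    (isOpen_lt hg.continuous continuous_const).measurableSet
  rw [← integral_const_mul, ← integral_indicator hQm]
  refine integral_mono ((hdi.const_mul cE).indicator hQm)
    (integral_cutoff_energy hζc hζ.nonneg hζ.le_one hw.p_memLp hw.g_memLp hw.q_memLp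
      hw.f_memLp).1 fun z => ?_
  have hnn : 0 ≤ ∑ i, (p i z * f i z + q i z * g i z) :=
    (mul_nonneg hcE (dens_nonneg p g z)).trans (hell z)
  by_cases hz : z ∈ {z | h z < r}
  · rw [indicator_of_mem hz]
    change _ ≤ ζ z * _
    rw [hζ.eq_one z (le_of_lt hz), one_mul]
    exact hell z
  · rw [indicator_of_notMem hz]
    exact mul_nonneg (hζ.nonneg z) hnn

/-- The interior estimate at unit scale. -/
theorem exists_interior_bound {V₀ V : Set (TS d)} {h : TS d → ℝ} (hg : IsGauge V₀ V h)
    (hV : IsOpen V) {cE CE : ℝ} (hcE : 0 < cE) (hCE : 1 ≤ CE) :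
    ∃ C : ℝ, 0 < C ∧ ∀ u p g q f, WeakSol V u p g q f → ∀ N : ℝ, 0 ≤ N →
      (∀ z, cE * dens p g z ≤ ∑ i, (p i z * f i z + q i z * g i z)) →
      (∀ z, dens q f z ≤ CE * dens p g z) →
      (∀ i, WeakBound V N (p i)) → (∀ i, WeakBound V N (g i)) →
      ∫ z in V₀, dens p g z ≤ C * N ^ 2 := by
  obtain ⟨B, c, hB, hc, hc1, hstep⟩ := exists_weak_energy_step hg hV
  -- With δ = c₁(R - r)^{d+7}, the factor (R - r)^{-(d+7)} δ^{-(d+5)} has exponent (d + 7)(d + 6);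
  -- Young's inequality doubles it.
  set m : ℕ := 2 * ((d + 7) * (d + 6)) with hm
  -- The second entry makes the coefficient θ = 2 B c₁ CE / cE satisfy θ 2^{m+1} ≤ 1, as absorption
  -- requires.
  set c₁ : ℝ := min c (cE / (2 * B * CE * 2 ^ (m + 1))) with hc₁
  have hCE0 : 0 < CE := by linarith
  have hc₁0 : 0 < c₁ := lt_min hc (by positivity)
  have hc₁c : c₁ ≤ c := min_le_left _ _
  have hc₁E : c₁ * (2 * B * CE * 2 ^ (m + 1)) ≤ cE :=
    (le_div_iff₀ (by positivity)).1 (min_le_right _ _)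
  set D : ℝ := cE⁻¹ * (B * (c₁⁻¹ ^ (d + 5)) ^ 2 * c₁⁻¹)
  refine ⟨2 ^ (m + 1) * D, by positivity, ?_⟩
  intro u p g q f hw N hN hell hCEd hpN hgN
  have hdi := integrable_dens hw.p_memLp hw.g_memLp
  have hdi' := integrable_dens hw.q_memLp hw.f_memLp
  set E : ℝ → ℝ := fun r => ∫ z in {z | h z < r}, dens p g z with hE
  have hE0 (r : ℝ) : 0 ≤ E r := integral_nonneg fun z => dens_nonneg p g z
  have hqf (R : ℝ) : ∫ z in {z | h z < R}, dens q f z ≤ CE * E R := by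
    rw [hE, ← integral_const_mul]
    exact integral_mono hdi'.integrableOn (hdi.const_mul _).integrableOn hCEd
  have hV0 : ∫ z in V₀, dens p g z ≤ E 1 :=
    setIntegral_mono_set hdi.integrableOn (ae_of_all _ fun z => dens_nonneg p g z)
      hg.inner.eventuallyLE
  refine hV0.trans ?_
  rw [mul_assoc]
  refine le_of_absorb (M := ∫ z, dens p g z) (θ := cE⁻¹ * (2 * B * c₁ * CE)) (m := m) ?_ hE0
    (by positivity) ?_ ?_
  · intro r _ _
    exact setIntegral_le_integral hdi (ae_of_all _ fun z => dens_nonneg p g z)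
  · rw [mul_assoc, inv_mul_le_iff₀ hcE, mul_one]
    linarith
  · intro r R hr hrR hR
    set τ := R - r with hτ
    have hτ0 : 0 < τ := sub_pos.2 hrR
    have hτ1 : τ ≤ 1 := by linarith
    -- The number ε makes e positive and the energy bounds strict; it is removed afterwards.
    have key : ∀ ε, 0 < ε → cE * E r ≤ 2 * B * c₁ * (CE * E R + ε)
        + B * (c₁⁻¹ ^ (d + 5)) ^ 2 * c₁⁻¹ * (τ⁻¹ ^ m * N ^ 2) := by
      intro ε hε
      have hpos : 0 < CE * E R + ε := by have := hE0 R; positivity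
      set e := √(CE * E R + ε)
      have he : 0 < e := Real.sqrt_pos.2 hpos
      have he2 : e ^ 2 = CE * E R + ε := Real.sq_sqrt hpos.le
      have hτp : τ ^ (d + 7) ≤ τ := pow_le_of_le_one hτ0.le hτ1 (by omega)
      -- The power of τ in δ cancels the prefactor τ^{-(d+7)}, so the coefficient of e² does not
      -- depend on the gap.
      have h1 := hstep u p g q f hw cE N hcE.le hN hell hpN hgN r R e (c₁ * τ ^ (d + 7)) hr hrR hR
        he (by positivity) (mul_le_mul hc₁c hτp (by positivity) hc.le)
        (by rw [he2]; have : E R ≤ CE * E R := le_mul_of_one_le_left (hE0 R) hCE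
            change E R < _; linarith)
        (by rw [he2]; have := hqf R; linarith)
      refine h1.trans ?_
      rw [← he2]
      set y : ℝ := τ⁻¹ ^ ((d + 7) * (d + 6)) * c₁⁻¹ ^ (d + 5) * N with hy
      have e1 : B * τ⁻¹ ^ (d + 7) * e * (c₁ * τ ^ (d + 7) * e + (c₁ * τ ^ (d + 7))⁻¹ ^ (d + 5) * N)
          = B * (c₁ * e ^ 2 + e * y) := by
        have e2 : τ⁻¹ ^ (d + 7) * τ ^ (d + 7) = 1 := by
          rw [← mul_pow, inv_mul_cancel₀ hτ0.ne', one_pow]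
        have e3 : (c₁ * τ ^ (d + 7))⁻¹ ^ (d + 5) = c₁⁻¹ ^ (d + 5) * τ⁻¹ ^ ((d + 7) * (d + 5)) := by
          rw [mul_inv, mul_pow, ← inv_pow, ← pow_mul]
        rw [e3, hy, show (d + 7) * (d + 6) = (d + 7) + (d + 7) * (d + 5) by ring, pow_add]
        linear_combination (B * c₁ * e ^ 2) * e2
      have e4 : τ⁻¹ ^ m * N ^ 2 * (c₁⁻¹ ^ (d + 5)) ^ 2 = y ^ 2 := by
        rw [hy, hm, pow_mul']; ring
      have e5 : e * y ≤ c₁ * e ^ 2 + c₁⁻¹ * y ^ 2 := by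
        have h2 : 0 ≤ c₁⁻¹ * ((c₁ * e - y) ^ 2 + (c₁ * e) ^ 2 + y ^ 2) := by positivity
        have h3 : c₁⁻¹ * ((c₁ * e - y) ^ 2 + (c₁ * e) ^ 2 + y ^ 2)
            = 2 * (c₁ * e ^ 2 + c₁⁻¹ * y ^ 2 - e * y) := by field_simp; ring
        linarith
      rw [e1]
      calc B * (c₁ * e ^ 2 + e * y) ≤ B * (c₁ * e ^ 2 + (c₁ * e ^ 2 + c₁⁻¹ * y ^ 2)) := by gcongr
        _ = _ := by rw [← e4]; ring
    have key' : cE * E r ≤ 2 * B * c₁ * (CE * E R)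
        + B * (c₁⁻¹ ^ (d + 5)) ^ 2 * c₁⁻¹ * (τ⁻¹ ^ m * N ^ 2) := by
      refine le_of_forall_pos_le_add fun ε hε => ?_
      have := key (ε / (2 * B * c₁)) (by positivity)
      have e6 : 2 * B * c₁ * (CE * E R + ε / (2 * B * c₁)) = 2 * B * c₁ * (CE * E R) + ε := by
        field_simp
      linarith
    calc E r = cE⁻¹ * (cE * E r) := by field_simp
      _ ≤ cE⁻¹ * (2 * B * c₁ * (CE * E R)
        + B * (c₁⁻¹ ^ (d + 5)) ^ 2 * c₁⁻¹ * (τ⁻¹ ^ m * N ^ 2)) := by gcongr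
      _ = _ := by simp only [D]; ring

/-! ### The block matrix of a coefficient matrix -/

lemma mulVec_sq_le {a : Matrix (Fin d) (Fin d) ℝ} {K : ℝ} (ha : ∀ i j, |a i j| ≤ K)
    (x : Fin d → ℝ) : ∑ i, (a *ᵥ x) i ^ 2 ≤ d ^ 2 * K ^ 2 * ∑ i, x i ^ 2 := by
  have h (i : Fin d) : (a *ᵥ x) i ^ 2 ≤ d * K ^ 2 * ∑ j, x j ^ 2 := by
    have h1 : (a *ᵥ x) i ^ 2 ≤ (∑ j, a i j ^ 2) * ∑ j, x j ^ 2 :=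
      Finset.sum_mul_sq_le_sq_mul_sq Finset.univ (a i) x
    have h2 : ∑ j, a i j ^ 2 ≤ d * K ^ 2 := by
      calc ∑ j, a i j ^ 2 ≤ ∑ _j : Fin d, K ^ 2 :=
            Finset.sum_le_sum fun j _ => sq_le_sq' (abs_le.1 (ha i j)).1 (abs_le.1 (ha i j)).2
        _ = d * K ^ 2 := by simp
    exact h1.trans (mul_le_mul_of_nonneg_right h2 (Finset.sum_nonneg fun j _ => sq_nonneg _))
  calc ∑ i, (a *ᵥ x) i ^ 2 ≤ ∑ _i : Fin d, d * K ^ 2 * ∑ j, x j ^ 2 :=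
        Finset.sum_le_sum fun i _ => h i
    _ = _ := by simp; ring

section Block

variable {Λ : ℝ} {a : Matrix (Fin d) (Fin d) ℝ}

lemma symPart_add_skewPart (a : Matrix (Fin d) (Fin d) ℝ) : symPart a + skewPart a = a := by
  ext i j; simp [symPart, skewPart]; ring

lemma dotProduct_skewPart_add (x y : Fin d → ℝ) :
    x ⬝ᵥ skewPart a *ᵥ y + y ⬝ᵥ skewPart a *ᵥ x = 0 := by
  have h : (skewPart a)ᵀ = -skewPart a := by
    ext i j; simp [skewPart]; ring
  rw [Matrix.dotProduct_mulVec, ← Matrix.mulVec_transpose, h, Matrix.neg_mulVec, neg_dotProduct,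
    dotProduct_comm]
  ring

lemma dotProduct_symPart (hell : ∀ ξ : Space d, Λ⁻¹ * ‖ξ‖ ^ 2 ≤ ξ.ofLp ⬝ᵥ a *ᵥ ξ.ofLp)
    (x : Fin d → ℝ) : Λ⁻¹ * ∑ i, x i ^ 2 ≤ x ⬝ᵥ symPart a *ᵥ x := by
  have h := hell (WithLp.toLp 2 x)
  rw [EuclideanSpace.real_norm_sq_eq] at h
  nth_rw 1 [← symPart_add_skewPart a, Matrix.add_mulVec, dotProduct_add] at h
  have := dotProduct_skewPart_add (a := a) x x
  simp only at h
  linarith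

lemma isUnit_det_symPart (hΛ : 0 < Λ)
    (hell : ∀ ξ : Space d, Λ⁻¹ * ‖ξ‖ ^ 2 ≤ ξ.ofLp ⬝ᵥ a *ᵥ ξ.ofLp) : IsUnit (symPart a).det := by
  rw [← Matrix.isUnit_iff_isUnit_det, ← Matrix.mulVec_injective_iff_isUnit]
  refine (injective_iff_map_eq_zero (Matrix.mulVecLin (symPart a))).2 fun x hx => ?_
  have h := dotProduct_symPart hell x
  rw [show symPart a *ᵥ x = 0 from hx, dotProduct_zero] at h
  have h1 : ∑ i, x i ^ 2 ≤ 0 := by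
    have := inv_pos.2 hΛ
    by_contra! h2
    have := mul_pos this h2
    linarith
  ext i
  have h2 := (Finset.sum_eq_zero_iff_of_nonneg fun i _ => sq_nonneg (x i)).1
    (le_antisymm h1 (Finset.sum_nonneg fun i _ => sq_nonneg _)) i (Finset.mem_univ i)
  simpa using h2

lemma abs_apply_le (hbd : ∀ ξ : Space d, ‖WithLp.toLp 2 (a *ᵥ ξ.ofLp)‖ ≤ Λ * ‖ξ‖) (i j : Fin d) :
    |a i j| ≤ Λ := by
  have h := hbd (EuclideanSpace.single j 1)
  have h1 : ‖(WithLp.toLp 2 (a *ᵥ (EuclideanSpace.single j (1 : ℝ)).ofLp) : Space d) i‖ ≤ _ :=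
    PiLp.norm_apply_le _ i
  refine le_trans ?_ (h1.trans (h.trans ?_))
  · simp
  · simp

lemma abs_symPart_le (hbd : ∀ ξ : Space d, ‖WithLp.toLp 2 (a *ᵥ ξ.ofLp)‖ ≤ Λ * ‖ξ‖)
    (i j : Fin d) : |symPart a i j| ≤ Λ := by
  have h1 := abs_le.1 (abs_apply_le hbd i j)
  have h2 := abs_le.1 (abs_apply_le hbd j i)
  simp only [symPart, Matrix.smul_apply, Matrix.add_apply, Matrix.transpose_apply, smul_eq_mul]
  rw [abs_le]; constructor <;> linarith [h1.1, h1.2, h2.1, h2.2]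

lemma abs_skewPart_le (hbd : ∀ ξ : Space d, ‖WithLp.toLp 2 (a *ᵥ ξ.ofLp)‖ ≤ Λ * ‖ξ‖)
    (i j : Fin d) : |skewPart a i j| ≤ Λ := by
  have h1 := abs_le.1 (abs_apply_le hbd i j)
  have h2 := abs_le.1 (abs_apply_le hbd j i)
  simp only [skewPart, Matrix.smul_apply, Matrix.sub_apply, Matrix.transpose_apply, smul_eq_mul]
  rw [abs_le]; constructor <;> linarith [h1.1, h1.2, h2.1, h2.2]

lemma bigA_mulVec_inr (X : Fin d ⊕ Fin d → ℝ) :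
    (fun i => (bigA a *ᵥ X) (Sum.inr i)) =
      (symPart a)⁻¹ *ᵥ ((fun i => X (Sum.inr i)) - skewPart a *ᵥ fun i => X (Sum.inl i)) := by
  have e : X = Sum.elim (fun i => X (Sum.inl i)) (fun i => X (Sum.inr i)) := by
    ext (i | i) <;> rfl
  ext i
  nth_rw 1 [e]
  rw [bigA, Matrix.fromBlocks_mulVec]
  simp [Matrix.mulVec_sub, Matrix.neg_mulVec, Function.comp_def]
  ring

/-- The blocks are those of a partial inversion: with q = s⁻¹(g - m p), the first row reads s p + m
q. Together with g = s q + m p this makes (p, q) the natural variables. -/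
lemma bigA_mulVec_inl (X : Fin d ⊕ Fin d → ℝ) :
    (fun i => (bigA a *ᵥ X) (Sum.inl i)) = symPart a *ᵥ (fun i => X (Sum.inl i)) +
      skewPart a *ᵥ fun i => (bigA a *ᵥ X) (Sum.inr i) := by
  have e : X = Sum.elim (fun i => X (Sum.inl i)) (fun i => X (Sum.inr i)) := by
    ext (i | i) <;> rfl
  rw [bigA_mulVec_inr]
  ext i
  nth_rw 1 [e]
  rw [bigA, Matrix.fromBlocks_mulVec]
  simp [Matrix.mulVec_sub, Matrix.sub_mulVec, Function.comp_def, mul_assoc]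
  ring

lemma inr_eq_of_bigA (hs : IsUnit (symPart a).det) (X : Fin d ⊕ Fin d → ℝ) :
    (fun i => X (Sum.inr i)) = symPart a *ᵥ (fun i => (bigA a *ᵥ X) (Sum.inr i)) +
      skewPart a *ᵥ fun i => X (Sum.inl i) := by
  rw [bigA_mulVec_inr, Matrix.mulVec_mulVec, Matrix.mul_nonsing_inv _ hs, Matrix.one_mulVec]
  simp

lemma sum_sq_add_mulVec_le {b c : Matrix (Fin d) (Fin d) ℝ} {K : ℝ} (hb : ∀ i j, |b i j| ≤ K)
    (hc : ∀ i j, |c i j| ≤ K) (x y : Fin d → ℝ) :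
    ∑ i, (b *ᵥ x + c *ᵥ y) i ^ 2 ≤ 2 * d ^ 2 * K ^ 2 * (∑ i, x i ^ 2 + ∑ i, y i ^ 2) := by
  have h1 := mulVec_sq_le hb x
  have h2 := mulVec_sq_le hc y
  calc ∑ i, (b *ᵥ x + c *ᵥ y) i ^ 2 ≤ ∑ i, 2 * ((b *ᵥ x) i ^ 2 + (c *ᵥ y) i ^ 2) :=
        Finset.sum_le_sum fun i _ => add_sq_le
    _ = 2 * (∑ i, (b *ᵥ x) i ^ 2 + ∑ i, (c *ᵥ y) i ^ 2) := by
        rw [← Finset.mul_sum, Finset.sum_add_distrib]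
    _ ≤ _ := by linarith

/-- The block matrix is elliptic and bounded, with constants that depend only on `d` and `Λ`. -/
lemma bigA_bounds (hΛ : 0 < Λ)
    (hell : ∀ ξ : Space d, Λ⁻¹ * ‖ξ‖ ^ 2 ≤ ξ.ofLp ⬝ᵥ a *ᵥ ξ.ofLp)
    (hbd : ∀ ξ : Space d, ‖WithLp.toLp 2 (a *ᵥ ξ.ofLp)‖ ≤ Λ * ‖ξ‖) (X : Fin d ⊕ Fin d → ℝ) :
    Λ⁻¹ / (1 + 2 * d ^ 2 * Λ ^ 2) * ∑ k, X k ^ 2 ≤ X ⬝ᵥ bigA a *ᵥ X ∧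
    ∑ k, (bigA a *ᵥ X) k ^ 2 ≤ Λ ^ 2 * (1 + 2 * d ^ 2 * Λ ^ 2) ^ 2 * ∑ k, X k ^ 2 := by
  set p : Fin d → ℝ := fun i => X (Sum.inl i) with hp
  set g : Fin d → ℝ := fun i => X (Sum.inr i) with hg
  set f : Fin d → ℝ := fun i => (bigA a *ᵥ X) (Sum.inl i) with hf
  set q : Fin d → ℝ := fun i => (bigA a *ᵥ X) (Sum.inr i) with hq
  set κ : ℝ := 1 + 2 * d ^ 2 * Λ ^ 2 with hκ
  have hκ1 : 0 < κ := by positivity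
  have ef : f = symPart a *ᵥ p + skewPart a *ᵥ q := bigA_mulVec_inl X
  have eg : g = symPart a *ᵥ q + skewPart a *ᵥ p :=
    inr_eq_of_bigA (isUnit_det_symPart hΛ hell) X
  have hX : ∑ k, X k ^ 2 = ∑ i, p i ^ 2 + ∑ i, g i ^ 2 := Fintype.sum_sum_type _
  have hY : ∑ k, (bigA a *ᵥ X) k ^ 2 = ∑ i, f i ^ 2 + ∑ i, q i ^ 2 := Fintype.sum_sum_type _
  have hXY : X ⬝ᵥ bigA a *ᵥ X = p ⬝ᵥ f + g ⬝ᵥ q := Fintype.sum_sum_type _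
  have hs := abs_symPart_le hbd
  have hm := abs_skewPart_le hbd
  have bg := sum_sq_add_mulVec_le hs hm q p
  have bf := sum_sq_add_mulVec_le hs hm p q
  rw [← eg] at bg
  rw [← ef] at bf
  -- In the variables (p, q) the two skew contributions p · m q and q · m p cancel, leaving the
  -- quadratic form of s in each variable.
  have hpos : Λ⁻¹ * (∑ i, p i ^ 2 + ∑ i, q i ^ 2) ≤ p ⬝ᵥ f + g ⬝ᵥ q := by
    have e : p ⬝ᵥ f + g ⬝ᵥ q = p ⬝ᵥ symPart a *ᵥ p + q ⬝ᵥ symPart a *ᵥ q := by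
      have := dotProduct_skewPart_add (a := a) p q
      rw [dotProduct_comm g q, ef, eg, dotProduct_add, dotProduct_add]
      linarith
    rw [e, mul_add]
    exact add_le_add (dotProduct_symPart hell p) (dotProduct_symPart hell q)
  have hp0 : 0 ≤ ∑ i, p i ^ 2 := Finset.sum_nonneg fun i _ => sq_nonneg _
  have hq0 : 0 ≤ ∑ i, q i ^ 2 := Finset.sum_nonneg fun i _ => sq_nonneg _
  set x := ∑ i, p i ^ 2 + ∑ i, q i ^ 2 with hx
  have hG : ∑ i, p i ^ 2 + ∑ i, g i ^ 2 ≤ κ * x := by rw [hκ]; linarith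
  have hF : ∑ i, f i ^ 2 + ∑ i, q i ^ 2 ≤ κ * x := by rw [hκ]; linarith
  rw [hX, hY, hXY]
  constructor
  · refine le_trans ?_ hpos
    rw [div_mul_eq_mul_div, div_le_iff₀ hκ1, mul_assoc]
    have := inv_pos.2 hΛ
    nlinarith
  · set t : ℝ := Λ⁻¹ / κ with ht
    have ht0 : 0 < t := by positivity
    have htκ : t * κ = Λ⁻¹ := div_mul_cancel₀ _ hκ1.ne'
    have hyoung (y z : ℝ) : y * z ≤ 1 / 2 * (t * z ^ 2 + t⁻¹ * y ^ 2) := by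
      have h1 : 0 ≤ t⁻¹ * (t * z - y) ^ 2 := by positivity
      have h2 : t⁻¹ * (t * z - y) ^ 2 = t * z ^ 2 + t⁻¹ * y ^ 2 - 2 * (y * z) := by
        field_simp; ring
      linarith
    have hsum : p ⬝ᵥ f + g ⬝ᵥ q ≤ 1 / 2 * (t * (∑ i, f i ^ 2 + ∑ i, q i ^ 2)
        + t⁻¹ * (∑ i, p i ^ 2 + ∑ i, g i ^ 2)) := by
      simp only [dotProduct, Finset.mul_sum, mul_add, ← Finset.sum_add_distrib]
      refine Finset.sum_le_sum fun i _ => ?_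
      have := hyoung (p i) (f i); have := hyoung (g i) (q i)
      linarith
    have h1 : t * (∑ i, f i ^ 2 + ∑ i, q i ^ 2) ≤ Λ⁻¹ * x := by
      rw [← htκ, mul_assoc]; gcongr
    have h2 : Λ⁻¹ * x ≤ t⁻¹ * (∑ i, p i ^ 2 + ∑ i, g i ^ 2) := by linarith
    have h3 : t⁻¹ = Λ * κ := by rw [ht]; field_simp
    have h4 : x ≤ Λ * (Λ * κ * (∑ i, p i ^ 2 + ∑ i, g i ^ 2)) := by
      rw [← h3]
      calc x = Λ * (Λ⁻¹ * x) := by field_simp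
        _ ≤ _ := by gcongr
    calc _ ≤ κ * x := hF
      _ ≤ κ * (Λ * (Λ * κ * (∑ i, p i ^ 2 + ∑ i, g i ^ 2))) := by gcongr
      _ = _ := by ring

end Block

/-! ### Measurability and square integrability of 𝐀S -/

lemma aemeasurable_det {α n : Type*} [MeasurableSpace α] {μ : Measure α} [Fintype n]
    [DecidableEq n] {A : α → Matrix n n ℝ} (h : ∀ i j, AEMeasurable (fun z => A z i j) μ) :
    AEMeasurable (fun z => (A z).det) μ := by
  simp only [Matrix.det_apply']
  refine Finset.aemeasurable_fun_sum _ fun σ _ => ?_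
  exact (Finset.aemeasurable_fun_prod _ fun i _ => h _ _).const_mul _

/-- Cramer's rule: each entry is a determinant times the inverse of the determinant. -/
lemma aemeasurable_inv {α n : Type*} [MeasurableSpace α] {μ : Measure α} [Fintype n]
    [DecidableEq n] {A : α → Matrix n n ℝ} (h : ∀ i j, AEMeasurable (fun z => A z i j) μ)
    (i j : n) : AEMeasurable (fun z => (A z)⁻¹ i j) μ := by
  simp only [Matrix.inv_def, Ring.inverse_eq_inv', Matrix.smul_apply, smul_eq_mul,
    Matrix.adjugate_apply]
  refine (aemeasurable_det h).inv.mul (aemeasurable_det fun k l => ?_)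
  simp only [Matrix.updateRow_apply]
  split_ifs
  · exact aemeasurable_const
  · exact h k l

lemma aemeasurable_matrix_mul {α n : Type*} [MeasurableSpace α] {μ : Measure α} [Fintype n]
    {A B : α → Matrix n n ℝ} (hA : ∀ i j, AEMeasurable (fun z => A z i j) μ)
    (hB : ∀ i j, AEMeasurable (fun z => B z i j) μ) (i j : n) :
    AEMeasurable (fun z => (A z * B z) i j) μ := by
  simp only [Matrix.mul_apply]
  exact Finset.aemeasurable_fun_sum _ fun k _ => (hA i k).mul (hB k j)

lemma aemeasurable_bigA {μ : Measure (TS d)} {a : TS d → Matrix (Fin d) (Fin d) ℝ}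
    (ha : ∀ i j, AEMeasurable (fun z => a z i j) μ) (i j : Fin d ⊕ Fin d) :
    AEMeasurable (fun z => bigA (a z) i j) μ := by
  have hs (i j : Fin d) : AEMeasurable (fun z => symPart (a z) i j) μ :=
    ((ha i j).add (ha j i)).const_mul _
  have hm (i j : Fin d) : AEMeasurable (fun z => skewPart (a z) i j) μ :=
    ((ha i j).sub (ha j i)).const_mul _
  have hi := aemeasurable_inv hs
  rcases i with i | i <;> rcases j with j | j
  · exact (hs i j).sub (aemeasurable_matrix_mul (aemeasurable_matrix_mul hm hi) hm i j)
  · exact aemeasurable_matrix_mul hm hi i j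
  · exact (aemeasurable_matrix_mul hi hm i j).neg
  · exact hi i j

/-- The field `𝐀 S` is square integrable if `S` is. -/
lemma memLp_bigA_mulVec {Λ : ℝ} (hΛ : 0 < Λ) {a : TS d → Matrix (Fin d) (Fin d) ℝ}
    (ha : IsCoeffField Λ a) {V : Set (TS d)} {S : TS d → PairVec d}
    (hS : MemLp S 2 (volume.restrict V)) (k : Fin d ⊕ Fin d) :
    MemLp (fun z => (bigA (a z) *ᵥ (S z).ofLp) k) 2 (volume.restrict V) := by
  have hSm (l : Fin d ⊕ Fin d) : AEMeasurable (fun z => S z l) (volume.restrict V) :=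
    (hS.eval_piLp l).1.aemeasurable
  have hm : AEStronglyMeasurable (fun z => (bigA (a z) *ᵥ (S z).ofLp) k) (volume.restrict V) := by
    refine AEMeasurable.aestronglyMeasurable ?_
    simp only [Matrix.mulVec, dotProduct]
    exact Finset.aemeasurable_fun_sum _ fun l _ =>
      (aemeasurable_bigA (fun i j => (ha.measurable i j).restrict) k l).mul (hSm l)
  refine hS.of_le_mul (c := Λ * (1 + 2 * d ^ 2 * Λ ^ 2)) hm (ae_of_all _ fun z => ?_)
  have h := (bigA_bounds hΛ (ha.elliptic z) (ha.bounded z) (S z).ofLp).2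
  rw [← EuclideanSpace.real_norm_sq_eq] at h
  refine abs_le_of_sq_le_sq ?_ (by positivity)
  calc _ ≤ ∑ k, (bigA (a z) *ᵥ (S z).ofLp) k ^ 2 :=
        Finset.single_le_sum (f := fun k => (bigA (a z) *ᵥ (S z).ofLp) k ^ 2)
          (fun k _ => sq_nonneg _) (Finset.mem_univ k)
    _ ≤ _ := h
    _ = _ := by ring

/-! ### Solution pairs are weak solutions -/

lemma integral_indicator_mul {V : Set (TS d)} (hV : MeasurableSet V) (F φ : TS d → ℝ) :
    ∫ z, V.indicator F z * φ z = ∫ z in V, F z * φ z := by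
  rw [← integral_indicator hV]
  congr 1; ext z
  by_cases hz : z ∈ V <;> simp [hz]

lemma IsTest.eq_zero {V : Set (TS d)} {φ : TS d → ℝ} (h : IsTest V φ) {z : TS d} (hz : z ∉ V) :
    φ z = 0 :=
  image_eq_zero_of_notMem_tsupport fun hz' => hz (h.supp hz')

lemma IsTest.dir {V : Set (TS d)} {φ : TS d → ℝ} (h : IsTest V φ) (v : TS d) :
    IsTest V (dir v φ) :=
  ⟨contDiff_dir_infty h.smooth v, hasCompactSupport_dir h.compact v,
    (tsupport_dir_subset φ v).trans h.supp⟩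

lemma IsTest.zero {V : Set (TS d)} : IsTest V (fun _ => (0 : ℝ)) :=
  ⟨contDiff_const, HasCompactSupport.zero, by simp [tsupport]⟩

lemma IsTest.memLp {V : Set (TS d)} {φ : TS d → ℝ} (h : IsTest V φ) (μ : Measure (TS d))
    [IsFiniteMeasureOnCompacts μ] : MemLp φ 2 μ :=
  memLp_of_compact h.smooth.continuous h.compact 2 μ

/-- A `C¹` function with compact support in the cylinder belongs to `L²(I; H¹(U))`. -/
lemma isL2H1_of_contDiff {I : Set ℝ} {U : Set (Space d)} {w : TS d → ℝ} (hw : ContDiff ℝ 1 w)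
    (hc : HasCompactSupport w) : IsL2H1 I U w (grad w) := by
  refine ⟨memLp_of_compact hw.continuous hc 2 _, MemLp.of_eval_piLp fun i => ?_, fun φ hφ i => ?_⟩
  · exact memLp_of_compact (continuous_dir hw (ex i)) (hasCompactSupport_dir hc _) 2 _
  · rw [setIntegral_eq_integral_of_forall_compl_eq_zero
        (fun z hz => by rw [grad_apply, (hφ.dir (ex i)).eq_zero hz, mul_zero]),
      setIntegral_eq_integral_of_forall_compl_eq_zero
        (fun z hz => by rw [hφ.eq_zero hz, mul_zero])]
    simp only [grad_apply]
    rw [integral_dir_mul hw (contDiff_one_of_infty hφ.smooth) hc, neg_neg]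

/-- The constant sequence v approximates itself, and the functional is integration against the
classical ∂ₜv. The flux identity is the definition of the weak gradient of φ, tested with the
components of h. -/
lemma mem_pairsZero {I : Set ℝ} {U : Set (Space d)} {v : TS d → ℝ} {h : Fin d → TS d → ℝ}
    (hv : IsTest (I ×ˢ U) v) (hh : ∀ i, IsTest (I ×ˢ U) (h i))
    (hdt : ∀ z, dir et v z = ∑ i, dir (ex i) (h i) z) :
    (fun z => WithLp.toLp 2 (Sum.elim (fun i => dir (ex i) v z) fun i => h i z) :
      TS d → PairVec d) ∈ pairsZero I U := by
  refine ⟨?_, v, fun φ _ => ∫ z in I ×ˢ U, φ z * dt v z, ⟨?_, fun _ => v, fun _ => hv, ?_, ?_, ?_⟩,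
    ?_⟩
  · refine MemLp.of_eval_piLp fun k => ?_
    rcases k with i | i
    · exact (hv.dir (ex i)).memLp _
    · exact (hh i).memLp _
  · exact isL2H1_of_contDiff (contDiff_one_of_infty hv.smooth) hv.compact
  · simp
  · have e (z : TS d) : grad v z - gradPart (fun z => WithLp.toLp 2
        (Sum.elim (fun i => dir (ex i) v z) fun i => h i z)) z = 0 := by
      ext i; simp [gradPart, grad_apply]
    simp [e]
  · intro ε hε
    refine Eventually.of_forall fun _ φ Φ _ => ?_
    simp only [sub_self, abs_zero]
    positivity
  · intro φ Φ hφ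
    have i1 (i : Fin d) : Integrable (fun z => Φ z i * h i z) (volume.restrict (I ×ˢ U)) :=
      (hφ.grad_memLp.eval_piLp i).integrable_mul ((hh i).memLp _)
    have i2 (i : Fin d) :
        Integrable (fun z => φ z * dir (ex i) (h i) z) (volume.restrict (I ×ˢ U)) :=
      hφ.memLp.integrable_mul (((hh i).dir _).memLp _)
    simp only [fluxPart, Sum.elim_inr, dt_eq_dir, hdt, Finset.mul_sum]
    rw [integral_finsetSum _ fun i _ => i1 i, integral_finsetSum _ fun i _ => i2 i,
      ← Finset.sum_neg_distrib]
    refine Finset.sum_congr rfl fun i _ => ?_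
    have := hφ.weak_grad _ (hh i) i
    simp only [grad_apply] at this
    rw [this, neg_neg]

/-- The orthogonality that defines solution pairs, tested against smooth pairs. -/
lemma solPairs_orthogonal {Λ : ℝ} (hΛ : 0 < Λ) {a : TS d → Matrix (Fin d) (Fin d) ℝ}
    (ha : IsCoeffField Λ a) {I : Set ℝ} {U : Set (Space d)} {S : TS d → PairVec d}
    (hS : S ∈ solPairs a I U) {v : TS d → ℝ} {h : Fin d → TS d → ℝ}
    (hv : IsTest (I ×ˢ U) v) (hh : ∀ i, IsTest (I ×ˢ U) (h i))
    (hdt : ∀ z, dir et v z = ∑ i, dir (ex i) (h i) z) :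
    (∑ i, ∫ z in I ×ˢ U, (bigA (a z) *ᵥ (S z).ofLp) (Sum.inl i) * dir (ex i) v z) +
      ∑ i, ∫ z in I ×ˢ U, (bigA (a z) *ᵥ (S z).ofLp) (Sum.inr i) * h i z = 0 := by
  have hY := memLp_bigA_mulVec hΛ ha hS.1.1
  have i1 (i : Fin d) : Integrable (fun z => (bigA (a z) *ᵥ (S z).ofLp) (Sum.inl i) *
      dir (ex i) v z) (volume.restrict (I ×ˢ U)) :=
    (hY _).integrable_mul ((hv.dir _).memLp _)
  have i2 (i : Fin d) : Integrable (fun z => (bigA (a z) *ᵥ (S z).ofLp) (Sum.inr i) * h i z)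
      (volume.restrict (I ×ˢ U)) :=
    (hY _).integrable_mul ((hh i).memLp _)
  rw [← integral_finsetSum _ fun i _ => i1 i, ← integral_finsetSum _ fun i _ => i2 i,
    ← integral_add (integrable_finsetSum _ fun i _ => i1 i)
      (integrable_finsetSum _ fun i _ => i2 i), ← hS.2 _ (mem_pairsZero hv hh hdt)]
  congr 1; ext z
  simp only [dotProduct, Fintype.sum_sum_type, Sum.elim_inl, Sum.elim_inr, mul_comm]

lemma IsTest.ite {V : Set (TS d)} {φ : TS d → ℝ} (h : IsTest V φ) (P : Prop) [Decidable P] :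
    IsTest V fun z => if P then φ z else 0 := by
  by_cases hP : P
  · simpa [hP] using h
  · simpa [hP] using IsTest.zero

lemma IsTest.sub {V : Set (TS d)} {φ ψ : TS d → ℝ} (h : IsTest V φ) (h' : IsTest V ψ) :
    IsTest V fun z => φ z - ψ z := by
  refine ⟨h.smooth.sub h'.smooth, h.compact.sub h'.compact, ?_⟩
  exact (tsupport_sub φ ψ).trans (union_subset h.supp h'.supp)

lemma dir_ite (v : TS d) (φ : TS d → ℝ) (P : Prop) [Decidable P] (z : TS d) :
    dir v (fun z => if P then φ z else 0) z = if P then dir v φ z else 0 := by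
  by_cases hP : P <;> simp [hP, dir]

/-- All fields are extended by zero, so that convolutions make sense globally; the equations are
claimed only against test functions supported in the cylinder. -/
theorem WeakSol.of_solPairs {Λ : ℝ} (hΛ : 0 < Λ) {a : TS d → Matrix (Fin d) (Fin d) ℝ}
    (ha : IsCoeffField Λ a) {I : Set ℝ} {U : Set (Space d)} (hV : MeasurableSet (I ×ˢ U))
    (hb : Bornology.IsBounded (I ×ˢ U)) {S : TS d → PairVec d} (hS : S ∈ solPairs a I U) :
    ∃ u, WeakSol (I ×ˢ U) u (fun i => (I ×ˢ U).indicator fun z => S z (Sum.inl i))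
      (fun i => (I ×ˢ U).indicator fun z => S z (Sum.inr i))
      (fun i => (I ×ˢ U).indicator fun z => (bigA (a z) *ᵥ (S z).ofLp) (Sum.inr i))
      (fun i => (I ×ˢ U).indicator fun z => (bigA (a z) *ᵥ (S z).ofLp) (Sum.inl i)) := by
  obtain ⟨u, hu, hflux⟩ := hS.1.2
  have hY := memLp_bigA_mulVec hΛ ha hS.1.1
  have hSk := fun k => hS.1.1.eval_piLp k
  have hc (F : TS d → ℝ) : HasCompactSupport ((I ×ˢ U).indicator F) :=
    HasCompactSupport.of_support_subset_isCompact hb.isCompact_closure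
      ((support_indicator_subset).trans subset_closure)
  refine ⟨(I ×ˢ U).indicator u, ⟨?_, ?_, ?_, ?_, ?_, fun i => hc _, fun i => hc _, fun i => hc _,
    fun i => hc _, ?_, ?_, ?_, ?_⟩⟩
  · exact (memLp_indicator_iff_restrict hV).2 hu.l2h1.memLp
  · exact fun i => (memLp_indicator_iff_restrict hV).2 (hSk _)
  · exact fun i => (memLp_indicator_iff_restrict hV).2 (hSk _)
  · exact fun i => (memLp_indicator_iff_restrict hV).2 (hY _)
  · exact fun i => (memLp_indicator_iff_restrict hV).2 (hY _)
  · intro φ hφ i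
    rw [integral_indicator_mul hV, integral_indicator_mul hV]
    exact hu.l2h1.weak_grad φ hφ i
  · intro φ hφ
    simp only [integral_indicator_mul hV]
    have h := hflux φ hφ
    have i1 (i : Fin d) : Integrable (fun z => grad φ z i * fluxPart S z i)
        (volume.restrict (I ×ˢ U)) :=
      ((hφ.dir (ex i)).memLp _).integrable_mul (hSk (Sum.inr i))
    rw [integral_finsetSum _ fun i _ => i1 i] at h
    refine Eq.trans (Finset.sum_congr rfl fun i _ => ?_) h
    congr 1; ext z
    rw [mul_comm]; rfl
  · intro φ hφ i j
    simp only [integral_indicator_mul hV]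
    -- The field ∂ⱼφ eᵢ - ∂ᵢφ eⱼ is divergence free, so it pairs with v = 0; orthogonality then says
    -- that q is curl free.
    have h := solPairs_orthogonal hΛ ha hS (v := fun _ => 0)
      (h := fun k z => (if k = i then dir (ex j) φ z else 0) - if k = j then dir (ex i) φ z else 0)
      IsTest.zero (fun k => ((hφ.dir (ex j)).ite _).sub ((hφ.dir (ex i)).ite _)) (fun z => by
        have e (k : Fin d) : dir (ex k) (fun z => (if k = i then dir (ex j) φ z else 0) -
            if k = j then dir (ex i) φ z else 0) z = (if k = i then dir (ex k) (dir (ex j) φ) z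
            else 0) - if k = j then dir (ex k) (dir (ex i) φ) z else 0 := by
          rw [← dir_ite, ← dir_ite]
          unfold dir
          rw [fderiv_fun_sub]
          · rfl
          · exact ((hφ.dir (ex j)).ite _).smooth.differentiable (by simp) z
          · exact ((hφ.dir (ex i)).ite _).smooth.differentiable (by simp) z
        simp only [e, Finset.sum_sub_distrib, Finset.sum_ite_eq', Finset.mem_univ, if_true]
        rw [dir_comm (contDiff_two_of_infty hφ.smooth), sub_self]
        simp [dir])
    have hz (v : TS d) : dir v (fun _ : TS d => (0 : ℝ)) = fun _ => 0 := by ext; simp [dir]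
    have i1 (k l m : Fin d) : Integrable (fun z => (bigA (a z) *ᵥ (S z).ofLp) (Sum.inr k) *
        if k = l then dir (ex m) φ z else 0) (volume.restrict (I ×ˢ U)) :=
      (hY _).integrable_mul (((hφ.dir (ex m)).ite _).memLp _)
    simp only [hz, mul_zero, integral_zero, Finset.sum_const_zero, zero_add, mul_sub] at h
    rw [Finset.sum_congr rfl fun k _ => integral_sub (i1 k i j) (i1 k j i),
      Finset.sum_sub_distrib] at h
    simp only [mul_ite, mul_zero] at h
    have e (l m : Fin d) : ∑ k, ∫ z in I ×ˢ U, (if k = l then (bigA (a z) *ᵥ (S z).ofLp)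
        (Sum.inr k) * dir (ex m) φ z else 0) =
        ∫ z in I ×ˢ U, (bigA (a z) *ᵥ (S z).ofLp) (Sum.inr l) * dir (ex m) φ z := by
      rw [Finset.sum_eq_single l]
      · simp
      · intro k _ hk; simp [hk]
      · simp
    rw [e, e] at h
    exact sub_eq_zero.1 h
  · intro φ hφ i
    simp only [integral_indicator_mul hV]
    -- The pair v = ∂ᵢφ, h = ∂ₜφ eᵢ satisfies ∂ₜv = ∇ · h; orthogonality to it is the weak form of
    -- ∂ₜqᵢ = ∂ᵢ(∇ · f).
    have h := solPairs_orthogonal hΛ ha hS (v := dir (ex i) φ)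
      (h := fun k z => if k = i then dir et φ z else 0) (hφ.dir _)
      (fun k => (hφ.dir et).ite _) (fun z => by
        simp only [dir_ite, Finset.sum_ite_eq', Finset.mem_univ, if_true]
        rw [dir_comm (contDiff_two_of_infty hφ.smooth)])
    rw [← eq_neg_iff_add_eq_zero] at h
    rw [h, Finset.sum_eq_single i]
    · simp
    · intro k _ hk; simp [hk]
    · simp

/-! ### Parabolic scaling of weak solutions -/

lemma memLp_comp_scl {σ : ℝ} (hσ : 0 < σ) {F : TS d → ℝ} (hF : MemLp F 2) :
    MemLp (fun z => F (scl σ z)) 2 := by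
  have h : MemLp F 2 (Measure.map (scl σ) (volume : Measure (TS d))) := by
    rw [map_scl hσ]
    exact hF.smul_measure ENNReal.ofReal_ne_top
  exact h.comp_of_map (continuous_scl_right σ).aemeasurable

lemma hasCompactSupport_comp_scl {σ : ℝ} (hσ : 0 < σ) {F : TS d → ℝ} (hF : HasCompactSupport F) :
    HasCompactSupport fun z => F (scl σ z) :=
  hF.comp_homeomorph (sclHomeo hσ)

lemma tsupport_comp_scl_subset (σ : ℝ) (F : TS d → ℝ) :
    tsupport (fun z => F (scl σ z)) ⊆ scl σ ⁻¹' tsupport F :=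
  tsupport_comp_subset_preimage F (continuous_scl_right σ)

lemma IsTest.comp_scl {V V' : Set (TS d)} {σ : ℝ} (hσ : 0 < σ) {φ : TS d → ℝ} (h : IsTest V φ)
    (hV : ∀ z, scl σ z ∈ V → z ∈ V') : IsTest V' fun z => φ (scl σ z) :=
  ⟨h.smooth.comp (contDiff_scl σ), hasCompactSupport_comp_scl hσ h.compact,
    (tsupport_comp_scl_subset σ φ).trans fun z hz => hV z (h.supp hz)⟩

lemma dir_ex_comp_scl {φ : TS d → ℝ} (hφ : ContDiff ℝ 1 φ) (σ : ℝ) (i : Fin d) (z : TS d) :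
    dir (ex i) (fun w => φ (scl σ w)) z = σ * dir (ex i) φ (scl σ z) := by
  rw [dir_comp_scl σ _ z (hφ.differentiable one_ne_zero _), scl_ex, dir_smul]

lemma dir_et_comp_scl {φ : TS d → ℝ} (hφ : ContDiff ℝ 1 φ) (σ : ℝ) (z : TS d) :
    dir et (fun w => φ (scl σ w)) z = σ ^ 2 * dir et φ (scl σ z) := by
  rw [dir_comp_scl σ _ z (hφ.differentiable one_ne_zero _), scl_et, dir_smul]

/-- The potential is divided by σ so that its gradient and flux are composed with the dilation
without extra factors. Both sides of ∂ₜu = ∇ · g then acquire the same factor σ, and both sides of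
the equation for q the factor σ². -/
lemma WeakSol.comp_scl {V V' : Set (TS d)} {σ : ℝ} (hσ : 0 < σ) {u : TS d → ℝ}
    {p g q f : Fin d → TS d → ℝ} (h : WeakSol V u p g q f) (hV : ∀ z ∈ V', scl σ z ∈ V) :
    WeakSol V' (fun z => σ⁻¹ * u (scl σ z)) (fun i z => p i (scl σ z)) (fun i z => g i (scl σ z))
      (fun i z => q i (scl σ z)) (fun i z => f i (scl σ z)) := by
  have hti {φ : TS d → ℝ} (hφ : IsTest V' φ) : IsTest V fun z => φ (scl σ⁻¹ z) :=
    hφ.comp_scl (inv_pos.2 hσ) fun z hz => by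
      have := hV _ hz
      rwa [scl_scl, mul_inv_cancel₀ hσ.ne', scl_one] at this
  have hback (z : TS d) : scl σ⁻¹ (scl σ z) = z := by
    rw [scl_scl, inv_mul_cancel₀ hσ.ne', scl_one]
  have hx {φ : TS d → ℝ} (hφ : ContDiff ℝ 1 φ) (i : Fin d) (z : TS d) :
      dir (ex i) φ z = σ * dir (ex i) (fun z => φ (scl σ⁻¹ z)) (scl σ z) := by
    rw [dir_ex_comp_scl hφ, hback, ← mul_assoc, mul_inv_cancel₀ hσ.ne', one_mul]
  have ht {φ : TS d → ℝ} (hφ : ContDiff ℝ 1 φ) (z : TS d) :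
      dir et φ z = σ ^ 2 * dir et (fun z => φ (scl σ⁻¹ z)) (scl σ z) := by
    rw [dir_et_comp_scl hφ, hback]
    field_simp
  have key (F G : TS d → ℝ) (c : ℝ) : ∫ z, F (scl σ z) * (c * G (scl σ z)) =
      c * ((σ ^ (d + 2))⁻¹ * ∫ z, F z * G z) := by
    rw [← integral_comp_scl hσ fun z => F z * G z, ← integral_const_mul]
    congr 1; ext z; ring
  have key' (F G : TS d → ℝ) (c c' : ℝ) : ∫ z, c' * F (scl σ z) * (c * G (scl σ z)) =
      c' * c * ((σ ^ (d + 2))⁻¹ * ∫ z, F z * G z) := by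
    rw [← integral_comp_scl hσ fun z => F z * G z, ← integral_const_mul]
    congr 1; ext z; ring
  refine ⟨(memLp_comp_scl hσ h.u_memLp).const_mul _, fun i => memLp_comp_scl hσ (h.p_memLp i),
    fun i => memLp_comp_scl hσ (h.g_memLp i), fun i => memLp_comp_scl hσ (h.q_memLp i),
    fun i => memLp_comp_scl hσ (h.f_memLp i), fun i => hasCompactSupport_comp_scl hσ (h.p_supp i),
    fun i => hasCompactSupport_comp_scl hσ (h.g_supp i),
    fun i => hasCompactSupport_comp_scl hσ (h.q_supp i),
    fun i => hasCompactSupport_comp_scl hσ (h.f_supp i), ?_, ?_, ?_, ?_⟩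
  · intro φ hφ i
    have e := h.grad_u _ (hti hφ) i
    have e2 : ∫ z, p i (scl σ z) * φ z =
        1 * ((σ ^ (d + 2))⁻¹ * ∫ z, p i z * φ (scl σ⁻¹ z)) := by
      rw [← key]
      congr 1; ext z; rw [hback, one_mul]
    simp only [hx (contDiff_one_of_infty hφ.smooth)]
    rw [key', e, e2, inv_mul_cancel₀ hσ.ne']
    ring
  · intro φ hφ
    have e := h.dt_u _ (hti hφ)
    have h1 := contDiff_one_of_infty hφ.smooth
    simp only [hx h1, ht h1, key, key', ← Finset.mul_sum, e]
    field_simp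
  · intro φ hφ i j
    have e := h.curl_q _ (hti hφ) i j
    simp only [hx (contDiff_one_of_infty hφ.smooth), key, e]
  · intro φ hφ i
    have e := h.dt_q _ (hti hφ) i
    have h1 := contDiff_one_of_infty hφ.smooth
    have hxx (j : Fin d) (z : TS d) : dir (ex j) (dir (ex i) φ) z =
        σ ^ 2 * dir (ex j) (dir (ex i) (fun z => φ (scl σ⁻¹ z))) (scl σ z) := by
      have e3 : dir (ex i) φ = fun z => σ • dir (ex i) (fun z => φ (scl σ⁻¹ z)) (scl σ z) := by
        ext z; exact hx h1 i z
      have hs := contDiff_one_of_infty (contDiff_dir_infty (hti hφ).smooth (ex i))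
      have e4 : dir (ex j) (fun z => σ • dir (ex i) (fun z => φ (scl σ⁻¹ z)) (scl σ z)) z =
          σ • dir (ex j) (fun z => dir (ex i) (fun z => φ (scl σ⁻¹ z)) (scl σ z)) z := by
        unfold dir
        rw [fderiv_fun_const_smul]
        · rfl
        · exact (hs.comp (contDiff_scl σ)).differentiable one_ne_zero z
      rw [e3, e4, dir_ex_comp_scl hs, smul_eq_mul]
      ring
    simp only [hxx, ht h1, key, ← Finset.mul_sum, e]
    ring

/-! ### Normalized norms of smooth functions on a cylinder -/

lemma enorm_sq_eq_ofReal {E : Type*} [SeminormedAddCommGroup E] (x : E) :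
    ‖x‖ₑ ^ 2 = ENNReal.ofReal (‖x‖ ^ 2) := by
  rw [← ofReal_norm, ENNReal.ofReal_pow (norm_nonneg x)]

lemma eLpNorm_two_sq {α E : Type*} [MeasurableSpace α] [SeminormedAddCommGroup E] (f : α → E)
    (μ : Measure α) : eLpNorm f 2 μ ^ 2 = ∫⁻ x, ‖f x‖ₑ ^ 2 ∂μ := by
  have := eLpNorm_nnreal_pow_eq_lintegral (f := f) (μ := μ) (p := 2) two_ne_zero
  simpa using this

lemma ennreal_add_sq_le (a b : ℝ≥0∞) : (a + b) ^ 2 ≤ 2 * (a ^ 2 + b ^ 2) := by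
  induction a using ENNReal.recTopCoe with
  | top => simp
  | coe a =>
    induction b using ENNReal.recTopCoe with
    | top => simp
    | coe b =>
      have h : (a + b) ^ 2 ≤ 2 * (a ^ 2 + b ^ 2) := add_sq_le
      exact_mod_cast h

section Cylinder

variable {I : Set ℝ} {U : Set (Space d)} {L : ℝ}

lemma volume_cylinder (hL : 0 < L) (hI : volume I = ENNReal.ofReal (L ^ 2))
    (hU : volume U = ENNReal.ofReal (L ^ d)) :
    volume (I ×ˢ U) = ENNReal.ofReal (L ^ (d + 2)) := by
  rw [Measure.volume_eq_prod, Measure.prod_prod, hI, hU, ← ENNReal.ofReal_mul (by positivity),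
    ← pow_add, add_comm]

lemma inv_volume_cylinder (hL : 0 < L) (hI : volume I = ENNReal.ofReal (L ^ 2))
    (hU : volume U = ENNReal.ofReal (L ^ d)) :
    (volume (I ×ˢ U))⁻¹ = ENNReal.ofReal ((L ^ (d + 2))⁻¹) := by
  rw [volume_cylinder hL hI hU, ENNReal.ofReal_inv_of_pos (by positivity)]

lemma integral_nvol (hL : 0 < L) (hI : volume I = ENNReal.ofReal (L ^ 2))
    (hU : volume U = ENNReal.ofReal (L ^ d)) (F : TS d → ℝ) :
    ∫ z, F z ∂(nvol (I ×ˢ U)) = (L ^ (d + 2))⁻¹ * ∫ z in I ×ˢ U, F z := by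
  rw [nvol, integral_smul_measure, inv_volume_cylinder hL hI hU,
    ENNReal.toReal_ofReal (by positivity), smul_eq_mul]

lemma lintegral_nvol_prod (hL : 0 < L) (hI : volume I = ENNReal.ofReal (L ^ 2))
    (hU : volume U = ENNReal.ofReal (L ^ d)) {G : TS d → ℝ≥0∞} (hG : Measurable G) :
    ∫⁻ t, ∫⁻ x, G (t, x) ∂(nvol U) ∂(nvol I) = ∫⁻ z, G z ∂(nvol (I ×ˢ U)) := by
  simp only [nvol, lintegral_smul_measure, smul_eq_mul]
  rw [lintegral_const_mul' _ _ (by rw [hU]; simp; positivity), ← mul_assoc,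
    Measure.volume_eq_prod ℝ (Space d), setLIntegral_prod _ hG.aemeasurable, Measure.prod_prod,
    ENNReal.mul_inv (by rw [hU]; simp) (by rw [hI]; simp)]

/-- The normalized `L²` mass of a square integrable function that vanishes outside the cylinder. -/
lemma lintegral_ofReal_nvol (hL : 0 < L) (hI : volume I = ENNReal.ofReal (L ^ 2))
    (hU : volume U = ENNReal.ofReal (L ^ d)) {F : TS d → ℝ} (hF : Integrable F)
    (h0 : ∀ z, 0 ≤ F z) (hz : ∀ z, z ∉ I ×ˢ U → F z = 0) :
    ∫⁻ z, ENNReal.ofReal (F z) ∂(nvol (I ×ˢ U)) =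
      ENNReal.ofReal ((L ^ (d + 2))⁻¹ * ∫ z, F z) := by
  rw [nvol, lintegral_smul_measure, inv_volume_cylinder hL hI hU,
    ← ofReal_integral_eq_lintegral_ofReal hF.integrableOn (ae_of_all _ h0),
    setIntegral_eq_integral_of_forall_compl_eq_zero hz, smul_eq_mul,
    ← ENNReal.ofReal_mul (by positivity)]

lemma normL2H1_sq (w : TS d → ℝ) (W : TS d → Space d) :
    normL2H1 I U w W ^ 2 =
      ∫⁻ t, normH1 U (fun x => w (t, x)) (fun x => W (t, x)) ^ 2 ∂(nvol I) := by
  rw [normL2H1, ← ENNReal.rpow_natCast, ← ENNReal.rpow_mul]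
  norm_num

lemma volume_rpow_eq (hd : d ≠ 0) (hL : 0 < L) (hU : volume U = ENNReal.ofReal (L ^ d)) :
    (volume U).toReal ^ (-(1 / (d : ℝ))) = L⁻¹ := by
  rw [hU, ENNReal.toReal_ofReal (by positivity), Real.rpow_neg (by positivity), one_div,
    Real.pow_rpow_inv_natCast hL.le hd]

/-- The upper bound is used for the competitor w, the two lower bounds for the functions φ against
which ∂ₜw is tested. Passing to squares turns the iterated norms into space-time integrals. -/
lemma normL2H1_sq_bounds (hd : d ≠ 0) (hL : 0 < L) (hI : volume I = ENNReal.ofReal (L ^ 2))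
    (hU : volume U = ENNReal.ofReal (L ^ d)) {w : TS d → ℝ} (hw : ContDiff ℝ 1 w)
    (hc : HasCompactSupport w) (hs : tsupport w ⊆ I ×ˢ U) :
    normL2H1 I U w (grad w) ^ 2 ≤ 2 * (ENNReal.ofReal (L⁻¹ ^ 2 * ((L ^ (d + 2))⁻¹ * ∫ z, w z ^ 2)) +
      ENNReal.ofReal ((L ^ (d + 2))⁻¹ * ∑ i, ∫ z, dir (ex i) w z ^ 2)) ∧
    ENNReal.ofReal (L⁻¹ ^ 2 * ((L ^ (d + 2))⁻¹ * ∫ z, w z ^ 2)) ≤ normL2H1 I U w (grad w) ^ 2 ∧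
    ENNReal.ofReal ((L ^ (d + 2))⁻¹ * ∑ i, ∫ z, dir (ex i) w z ^ 2) ≤
      normL2H1 I U w (grad w) ^ 2 := by
  have hz {z : TS d} (hz : z ∉ I ×ˢ U) : z ∉ tsupport w := fun h => hz (hs h)
  have hgc : Continuous (grad w) :=
    (PiLp.continuous_toLp 2 _).comp (continuous_pi fun i => continuous_dir hw (ex i))
  have ew : ∫⁻ z, ‖w z‖ₑ ^ 2 ∂(nvol (I ×ˢ U)) = ENNReal.ofReal ((L ^ (d + 2))⁻¹ * ∫ z, w z ^ 2) := by
    rw [← lintegral_ofReal_nvol hL hI hU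
      (memLp_of_compact hw.continuous hc 2 volume).integrable_sq (fun z => sq_nonneg _)
      fun z h => by rw [image_eq_zero_of_notMem_tsupport (hz h)]; simp]
    simp only [enorm_sq_eq_ofReal, Real.norm_eq_abs, sq_abs]
  have eg : ∫⁻ z, ‖grad w z‖ₑ ^ 2 ∂(nvol (I ×ˢ U)) =
      ENNReal.ofReal ((L ^ (d + 2))⁻¹ * ∑ i, ∫ z, dir (ex i) w z ^ 2) := by
    have hi (i : Fin d) : Integrable fun z => dir (ex i) w z ^ 2 :=
      (memLp_of_compact (continuous_dir hw (ex i)) (hasCompactSupport_dir hc _) 2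
        volume).integrable_sq
    rw [← integral_finsetSum _ fun i _ => hi i, ← lintegral_ofReal_nvol hL hI hU
      (integrable_finsetSum _ fun i _ => hi i) (fun z => Finset.sum_nonneg fun i _ => sq_nonneg _)
      fun z h => Finset.sum_eq_zero fun i _ => by
        rw [image_eq_zero_of_notMem_tsupport fun h' => hz h (tsupport_dir_subset w _ h')]; simp]
    simp only [enorm_sq_eq_ofReal, EuclideanSpace.real_norm_sq_eq, grad_apply]
  have mw : Measurable fun z => ‖w z‖ₑ ^ 2 := hw.continuous.enorm.measurable.pow_const 2
  have mg : Measurable fun z => ‖grad w z‖ₑ ^ 2 := hgc.enorm.measurable.pow_const 2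
  have hL2 : ENNReal.ofReal L⁻¹ ^ 2 = ENNReal.ofReal (L⁻¹ ^ 2) :=
    (ENNReal.ofReal_pow (by positivity) 2).symm
  have e1 : ENNReal.ofReal (L⁻¹ ^ 2 * ((L ^ (d + 2))⁻¹ * ∫ z, w z ^ 2)) =
      ∫⁻ t, (ENNReal.ofReal L⁻¹ * eLpNorm (fun x => w (t, x)) 2 (nvol U)) ^ 2 ∂(nvol I) := by
    simp only [mul_pow, eLpNorm_two_sq]
    rw [lintegral_const_mul' _ _ (by simp), lintegral_nvol_prod hL hI hU mw, ew, hL2,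
      ENNReal.ofReal_mul (by positivity)]
  have e2 : ENNReal.ofReal ((L ^ (d + 2))⁻¹ * ∑ i, ∫ z, dir (ex i) w z ^ 2) =
      ∫⁻ t, eLpNorm (fun x => grad w (t, x)) 2 (nvol U) ^ 2 ∂(nvol I) := by
    simp only [eLpNorm_two_sq]
    rw [lintegral_nvol_prod hL hI hU mg, eg]
  have m2 : Measurable fun t => eLpNorm (fun x => grad w (t, x)) 2 (nvol U) ^ 2 := by
    simp only [eLpNorm_two_sq]
    have : SFinite (nvol U) := by unfold nvol; infer_instance
    exact mg.lintegral_prod_right'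
  rw [normL2H1_sq, e1, e2]
  simp only [normH1, volume_rpow_eq hd hL hU]
  refine ⟨?_, ?_, ?_⟩
  · rw [← lintegral_add_right _ m2, ← lintegral_const_mul' _ _ (by simp)]
    exact lintegral_mono fun t => ennreal_add_sq_le _ _
  · exact lintegral_mono fun t => pow_le_pow_left₀ (by simp) le_self_add 2
  · exact lintegral_mono fun t => pow_le_pow_left₀ (by simp) le_add_self 2

/-- A criterion for a smooth function to be an admissible competitor in the dual norm. -/
lemma le_normHatDual (hd : d ≠ 0) (hL : 0 < L) (hI : volume I = ENNReal.ofReal (L ^ 2))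
    (hU : volume U = ENNReal.ofReal (L ^ d)) {w : TS d → ℝ} (hw : ContDiff ℝ 1 w)
    (hc : HasCompactSupport w) (hs : tsupport w ⊆ I ×ˢ U) {κ : ℝ} (hκ0 : 0 ≤ κ)
    (hκ : (2 * d + 11) * κ ≤ 1) (h1 : ∫ z, w z ^ 2 ≤ L ^ (d + 4) * κ ^ 2)
    (h2 : ∀ i, ∫ z, dir (ex i) w z ^ 2 ≤ L ^ (d + 2) * κ ^ 2)
    (h3 : ∀ φ : TS d → ℝ, ContDiff ℝ ∞ φ → HasCompactSupport φ → ∫ z, φ z ^ 2 ≤ L ^ (d + 4) →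
      (∀ i, ∫ z, dir (ex i) φ z ^ 2 ≤ L ^ (d + 2)) →
      |∫ z, w z * dt φ z| ≤ L ^ (d + 2) * (9 * κ)) (F : TS d → ℝ) :
    ENNReal.ofReal ((L ^ (d + 2))⁻¹ * ∫ z in I ×ˢ U, F z * w z) ≤ normHatDual I U F := by
  have hLp : 0 < L ^ (d + 2) := by positivity
  have hw2 : L⁻¹ ^ 2 * ((L ^ (d + 2))⁻¹ * ∫ z, w z ^ 2) ≤ κ ^ 2 := by
    calc _ ≤ L⁻¹ ^ 2 * ((L ^ (d + 2))⁻¹ * (L ^ (d + 4) * κ ^ 2)) := by gcongr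
      _ = κ ^ 2 := by rw [pow_add, pow_add]; field_simp
  have hg2 : (L ^ (d + 2))⁻¹ * ∑ i, ∫ z, dir (ex i) w z ^ 2 ≤ d * κ ^ 2 := by
    calc _ ≤ (L ^ (d + 2))⁻¹ * ∑ _i : Fin d, L ^ (d + 2) * κ ^ 2 := by
          gcongr with i; exact h2 i
      _ = d * κ ^ 2 := by
          rw [Finset.sum_const, Finset.card_univ, Fintype.card_fin, nsmul_eq_mul]; field_simp
  have hb := normL2H1_sq_bounds hd hL hI hU hw hc hs
  -- Together with the 9κ for the time derivative this is (2d + 11)κ ≤ 1.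
  have hn1 : normL2H1 I U w (grad w) ≤ ENNReal.ofReal ((2 * d + 2) * κ) := by
    rw [← ENNReal.pow_le_pow_left_iff two_ne_zero, ← ENNReal.ofReal_pow (by positivity)]
    refine hb.1.trans ?_
    rw [← ENNReal.ofReal_add (by positivity) (by positivity),
      show ∀ x : ℝ, 2 * ENNReal.ofReal x = ENNReal.ofReal (2 * x) from fun x => by
        rw [ENNReal.ofReal_mul zero_le_two]; simp]
    refine ENNReal.ofReal_le_ofReal ?_
    have : (0 : ℝ) ≤ d * κ ^ 2 := by positivity
    have : (0 : ℝ) ≤ d ^ 2 * κ ^ 2 := by positivity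
    nlinarith
  have hn2 : normDt I U w ≤ ENNReal.ofReal (9 * κ) := by
    refine iSup_le fun φ => iSup_le fun hφ => iSup_le fun hn => ENNReal.ofReal_le_ofReal ?_
    have hbφ := normL2H1_sq_bounds hd hL hI hU (contDiff_one_of_infty hφ.smooth) hφ.compact hφ.supp
    have hn' : normL2H1 I U φ (grad φ) ^ 2 ≤ ENNReal.ofReal 1 := by
      simpa using pow_le_pow_left₀ (by simp) hn 2
    have b1 := (ENNReal.ofReal_le_ofReal_iff zero_le_one).1 (hbφ.2.1.trans hn')
    have b2 := (ENNReal.ofReal_le_ofReal_iff zero_le_one).1 (hbφ.2.2.trans hn')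
    rw [inv_mul_le_iff₀ hLp, mul_one] at b2
    rw [← mul_assoc, inv_pow, ← mul_inv, inv_mul_le_iff₀ (by positivity), mul_one, ← pow_add] at b1
    have h := h3 φ hφ.smooth hφ.compact (b1.trans_eq (by ring)) fun i =>
      (Finset.single_le_sum (f := fun i => ∫ z, dir (ex i) φ z ^ 2)
        (fun i _ => integral_nonneg fun z => sq_nonneg _) (Finset.mem_univ i)).trans b2
    rw [integral_nvol hL hI hU, setIntegral_eq_integral_of_forall_compl_eq_zero
      (fun z hz => by rw [image_eq_zero_of_notMem_tsupport fun h => hz (hs h), zero_mul]),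
      ← mul_neg, inv_mul_le_iff₀ hLp]
    exact (neg_le_abs _).trans h
  have hpar : IsHpar I U w (grad w) :=
    ⟨isL2H1_of_contDiff hw hc, hn2.trans_lt ENNReal.ofReal_lt_top⟩
  have hnorm : normHpar I U w (grad w) ≤ 1 := by
    refine (add_le_add hn1 hn2).trans ?_
    rw [← ENNReal.ofReal_add (by positivity) (by positivity), ← ENNReal.ofReal_one]
    exact ENNReal.ofReal_le_ofReal (by linarith)
  rw [← integral_nvol hL hI hU]
  exact le_iSup_of_le w (le_iSup_of_le (grad w) (le_iSup_of_le hpar (le_iSup_of_le hnorm le_rfl)))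

/-- The dual norm at scale `3λ` bounds the rescaled function at unit scale. -/
lemma weakBound_of_normHatDual (hd : d ≠ 0) {σ : ℝ} (hσ : 0 < σ) {V' : Set (TS d)}
    (hI : volume I = ENNReal.ofReal ((3 * σ) ^ 2)) (hU : volume U = ENNReal.ofReal ((3 * σ) ^ d))
    (hV : MeasurableSet (I ×ˢ U)) (hVV : ∀ z ∈ V', scl σ z ∈ I ×ˢ U) {F : TS d → ℝ} {H : ℝ}
    (hF : normHatDual I U F ≤ ENNReal.ofReal H) (hH : 0 ≤ H) :
    WeakBound V' (3 ^ (d + 2) * (2 * d + 11) * σ⁻¹ * H)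
      (fun z => (I ×ˢ U).indicator F (scl σ z)) := by
  intro w K hw hc hs hK b1 b2 b3
  have hσi := inv_pos.2 hσ
  have h3σ : (0 : ℝ) < 3 * σ := by positivity
  set X : ℝ := ∫ z, (I ×ˢ U).indicator F (scl σ z) * w z with hX
  have hback (z : TS d) : scl σ⁻¹ (scl σ z) = z := by
    rw [scl_scl, inv_mul_cancel₀ hσ.ne', scl_one]
  have hback' (z : TS d) : scl σ (scl σ⁻¹ z) = z := by
    rw [scl_scl, mul_inv_cancel₀ hσ.ne', scl_one]
  have hint (G : TS d → ℝ) : ∫ z, G z = σ ^ (d + 2) * ∫ z, G (scl σ z) := by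
    rw [integral_comp_scl hσ, ← mul_assoc, mul_inv_cancel₀ (by positivity), one_mul]
  -- The largest κ for which the rescaled competitor is admissible in the dual norm.
  set κ : ℝ := (2 * d + 11)⁻¹ with hκ
  have hκ0 : 0 < κ := by positivity
  have h3 : ∀ m : ℕ, (1 : ℝ) ≤ 3 ^ m := fun m => one_le_pow₀ (by norm_num)
  -- The competitor is c w∘scl σ⁻¹, normalized through |c|K = σκ. The factor σ reflects the weight
  -- |U|^{-1/d} in the H¹ norm and is the origin of σ⁻¹ in the conclusion.
  have key (c : ℝ) (hcK : |c| * K = σ * κ) :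
      c * ((3 ^ (d + 2))⁻¹ * X) ≤ H := by
    have hcK2 : c ^ 2 * K ^ 2 = σ ^ 2 * κ ^ 2 := by
      rw [← sq_abs c, ← mul_pow, hcK, mul_pow]
    have hwc : ContDiff ℝ 1 fun z => w (scl σ⁻¹ z) :=
      hw.comp (contDiff_scl σ⁻¹)
    have hdc (v z : TS d) : dir v (fun z => c * w (scl σ⁻¹ z)) z =
        c * dir v (fun z => w (scl σ⁻¹ z)) z := by
      unfold dir
      rw [fderiv_const_mul (hwc.differentiable one_ne_zero z)]
      rfl
    have hfin := le_normHatDual hd h3σ hI hU (w := fun z => c * w (scl σ⁻¹ z))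
      (contDiff_const.mul hwc) ((hasCompactSupport_comp_scl hσi hc).mul_left) (fun z hz => by
        have h1 := hs (tsupport_comp_scl_subset σ⁻¹ w (tsupport_mul_subset_right hz))
        have h2 := hVV _ h1
        rwa [hback'] at h2) hκ0.le (mul_inv_cancel₀ (by positivity)).le ?_ ?_ ?_ F
    · refine (ENNReal.ofReal_le_ofReal_iff hH).1 (le_trans (le_of_eq ?_) (hfin.trans hF))
      congr 1
      rw [← integral_indicator_mul hV, hint]
      simp only [hback]
      rw [hX, mul_pow]
      have : ∫ z, (I ×ˢ U).indicator F (scl σ z) * (c * w z) =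
          c * ∫ z, (I ×ˢ U).indicator F (scl σ z) * w z := by
        rw [← integral_const_mul]; congr 1; ext z; ring
      rw [this]
      field_simp
    · rw [hint]
      simp only [hback, mul_pow, integral_const_mul]
      calc σ ^ (d + 2) * (c ^ 2 * ∫ z, w z ^ 2) ≤ σ ^ (d + 2) * (c ^ 2 * K ^ 2) := by gcongr
        _ = 1 * σ ^ (d + 4) * κ ^ 2 := by rw [hcK2]; ring
        _ ≤ _ := by gcongr; exact h3 _
    · intro i
      rw [hint]
      simp only [hdc, dir_ex_comp_scl hw, hback, mul_pow, integral_const_mul]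
      calc σ ^ (d + 2) * (c ^ 2 * (σ⁻¹ ^ 2 * ∫ z, dir (ex i) w z ^ 2))
          ≤ σ ^ (d + 2) * (c ^ 2 * (σ⁻¹ ^ 2 * K ^ 2)) := by gcongr; exact b2 i
        _ = σ ^ (d + 2) * σ⁻¹ ^ 2 * (c ^ 2 * K ^ 2) := by ring
        _ = 1 * σ ^ (d + 2) * κ ^ 2 := by rw [hcK2]; field_simp
        _ ≤ _ := by gcongr; exact h3 _
    · intro φ hφ hφc a1 a2
      have hφ1 := contDiff_one_of_infty hφ
      -- The constant 3^{d+4} is the number 9 · 3^{d+2} built into the hypothesis on the time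
      -- derivative.
      have hB := b3 (fun z => φ (scl σ z)) (3 ^ (d + 4) * σ) (hφ.comp (contDiff_scl σ))
        (hasCompactSupport_comp_scl hσ hφc) (by positivity) (by
          rw [integral_comp_scl hσ fun z => φ z ^ 2, inv_mul_le_iff₀ (by positivity)]
          refine a1.trans ?_
          calc (3 * σ) ^ (d + 4) = 3 ^ (d + 4) * 1 * σ ^ (d + 4) := by rw [mul_pow, mul_one]
            _ ≤ 3 ^ (d + 4) * 3 ^ (d + 4) * σ ^ (d + 4) := by gcongr; exact h3 _
            _ = _ := by ring) (fun i => by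
          simp only [dir_ex_comp_scl hφ1, mul_pow, integral_const_mul]
          rw [integral_comp_scl hσ fun z => dir (ex i) φ z ^ 2]
          calc σ ^ 2 * ((σ ^ (d + 2))⁻¹ * ∫ z, dir (ex i) φ z ^ 2)
              ≤ σ ^ 2 * ((σ ^ (d + 2))⁻¹ * (3 * σ) ^ (d + 2)) := by gcongr; exact a2 i
            _ = 3 ^ (d + 2) * 1 * σ ^ 2 := by rw [mul_pow]; field_simp
            _ ≤ 3 ^ (d + 4) * 3 ^ (d + 4) * σ ^ 2 := by
                gcongr
                · norm_num
                · omega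
                · exact h3 _
            _ = _ := by ring)
      have e : ∫ z, c * w (scl σ⁻¹ z) * dt φ z =
          c * (σ ^ d * ∫ z, w z * dt (fun z => φ (scl σ z)) z) := by
        rw [hint]
        simp only [dt_eq_dir, dir_et_comp_scl hφ1, hback]
        rw [← integral_const_mul, ← integral_const_mul, ← integral_const_mul]
        congr 1; ext z; ring
      rw [e, abs_mul, abs_mul, abs_of_pos (by positivity : 0 < σ ^ d)]
      calc |c| * (σ ^ d * |∫ z, w z * dt (fun z => φ (scl σ z)) z|)
          ≤ |c| * (σ ^ d * (K * (3 ^ (d + 4) * σ))) := by gcongr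
        _ = (|c| * K) * (σ ^ d * (3 ^ (d + 4) * σ)) := by ring
        _ = _ := by rw [hcK]; ring
  have hc0 : 0 < σ * κ / K := by positivity
  -- The dual norm sees only the positive part of the pairing, so both signs of c are used to bound
  -- its absolute value.
  have k1 := key (σ * κ / K) (by rw [abs_of_pos hc0]; field_simp)
  have k2 := key (-(σ * κ / K)) (by rw [abs_neg, abs_of_pos hc0]; field_simp)
  have k3 : σ * κ / K * ((3 ^ (d + 2))⁻¹ * |X|) ≤ H := by
    rcases abs_cases X with h | h <;> rw [h.1] <;> linarith
  have e : |X| = 3 ^ (d + 2) * (2 * d + 11) * σ⁻¹ * (σ * κ / K * ((3 ^ (d + 2))⁻¹ * |X|)) * K := by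
    rw [hκ]; field_simp
  rw [e]
  gcongr

end Cylinder

/-! ### The triadic cylinders -/

lemma isOpen_cylinder (d n : ℕ) : IsOpen (interval n ×ˢ cube d n) := by
  refine isOpen_Ioo.prod ?_
  have : cube d n = ⋂ i, (fun x : Space d => x i) ⁻¹' Ioo (-((3 : ℝ) ^ n / 2)) (3 ^ n / 2) := by
    ext x; simp [cube]
  rw [this]
  exact isOpen_iInter_of_finite fun i => isOpen_Ioo.preimage (by fun_prop)

lemma volume_interval (n : ℕ) : volume (interval n) = ENNReal.ofReal (((3 : ℝ) ^ n) ^ 2) := by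
  rw [interval, Real.volume_Ioo]
  congr 1
  ring

lemma volume_cube (d n : ℕ) : volume (cube d n) = ENNReal.ofReal (((3 : ℝ) ^ n) ^ d) := by
  have e : cube d n = (WithLp.ofLp : Space d → Fin d → ℝ) ⁻¹'
      univ.pi fun _ => Ioo (-((3 : ℝ) ^ n / 2)) (3 ^ n / 2) := by
    ext x; simp [cube]
  rw [e, (PiLp.volume_preserving_ofLp (Fin d)).measure_preimage
    (MeasurableSet.univ_pi fun _ => measurableSet_Ioo).nullMeasurableSet, Real.volume_pi_Ioo]
  simp only [sub_neg_eq_add, add_halves, Finset.prod_const, Finset.card_univ, Fintype.card_fin]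
  rw [← ENNReal.ofReal_pow (by positivity)]

lemma scl_mem_cylinder_iff {d m n : ℕ} {z : TS d} :
    scl ((3 : ℝ) ^ n) z ∈ interval (n + m) ×ˢ cube d (n + m) ↔ z ∈ interval m ×ˢ cube d m := by
  have key (k : ℕ) (x : ℝ) : (3 : ℝ) ^ n * x ∈ Ioo (-((3 : ℝ) ^ n * 3 ^ k / 2)) (3 ^ n * 3 ^ k / 2) ↔
      x ∈ Ioo (-((3 : ℝ) ^ k / 2)) (3 ^ k / 2) := by
    have h : (0 : ℝ) < 3 ^ n := by positivity
    rw [mem_Ioo, mem_Ioo, mul_div_assoc, ← mul_neg, mul_lt_mul_iff_right₀ h, mul_lt_mul_iff_right₀ h]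
  have key2 (x : ℝ) : ((3 : ℝ) ^ n) ^ 2 * x ∈ interval (n + m) ↔ x ∈ interval m := by
    have h : (0 : ℝ) < (3 ^ n) ^ 2 := by positivity
    rw [interval, interval, show 2 * (n + m) = n * 2 + 2 * m by ring, pow_add, pow_mul 3 n 2,
      mem_Ioo, mem_Ioo, mul_div_assoc, ← mul_neg, mul_lt_mul_iff_right₀ h, mul_lt_mul_iff_right₀ h]
  simp only [mem_prod, scl, cube, mem_ofPred_eq, PiLp.smul_apply, smul_eq_mul, pow_add, key2, key]

lemma isBounded_cylinder (d n : ℕ) : Bornology.IsBounded (interval n ×ˢ cube d n) := by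
  refine (Metric.isBounded_Ioo _ _).prod ?_
  have e : cube d n ⊆ (WithLp.ofLp : Space d → Fin d → ℝ) ⁻¹'
      univ.pi fun _ => Icc (-((3 : ℝ) ^ n / 2)) (3 ^ n / 2) :=
    fun x hx i _ => Ioo_subset_Icc_self (hx i)
  refine Bornology.IsBounded.subset ?_ e
  have hc : IsCompact (univ.pi fun _ : Fin d => Icc (-((3 : ℝ) ^ n / 2)) (3 ^ n / 2)) :=
    isCompact_univ_pi fun _ => isCompact_Icc
  exact ((PiLp.homeomorph 2 fun _ : Fin d => ℝ).isCompact_preimage.2 hc).isBounded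

lemma interval_subset_succ (n : ℕ) : interval n ⊆ interval (n + 1) := by
  have h : (3 : ℝ) ^ (2 * n) ≤ 3 ^ (2 * (n + 1)) := pow_le_pow_right₀ (by norm_num) (by omega)
  exact Ioo_subset_Ioo (by linarith) (by linarith)

lemma cube_subset_succ (d n : ℕ) : cube d n ⊆ cube d (n + 1) := by
  have h : (3 : ℝ) ^ n ≤ 3 ^ (n + 1) := pow_le_pow_right₀ (by norm_num) (by omega)
  exact fun x hx i => Ioo_subset_Ioo (by linarith) (by linarith) (hx i)

lemma norm_sq_eq_dens (S : TS d → PairVec d) (z : TS d) :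
    ‖S z‖ ^ 2 = dens (fun i z => S z (Sum.inl i)) (fun i z => S z (Sum.inr i)) z := by
  rw [EuclideanSpace.real_norm_sq_eq, Fintype.sum_sum_type, dens, Finset.sum_add_distrib]

/-- The normalized `L²` norm on a triadic cylinder in terms of rescaled components. -/
lemma eLpNorm_cylinder_sq (n : ℕ) {V : Set (TS d)} (hV : MeasurableSet V)
    (hsub : interval n ×ˢ cube d n ⊆ V) {S : TS d → PairVec d}
    (hS : MemLp S 2 (volume.restrict V)) :
    eLpNorm S 2 (nvol (interval n ×ˢ cube d n)) ^ 2 =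
      ENNReal.ofReal (∫ z in interval 0 ×ˢ cube d 0,
        dens (fun i z => V.indicator (fun z => S z (Sum.inl i)) (scl ((3 : ℝ) ^ n) z))
          (fun i z => V.indicator (fun z => S z (Sum.inr i)) (scl ((3 : ℝ) ^ n) z)) z) := by
  set σ : ℝ := 3 ^ n with hσ
  have hσ0 : 0 < σ := by positivity
  set P : Fin d → TS d → ℝ := fun i => V.indicator fun z => S z (Sum.inl i) with hP
  set G : Fin d → TS d → ℝ := fun i => V.indicator fun z => S z (Sum.inr i) with hG
  set W : Set (TS d) := interval n ×ˢ cube d n with hW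
  have hWm : MeasurableSet W := (isOpen_cylinder d n).measurableSet
  have hW0 : MeasurableSet (interval 0 ×ˢ cube d 0) := (isOpen_cylinder d 0).measurableSet
  have hPG : Integrable (dens P G) :=
    integrable_dens (fun i => (memLp_indicator_iff_restrict hV).2 (hS.eval_piLp _))
      fun i => (memLp_indicator_iff_restrict hV).2 (hS.eval_piLp _)
  have hSd (z : TS d) (hz : z ∈ W) : ‖S z‖ₑ ^ 2 = ENNReal.ofReal (W.indicator (dens P G) z) := by
    rw [enorm_sq_eq_ofReal, norm_sq_eq_dens, indicator_of_mem hz]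
    simp only [dens, hP, hG, indicator_of_mem (hsub hz)]
  have e1 : eLpNorm S 2 (nvol W) ^ 2 = ∫⁻ z, ENNReal.ofReal (W.indicator (dens P G) z) ∂(nvol W) := by
    rw [eLpNorm_two_sq, nvol, lintegral_smul_measure, lintegral_smul_measure,
      setLIntegral_congr_fun hWm hSd]
  rw [e1, hW, lintegral_ofReal_nvol hσ0 (volume_interval n) (volume_cube d n)
    (hPG.indicator hWm) (indicator_nonneg fun z _ => dens_nonneg P G z)
    (fun z hz => indicator_of_notMem hz _), ← integral_comp_scl hσ0, ← integral_indicator hW0]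
  congr 2
  ext z
  have hiff : scl σ z ∈ W ↔ z ∈ interval 0 ×ˢ cube d 0 := scl_mem_cylinder_iff (m := 0) (n := n)
  by_cases hz : z ∈ interval 0 ×ˢ cube d 0
  · rw [indicator_of_mem hz, indicator_of_mem (hiff.2 hz)]
    rfl
  · rw [indicator_of_notMem hz, indicator_of_notMem (mt hiff.1 hz)]

end ParHom

end

/-! ### Reduction of the estimate at scale 3^n to unit scale -/

theorem proposition3p7 (d : ℕ) (hd : 2 ≤ d) (Λ : ℝ) (hΛ : 1 ≤ Λ) :
    ∃ C : ℝ, 0 < C ∧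
      ∀ a : ParHom.TS d → Matrix (Fin d) (Fin d) ℝ, ParHom.IsCoeffField Λ a →
      ∀ n : ℕ, ∀ S ∈ ParHom.solPairs a (ParHom.interval (n + 1)) (ParHom.cube d (n + 1)),
        MeasureTheory.eLpNorm S 2 (ParHom.nvol (ParHom.interval n ×ˢ ParHom.cube d n)) ≤
          ENNReal.ofReal (C * (3 : ℝ) ^ (-(n : ℤ))) *
            ParHom.normHatDualVec (ParHom.interval (n + 1)) (ParHom.cube d (n + 1)) S := by
  have hΛ0 : 0 < Λ := by linarith
  obtain ⟨h, hg⟩ := ParHom.exists_gauge hd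
  set κ : ℝ := 1 + 2 * d ^ 2 * Λ ^ 2 with hκ
  have hκ1 : 1 ≤ κ := by rw [hκ]; have : 0 ≤ 2 * d ^ 2 * Λ ^ 2 := by positivity
                         linarith
  have hCE : 1 ≤ Λ ^ 2 * κ ^ 2 :=
    one_le_mul_of_one_le_of_one_le (one_le_pow₀ hΛ) (one_le_pow₀ hκ1)
  -- The ellipticity constants are those of `bigA_bounds`, so C₀ depends on d and Λ only.
  obtain ⟨C₀, hC₀, hmain⟩ := ParHom.exists_interior_bound hg (ParHom.isOpen_cylinder d 1)
    (cE := Λ⁻¹ / κ) (by positivity) hCE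
  set C₁ : ℝ := 3 ^ (d + 2) * (2 * d + 11) with hC₁
  refine ⟨√C₀ * C₁, by positivity, ?_⟩
  intro a ha n S hS
  set V : Set (ParHom.TS d) := ParHom.interval (n + 1) ×ˢ ParHom.cube d (n + 1) with hV
  have hVm : MeasurableSet V := (ParHom.isOpen_cylinder d (n + 1)).measurableSet
  set σ : ℝ := 3 ^ n with hσ
  have hσ0 : 0 < σ := by positivity
  have hσz : (3 : ℝ) ^ (-(n : ℤ)) = σ⁻¹ := by rw [zpow_neg, zpow_natCast]
  have hσ3 : (3 : ℝ) ^ (n + 1) = 3 * σ := by rw [pow_succ, mul_comm]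
  rw [hσz]
  -- An infinite dual norm makes the claim trivial, the prefactor being positive; otherwise the norm
  -- is a real number H.
  by_cases htop : ParHom.normHatDualVec (ParHom.interval (n + 1)) (ParHom.cube d (n + 1)) S = ⊤
  · rw [htop, ENNReal.mul_top]
    · exact le_top
    · rw [Ne, ENNReal.ofReal_eq_zero, not_le]; positivity
  set H := (ParHom.normHatDualVec (ParHom.interval (n + 1)) (ParHom.cube d (n + 1)) S).toReal
    with hH
  have hHof : ParHom.normHatDualVec (ParHom.interval (n + 1)) (ParHom.cube d (n + 1)) S =
      ENNReal.ofReal H := (ENNReal.ofReal_toReal htop).symm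
  have hH0 : 0 ≤ H := ENNReal.toReal_nonneg
  obtain ⟨u, hu⟩ := ParHom.WeakSol.of_solPairs hΛ0 ha hVm (ParHom.isBounded_cylinder d (n + 1)) hS
  rw [← hV] at hu
  have hmem : ∀ z ∈ ParHom.interval 1 ×ˢ ParHom.cube d 1, ParHom.scl σ z ∈ V := fun z hz =>
    ParHom.scl_mem_cylinder_iff.2 hz
  have hweak (k : Fin d ⊕ Fin d) : ParHom.WeakBound (ParHom.interval 1 ×ˢ ParHom.cube d 1)
      (C₁ * σ⁻¹ * H) (fun z => V.indicator (fun z => S z k) (ParHom.scl σ z)) := by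
    refine ParHom.weakBound_of_normHatDual (by omega) hσ0 ?_ ?_ hVm hmem ?_ hH0
    · rw [ParHom.volume_interval, hσ3]
    · rw [ParHom.volume_cube, hσ3]
    · rw [← hHof]
      exact Finset.single_le_sum (f := fun k => ParHom.normHatDual (ParHom.interval (n + 1))
        (ParHom.cube d (n + 1)) fun z => S z k) (fun _ _ => zero_le) (Finset.mem_univ k)
  have hbound := hmain _ _ _ _ _ (hu.comp_scl hσ0 hmem) (C₁ * σ⁻¹ * H) (by positivity)
    (fun z => by
      by_cases hz : ParHom.scl σ z ∈ V
      · have hb := (ParHom.bigA_bounds hΛ0 (ha.elliptic (ParHom.scl σ z))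
          (ha.bounded (ParHom.scl σ z)) (S (ParHom.scl σ z)).ofLp).1
        simp only [ParHom.dens, indicator_of_mem hz, Finset.sum_add_distrib]
        simp only [Fintype.sum_sum_type, dotProduct] at hb
        refine hb.trans (le_of_eq ?_)
        congr 1
        exact Finset.sum_congr rfl fun i _ => mul_comm _ _
      · simp [ParHom.dens, indicator_of_notMem hz])
    (fun z => by
      by_cases hz : ParHom.scl σ z ∈ V
      · have hb := (ParHom.bigA_bounds hΛ0 (ha.elliptic (ParHom.scl σ z))
          (ha.bounded (ParHom.scl σ z)) (S (ParHom.scl σ z)).ofLp).2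
        simp only [ParHom.dens, indicator_of_mem hz, Finset.sum_add_distrib]
        simp only [Fintype.sum_sum_type] at hb
        rwa [add_comm (∑ i, _ ^ 2)]
      · simp [ParHom.dens, indicator_of_notMem hz])
    (fun i => hweak _) fun i => hweak _
  -- The interior estimate bounds squares, so both sides are squared. The normalized norm on the
  -- n-th cylinder is the rescaled one on the unit cylinder, whose volume is 1.
  rw [hHof, ← ENNReal.ofReal_mul (by positivity), ← ENNReal.pow_le_pow_left_iff two_ne_zero,
    ParHom.eLpNorm_cylinder_sq n hVm
      (prod_mono (ParHom.interval_subset_succ n) (ParHom.cube_subset_succ d n)) hS.1.1,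
    ← ENNReal.ofReal_pow (by positivity)]
  refine ENNReal.ofReal_le_ofReal (hbound.trans (le_of_eq ?_))
  rw [show √C₀ * C₁ * σ⁻¹ * H = √C₀ * (C₁ * σ⁻¹ * H) by ring, mul_pow (√C₀),
    Real.sq_sqrt hC₀.le]
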